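/- **Setting.** Let $\Omega=[0,1]^d$. A *spatial network* is a connected graph with a finite node set $\mathcal N\subset\Omega$; write $x\sim y$ for adjacent nodes. Let $\hat V=\mathbb R^{\mathcal N}$ and, for $\omega\subseteq\Omega$, $u,v\in\hat V$, $$(M_\omega u,v)=\sum_{x\in\mathcal N\cap\omega}\tfrac12\sum_{y\sim x}|x-y|\,u(x)v(x),\qquad (L_\omega v,v)=\sum_{x\in\mathcal N\cap\omega}\tfrac12\sum_{y\sim x}\frac{(v(x)-v(y))^2}{|x-y|},$$ $M=M_\Omega$, $L=L_\Omega$, $|v|_{M,\omega}^2=(M_\omega v,v)$, $|v|_{L,\omega}^2=(L_\omega v,v)$, $|v|_M=|v|_{M,\Omega}$, $|v|_L=|v|_{L,\Omega}$. The box $B_R(x)\subseteq\Omega$ consists of the $z\in\Omega$ with $x_j-R\le z_j<x_j+R$ for every $j$, where $z_j=x_j+R$ is also allowed if $x_j+R=1$. Boxes with $\overline{B_R(x)}=\prod_j[x_j-R,x_j+R]\subseteq\Omega$ are called *inner*. *Mesh.* Let $H=2^{-i}$, $i\in\mathbb N_0$, and let $\mathcal T_H$ be the partition of $\Omega$ into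 the boxes $B_{H/2}(x)$ of side $H$. Let $\Gamma\subseteq\partial\Omega$ be a nonempty union of boundary faces of elements of $\mathcal T_H$, and $V=\{v\in\hat V: v=0 \text{ on }\mathcal N\cap\Gamma\}$. *Network properties.* There are $R_0>0$, $\rho>0$ and $\sigma$ with: (1) $\rho\le(2R)^{-d}|1|^2_{M,B_R(x)}\le\sigma\rho$ for all inner boxes with $R\ge R_0$; (2) for each such box there is a connected subgraph that contains all edges with an endpoint in $B_R(x)$ and no edge with an endpoint outside $B_{R+R_0}(x)$; (3) all edges are shorter than $R_0$; (4) each $y\in\Gamma$ has a node $x\in\mathcal N\cap\Gamma$ with $|x-y|<R_0$. The *Poincaré constant* of the network is the smallest $\mu\ge0$ with: $\min_{a\in\mathbb R}|v-a|_{M,B_R(x)}\le\mu R|v|_{L,B_{R+R_0}(x)}$ for all $v\in\hat V$ and inner boxes with $R\ge R_0$; $|v|_{M,B_R(x)}\le\mu R|v|_{L,B_{R+R_0}(x)}$ for all $v\in V$ and inner boxes with $R\ge2R_0$ such that $\Gamma\cap\overline{B_R(x)}$ contains an axis-parallel $(d-1)$-dimensional cube of side $R$; and $|v|_M\le\mu|v|_L$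 for all $v\in V$. *Operator.* $K=\sum_{x\in\mathcal N}K_x$ with symmetric positive semi-definite $K_x$ supported on $x$ and the nodes adjacent to $x$, and $\alpha(Lv,v)\le(Kv,v)\le\beta(Lv,v)$ for $v\in V$, where $0<\alpha\le\beta$. Let $|v|_K=(Kv,v)^{1/2}$ and $K_T=\sum_{x\in\mathcal N\cap T}K_x$; on $V$, $M^{-1}K$ is the operator with $(M\,M^{-1}Kv,w)=(Kv,w)$ for $v,w\in V$. *Localized multiscale space.* Let $\varphi_j$ be the restrictions to $\mathcal N$ of the Lagrange ($d$-linear) basis functions of the mesh nodes $y_j$, $\hat V_H=\mathrm{span}\{\varphi_j\}$, $V_H=\mathrm{span}\{\varphi_j:y_j\notin\Gamma\}$. Let $T_j$ be the element containing $y_j$, let $\psi_j\in\hat V_H$ satisfy $(M_{T_j}\psi_j,\varphi_\ell)=\delta_{j\ell}$, and let $\mathcal Iv=\sum_{y_j\notin\Gamma}(M_{T_j}\psi_j,v)\varphi_j$. Let $U(\omega)$ be the union of the $T\in\mathcal T_H$ with $\overline T\cap\overline\omega\ne\emptyset$, $U_1=U$, $U_k(\omega)=U_{k-1}(U(\omega))$,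 and $W_k^T=\{v\in V:\mathcal Iv=0,\ \mathrm{supp}\,v\subseteq U_k(T)\}$. For $v\in V_H$ let $\mathcal Q_kv=\sum_{T\in\mathcal T_H}\mathcal Q_k^Tv$, where $\mathcal Q^T_kv\in W^T_k$ solves $(K\mathcal Q_k^Tv,w)=(K_Tv,w)$ for all $w\in W_k^T$. Put $V^{\mathrm{ms}}_{H,k}=\{v-\mathcal Q_kv:v\in V_H\}$, and let $R^{\mathrm{ms}}_k:V\to V^{\mathrm{ms}}_{H,k}$ be the projection orthogonal with respect to $(K\cdot,\cdot)$. *Wave equation and scheme.* Let $T>0$, $f\in C^3([0,T];V)$, and let $u\in C^2([0,T];V)$ solve $(MD_t^2u,v)+(Ku,v)=(Mf,v)$ for all $v\in V$, with $u(0)=g$, $D_tu(0)=h$. Let $N\ge1$, $\tau=T/N$, $t_s=s\tau$, $\partial_tv^n=(v^{n+1}-v^n)/\tau$, $\bar\partial_tv^n=(v^n-v^{n-1})/\tau$, $v^{n+1/2}=\frac12(v^{n+1}+v^n)$. Let $u^{\mathrm{ms},0}_{H,k},\dots,u^{\mathrm{ms},N}_{H,k}\in V^{\mathrm{ms}}_{H,k}$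 satisfy, for $1\le n\le N-1$, $$(M\partial_t\bar\partial_tu^{\mathrm{ms},n}_{H,k},v)+\big(K\tfrac12(u^{\mathrm{ms},n+1/2}_{H,k}+u^{\mathrm{ms},n-1/2}_{H,k}),v\big)=(Mf(t_n),v)\qquad\forall v\in V^{\mathrm{ms}}_{H,k}.$$ **Statement.** There is $c_0>0$, depending only on $d,\sigma,\alpha,\beta$ and an upper bound $\mu$ for the Poincaré constant, such that for all $T>0$, $C_0$, $C_{w,f}$ there is a constant $C$, depending only on $d,\sigma,\mu,\alpha,\beta,T,C_0,C_{w,f}$ (hence not on the fine-scale features of the network and of $K$, nor on $R_0,\rho,H,k,\tau$), with the following property. In the above setting, let $H\ge8dR_0$ and let the integer $k\ge1$ satisfy $k\ge c_0\log(1/H)$ (in particular $k\sim\log(1/H)$ with a large enough factor is allowed). Suppose $$|\partial_tu^{\mathrm{ms},0}_{H,k}-R^{\mathrm{ms}}_k\partial_tu(t_0)|_M+|u^{\mathrm{ms},1/2}_{H,k}-R^{\mathrm{ms}}_ku(t_{1/2})|_K\le C_0(H+\tau^2),$$ where $\partial_tu(t_0)=(u(t_1)-u(t_0))/\tau$, and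 that the data are well-prepared and compatible of order 3, i.e. $$\sum_{j=0}^3\int_0^T|D_t^jf(t)|_M\,dt+\sum_{j=0}^3|w_j|_K+|w_4|_M\le C_{w,f},\qquad w_0=g,\ w_1=h,\ w_{j}=D_t^{j-2}f(0)-M^{-1}Kw_{j-2}.$$ Then for $0\le n\le N-1$ $$|\partial_tu^{\mathrm{ms},n}_{H,k}-D_tu(t_{n+1/2})|_M+|u^{\mathrm{ms},n+1/2}_{H,k}-u(t_{n+1/2})|_K\le C(H+\tau^2).$$ -/

import Mathlib

noncomputable section

open scoped Classical

/-! ### Boxes in the unit cube -/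

/-- The ambient space `ℝ^d` with its Euclidean norm. -/
abbrev Pt (d : ℕ) : Type := EuclideanSpace ℝ (Fin d)

/-- The domain `Ω = [0,1]^d`. -/
def unitCube (d : ℕ) : Set (Pt d) := {z | ∀ j, 0 ≤ z j ∧ z j ≤ 1}

/-- The box `B_R(x)` of side `2R` in `Ω`: half open in every coordinate, except that an upper bound
lying on the boundary of `Ω` is included. -/
def box {d : ℕ} (x : Pt d) (R : ℝ) : Set (Pt d) :=
  {z | z ∈ unitCube d ∧ ∀ j, x j - R ≤ z j ∧ (z j < x j + R ∨ (z j = 1 ∧ x j + R = 1))}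

/-- The closed cube with center `x` and side `2R`. -/
def closedCube {d : ℕ} (x : Pt d) (R : ℝ) : Set (Pt d) :=
  {z | ∀ j, x j - R ≤ z j ∧ z j ≤ x j + R}

/-- The `(d-1)`-dimensional closed cube with center `y` and side `s`, orthogonal to the `j`-th
coordinate direction. -/
def flatCube {d : ℕ} (y : Pt d) (j : Fin d) (s : ℝ) : Set (Pt d) :=
  {z | z j = y j ∧ ∀ l, l ≠ j → y l - s / 2 ≤ z l ∧ z l ≤ y l + s / 2}

/-! ### The coarse mesh of size `H = 2^{-i}` -/

/-- The mesh size `H = 2^{-i}`. -/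
def meshSize (i : ℕ) : ℝ := (2 ^ i : ℝ)⁻¹

/-- Center of the mesh element with index `c`. -/
def elementCenter {d : ℕ} (i : ℕ) (c : Fin d → Fin (2 ^ i)) : Pt d :=
  WithLp.toLp 2 fun j => (((c j : ℕ) : ℝ) + 1 / 2) * meshSize i

/-- The mesh elements `T ∈ 𝒯_H`; they form a partition of `Ω`. -/
def element {d : ℕ} (i : ℕ) (c : Fin d → Fin (2 ^ i)) : Set (Pt d) :=
  box (elementCenter i c) (meshSize i / 2)

/-- The nodes `y_p` of the mesh. -/
def meshNode {d : ℕ} (i : ℕ) (p : Fin d → Fin (2 ^ i + 1)) : Pt d :=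
  WithLp.toLp 2 fun j => ((p j : ℕ) : ℝ) * meshSize i

/-- The Lagrange basis function (`d`-linear hat function) of the mesh node `y_p`. -/
def hat {d : ℕ} (i : ℕ) (p : Fin d → Fin (2 ^ i + 1)) (z : Pt d) : ℝ :=
  ∏ j, max 0 (1 - |z j / meshSize i - ((p j : ℕ) : ℝ)|)

/-- Index of the unique mesh element containing the mesh node `y_p`. -/
def ownElement {d : ℕ} (i : ℕ) (p : Fin d → Fin (2 ^ i + 1)) : Fin d → Fin (2 ^ i) :=
  fun j => ⟨min (p j : ℕ) (2 ^ i - 1), by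
    have h : 0 < 2 ^ i := by positivity
    omega⟩

/-- The part of the closure of the element with index `c` in the hyperplane `z_j = e`; for
`e ∈ {0, 1}` this is an element face on the boundary of `Ω`, or empty. -/
def meshFace {d : ℕ} (i : ℕ) (c : Fin d → Fin (2 ^ i)) (j : Fin d) (e : ℝ) : Set (Pt d) :=
  {z | z j = e ∧ z ∈ closedCube (elementCenter i c) (meshSize i / 2)}

/-- `Γ ⊆ ∂Ω` is a union of element faces. -/
def IsUnionOfBoundaryFaces {d : ℕ} (i : ℕ) (Γ : Set (Pt d)) : Prop :=
  ∀ z ∈ Γ, ∃ c j e, (e = 0 ∨ e = 1) ∧ z ∈ meshFace i c j e ∧ meshFace i c j e ⊆ Γ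

/-- The coarse grid patch `U(ω)`. -/
def patch {d : ℕ} (i : ℕ) (ω : Set (Pt d)) : Set (Pt d) :=
  {x | ∃ c, x ∈ element i c ∧ (closure (element i c) ∩ closure ω).Nonempty}

/-- The iterated patches `U_k(ω)`, with `U_1 = U` and `U_{k+1}(ω) = U_k(U(ω))`. -/
def iterPatch {d : ℕ} (i : ℕ) : ℕ → Set (Pt d) → Set (Pt d)
  | 0, ω => ω
  | k + 1, ω => iterPatch i k (patch i ω)

/-! ### Spatial networks -/

/-- A spatial network: a connected graph on a finite set of nodes in `Ω`. -/
structure SpatialNetwork (d : ℕ) where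
  /-- the nodes -/
  nodes : Finset (Pt d)
  /-- the edges -/
  graph : SimpleGraph nodes
  nodes_mem : ∀ x ∈ nodes, x ∈ unitCube d
  connected : graph.Connected

namespace SpatialNetwork

variable {d : ℕ} (net : SpatialNetwork d)

/-- The space `V̂` of real functions on the nodes. -/
abbrev Fn : Type := net.nodes → ℝ

/-- The space `V` of functions that vanish at the nodes in `Γ`. -/
def V (Γ : Set (Pt d)) : Submodule ℝ net.Fn where
  carrier := {v | ∀ x : net.nodes, (x : Pt d) ∈ Γ → v x = 0}
  add_mem' := by
    intro a b ha hb x hx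
    simp [ha x hx, hb x hx]
  zero_mem' := by
    intro x _
    rfl
  smul_mem' := by
    intro r a ha x hx
    simp [ha x hx]

/-- The diagonal entry of `M` at the node `x`. -/
def massAt (x : net.nodes) : ℝ :=
  (1 / 2) * ∑ y : net.nodes, if net.graph.Adj x y then dist (x : Pt d) (y : Pt d) else 0

/-- `(M_ω u, v)`. -/
def massOn (ω : Set (Pt d)) (u v : net.Fn) : ℝ :=
  ∑ x : net.nodes, if (x : Pt d) ∈ ω then net.massAt x * u x * v x else 0

/-- `(M u, v)`. -/
def mass (u v : net.Fn) : ℝ := net.massOn Set.univ u v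

/-- The norm `|v|_M`. -/
def mNorm (v : net.Fn) : ℝ := √(net.mass v v)

/-- `(L_ω v, v)` for the weighted graph Laplacian. -/
def lapOn (ω : Set (Pt d)) (v : net.Fn) : ℝ :=
  ∑ x : net.nodes, if (x : Pt d) ∈ ω then
    (1 / 2) * ∑ y : net.nodes,
      if net.graph.Adj x y then (v x - v y) ^ 2 / dist (x : Pt d) (y : Pt d) else 0
  else 0

/-- `(L v, v)`. -/
def lap (v : net.Fn) : ℝ := net.lapOn Set.univ v

/-- The network properties: homogeneity, connectivity, locality and boundary density on the scale
`R₀`, with uniformity constant `σ` and density `ρ`. Only boxes contained in `Ω` are considered. -/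
structure HasProperties (Γ : Set (Pt d)) (R₀ σ ρ : ℝ) : Prop where
  R₀_pos : 0 < R₀
  ρ_pos : 0 < ρ
  homogeneity : ∀ (x : Pt d) (R : ℝ), R₀ ≤ R → closedCube x R ⊆ unitCube d →
    ρ ≤ net.massOn (box x R) 1 1 / (2 * R) ^ d ∧
      net.massOn (box x R) 1 1 / (2 * R) ^ d ≤ σ * ρ
  connectivity : ∀ (x : Pt d) (R : ℝ), R₀ ≤ R → closedCube x R ⊆ unitCube d →
    ∃ S : net.graph.Subgraph, S.Connected ∧
      (∀ a b : net.nodes, net.graph.Adj a b → (a : Pt d) ∈ box x R → S.Adj a b) ∧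
      (∀ a b : net.nodes, S.Adj a b → (a : Pt d) ∈ box x (R + R₀))
  locality : ∀ a b : net.nodes, net.graph.Adj a b → dist (a : Pt d) (b : Pt d) < R₀
  boundary_density : ∀ y ∈ Γ, ∃ a : net.nodes, (a : Pt d) ∈ Γ ∧ dist (a : Pt d) y < R₀

/-- `μ` is admissible in the Poincaré inequality on boxes, in the Friedrichs inequality on boxes
that contain a portion of `Γ` of comparable size, and in the Friedrichs inequality on `Ω`. -/
structure IsPoincareBound (Γ : Set (Pt d)) (R₀ μ : ℝ) : Prop where
  nonneg : 0 ≤ μ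
  poincare : ∀ (x : Pt d) (R : ℝ), R₀ ≤ R → closedCube x R ⊆ unitCube d → ∀ v : net.Fn,
    ∃ a : ℝ, √(net.massOn (box x R) (fun y => v y - a) (fun y => v y - a)) ≤
      μ * R * √(net.lapOn (box x (R + R₀)) v)
  friedrichs : ∀ (x : Pt d) (R : ℝ), 2 * R₀ ≤ R → closedCube x R ⊆ unitCube d →
    (∃ y j, flatCube y j R ⊆ Γ ∩ closedCube x R) → ∀ v ∈ net.V Γ,
      √(net.massOn (box x R) v v) ≤ μ * R * √(net.lapOn (box x (R + R₀)) v)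
  global : ∀ v ∈ net.V Γ, net.mNorm v ≤ μ * √(net.lap v)

/-- The Poincaré constant of the network, i.e. the smallest admissible `μ`. It measures how well
the network is connected on scales `R ≥ R₀`. -/
def poincareConst (Γ : Set (Pt d)) (R₀ : ℝ) : ℝ :=
  sInf {μ : ℝ | net.IsPoincareBound Γ R₀ μ}

/-- A local operator `K = ∑ₓ Kₓ`, with symmetric positive semi-definite `Kₓ` supported on `x` and the
nodes adjacent to `x`. -/
structure LocalOperator where
  /-- the operators `Kₓ` -/
  loc : net.nodes → Matrix net.nodes net.nodes ℝ
  posSemidef : ∀ x, (loc x).PosSemidef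
  support : ∀ x y z, loc x y z ≠ 0 →
    (y = x ∨ net.graph.Adj x y) ∧ (z = x ∨ net.graph.Adj x z)

/-- The restrictions `φ_p` of the Lagrange basis functions to the nodes of the network. -/
def basisFn (i : ℕ) (p : Fin d → Fin (2 ^ i + 1)) : net.Fn := fun x => hat i p (x : Pt d)

/-- The space `V̂_H`. -/
def VHhat (i : ℕ) : Submodule ℝ net.Fn := Submodule.span ℝ (Set.range (net.basisFn i))

/-- The space `V_H`, spanned by the basis functions of the mesh nodes outside `Γ`. -/
def VH (Γ : Set (Pt d)) (i : ℕ) : Submodule ℝ net.Fn :=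
  Submodule.span ℝ {v | ∃ p, meshNode i p ∉ Γ ∧ v = net.basisFn i p}

/-- `ψ ∈ V̂_H` satisfies `(M_{T_p} ψ, φ_q) = δ_{pq}` for all `q`. -/
def IsDual (i : ℕ) (p : Fin d → Fin (2 ^ i + 1)) (ψ : net.Fn) : Prop :=
  ψ ∈ net.VHhat i ∧
    ∀ q, net.massOn (element i (ownElement i p)) ψ (net.basisFn i q) = if q = p then 1 else 0

/-- The dual function `ψ_p`. -/
def dualFn (i : ℕ) (p : Fin d → Fin (2 ^ i + 1)) : net.Fn :=
  if h : ∃ ψ, net.IsDual i p ψ then h.choose else 0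

/-- The interpolant `𝓘 : V → V_H`. -/
def interp (Γ : Set (Pt d)) (i : ℕ) (v : net.Fn) : net.Fn :=
  ∑ p : Fin d → Fin (2 ^ i + 1), if meshNode i p ∈ Γ then 0 else
    net.massOn (element i (ownElement i p)) (net.dualFn i p) v • net.basisFn i p

theorem interp_zero (Γ : Set (Pt d)) (i : ℕ) : net.interp Γ i 0 = 0 := by
  simp [interp, massOn]

theorem massOn_add_right (ω : Set (Pt d)) (u v w : net.Fn) :
    net.massOn ω u (v + w) = net.massOn ω u v + net.massOn ω u w := by
  simp only [massOn, ← Finset.sum_add_distrib]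
  refine Finset.sum_congr rfl fun x _ => ?_
  split_ifs <;> simp [mul_add]

theorem massOn_smul_right (ω : Set (Pt d)) (r : ℝ) (u v : net.Fn) :
    net.massOn ω u (r • v) = r * net.massOn ω u v := by
  simp only [massOn, Finset.mul_sum]
  refine Finset.sum_congr rfl fun x _ => ?_
  split_ifs
  · simp only [Pi.smul_apply, smul_eq_mul]
    ring
  · simp

theorem interp_add (Γ : Set (Pt d)) (i : ℕ) (v w : net.Fn) :
    net.interp Γ i (v + w) = net.interp Γ i v + net.interp Γ i w := by
  simp only [interp, ← Finset.sum_add_distrib]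
  refine Finset.sum_congr rfl fun p _ => ?_
  split_ifs
  · simp
  · rw [massOn_add_right, add_smul]

theorem interp_smul (Γ : Set (Pt d)) (i : ℕ) (r : ℝ) (v : net.Fn) :
    net.interp Γ i (r • v) = r • net.interp Γ i v := by
  simp only [interp, Finset.smul_sum]
  refine Finset.sum_congr rfl fun p _ => ?_
  split_ifs
  · simp
  · rw [massOn_smul_right, mul_smul]

/-- The restricted fine-scale space: the functions in `W = {v ∈ V : 𝓘 v = 0}` supported in `ω`. -/
def fineSpaceOn (Γ : Set (Pt d)) (i : ℕ) (ω : Set (Pt d)) : Submodule ℝ net.Fn where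
  carrier := {v | v ∈ net.V Γ ∧ net.interp Γ i v = 0 ∧ ∀ x : net.nodes, (x : Pt d) ∉ ω → v x = 0}
  add_mem' := by
    rintro a b ⟨ha, ha', ha''⟩ ⟨hb, hb', hb''⟩
    refine ⟨add_mem ha hb, ?_, fun x hx => ?_⟩
    · rw [interp_add, ha', hb', add_zero]
    · simp [ha'' x hx, hb'' x hx]
  zero_mem' := ⟨zero_mem _, net.interp_zero Γ i, fun _ _ => rfl⟩
  smul_mem' := by
    rintro r a ⟨ha, ha', ha''⟩
    refine ⟨Submodule.smul_mem _ r ha, ?_, fun x hx => ?_⟩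
    · rw [interp_smul, ha', smul_zero]
    · simp [ha'' x hx]

end SpatialNetwork

/-! ### The operator `K`, the localized multiscale space and the Ritz projection -/

namespace SpatialNetwork.LocalOperator

variable {d : ℕ} {net : SpatialNetwork d} (K : net.LocalOperator)

/-- `(K_ω u, v)` with `K_ω = ∑_{x ∈ ω} Kₓ`. -/
def formOn (ω : Set (Pt d)) (u v : net.Fn) : ℝ :=
  ∑ x : net.nodes, if (x : Pt d) ∈ ω then v ⬝ᵥ ((K.loc x).mulVec u) else 0

/-- `(K u, v)`. -/
def form (u v : net.Fn) : ℝ := K.formOn Set.univ u v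

/-- The norm `|v|_K` on `V`. -/
def kNorm (v : net.Fn) : ℝ := √(K.form v v)

/-- `K` is bounded and coercive on `V` with respect to `L`. -/
def IsBoundedCoercive (Γ : Set (Pt d)) (α β : ℝ) : Prop :=
  0 < α ∧ α ≤ β ∧
    ∀ v ∈ net.V Γ, α * net.lap v ≤ K.form v v ∧ K.form v v ≤ β * net.lap v

/-- The operator `M⁻¹K` on `V`. -/
def invMassK (Γ : Set (Pt d)) (v : net.Fn) : net.Fn :=
  fun x => if (x : Pt d) ∈ Γ then 0 else (∑ y, (K.loc y).mulVec v) x / net.massAt x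

/-- The element `r` of the space `S` with `(K r, w) = F w` for all `w ∈ S`. -/
def galerkin (S : Submodule ℝ net.Fn) (F : net.Fn → ℝ) : net.Fn :=
  if h : ∃ r ∈ S, ∀ w ∈ S, K.form r w = F w then h.choose else 0

/-- The localized corrector `𝒬_k = ∑_T 𝒬_k^T`, where `𝒬_k^T v ∈ W_k^T` solves
`(K 𝒬_k^T v, w) = (K_T v, w)` for all `w ∈ W_k^T`. -/
def corrector (Γ : Set (Pt d)) (i k : ℕ) (v : net.Fn) : net.Fn :=
  ∑ c : Fin d → Fin (2 ^ i),
    K.galerkin (net.fineSpaceOn Γ i (iterPatch i k (element i c))) (K.formOn (element i c) v)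

/-- The localized multiscale space `V_H - 𝒬_k V_H`. -/
def msSpace (Γ : Set (Pt d)) (i k : ℕ) : Submodule ℝ net.Fn :=
  Submodule.span ℝ {z | ∃ v ∈ net.VH Γ i, z = v - K.corrector Γ i k v}

/-- The localized Ritz projection onto the multiscale space. -/
def ritz (Γ : Set (Pt d)) (i k : ℕ) (v : net.Fn) : net.Fn :=
  K.galerkin (K.msSpace Γ i k) (K.form v)

/-! ### The wave equation and the fully discrete scheme -/

/-- `u : [0,T] → V` solves `(M D²u, v) + (K u, v) = (M f, v)` for all `v ∈ V`, with initial values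
`u(0) = g` and `Du(0) = h`. -/
structure IsSolution (Γ : Set (Pt d)) (T : ℝ) (f : ℝ → net.Fn) (g h : net.Fn)
    (u : ℝ → net.Fn) : Prop where
  contDiffOn : ContDiffOn ℝ 2 u (Set.Icc 0 T)
  mem : ∀ t ∈ Set.Icc 0 T, u t ∈ net.V Γ
  eqn : ∀ t ∈ Set.Icc 0 T, ∀ v ∈ net.V Γ,
    net.mass (iteratedDerivWithin 2 u (Set.Icc 0 T) t) v + K.form (u t) v = net.mass (f t) v
  init : u 0 = g
  init_deriv : derivWithin u (Set.Icc 0 T) 0 = h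

/-- The initial data `w_0 = g`, `w_1 = h`, `w_{j+2} = D^j f(0) - M⁻¹K w_j`. -/
def dataSeq (Γ : Set (Pt d)) (T : ℝ) (f : ℝ → net.Fn) (g h : net.Fn) : ℕ → net.Fn
  | 0 => g
  | 1 => h
  | j + 2 => iteratedDerivWithin j f (Set.Icc 0 T) 0 - K.invMassK Γ (dataSeq Γ T f g h j)

/-- The data are well-prepared and compatible of order `m`, with bound `B`. -/
structure IsWellPrepared (Γ : Set (Pt d)) (T : ℝ) (f : ℝ → net.Fn) (g h : net.Fn)
    (m : ℕ) (B : ℝ) : Prop where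
  mem : ∀ t ∈ Set.Icc 0 T, f t ∈ net.V Γ
  contDiffOn : ContDiffOn ℝ m f (Set.Icc 0 T)
  bound : ∑ j ∈ Finset.range (m + 1),
        (∫ t in (0 : ℝ)..T, net.mNorm (iteratedDerivWithin j f (Set.Icc 0 T) t)) +
      ∑ j ∈ Finset.range (m + 1), K.kNorm (K.dataSeq Γ T f g h j) +
      net.mNorm (K.dataSeq Γ T f g h (m + 1)) ≤ B

end SpatialNetwork.LocalOperator

/-- The forward difference quotient `∂_t U^n = (U^{n+1} - U^n) / τ`. -/
def diffQuot {E : Type*} [AddCommGroup E] [Module ℝ E] (τ : ℝ) (U : ℕ → E) (n : ℕ) : E :=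
  τ⁻¹ • (U (n + 1) - U n)

/-- The average `U^{n+1/2} = (U^{n+1} + U^n) / 2`. -/
def midpt {E : Type*} [AddCommGroup E] [Module ℝ E] (U : ℕ → E) (n : ℕ) : E :=
  (2 : ℝ)⁻¹ • (U (n + 1) + U n)

/-- `U^0, …, U^N` is a solution of the localized method with time step `τ`: it lies in the
multiscale space, and for `1 ≤ n ≤ N - 1` (written `n + 1` below)
`(M ∂_t ∂̄_t U^n, v) + (K (U^{n+1/2} + U^{n-1/2}) / 2, v) = (M f(t_n), v)` for all `v` in this space. -/
structure SpatialNetwork.LocalOperator.IsLocalizedScheme {d : ℕ} {net : SpatialNetwork d}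
    (K : net.LocalOperator) (Γ : Set (Pt d)) (i k N : ℕ) (τ : ℝ) (f : ℝ → net.Fn)
    (U : ℕ → net.Fn) : Prop where
  mem : ∀ n ≤ N, U n ∈ K.msSpace Γ i k
  eqn : ∀ n, n + 2 ≤ N → ∀ v ∈ K.msSpace Γ i k,
    net.mass (τ⁻¹ • (diffQuot τ U (n + 1) - diffQuot τ U n)) v +
      K.form ((2 : ℝ)⁻¹ • (midpt U (n + 1) + midpt U n)) v =
    net.mass (f (((n + 1 : ℕ) : ℝ) * τ)) v

end

/-! The error is split at the localized Ritz projection `R`: `U - u = (U - R u) - (u - R u)`.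
Everything rests on a first-order bound for `u - R u` in the energy norm whose constant does not see
the fine scale (`kNorm_sub_ritz_le`); the time stepping is then an energy argument.

Take first the method with unlocalized correctors. Let `v` be the interpolant of `w` and `q` its
corrector. Then `e = w - v + q` lies in the kernel `W` of the interpolant, and since `q` and `v`
have the same `K`-products with `W`, `K(e,e) = K(w,e) = (M M⁻¹K w, e)`. On `W` the `M`-norm is at
most a constant times `H` times the `K`-norm (`mass_le_of_interp_eq_zero`: Poincaré on an element,
Friedrichs near `Γ`). Hence the energy norm of `e` is at most a constant times `H |M⁻¹K w|_M`,
without any spatial regularity of `w`.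

For the localization, each element corrector is approximated by a damped additive Schwarz iteration
over fine-scale functions supported near single mesh nodes. Multiplying by the hat functions and
removing the interpolant gives a stable decomposition with finite overlap (`sum_bilin_split_le`,
`bilin_sum_le`), so every step contracts the `K`-error by a fixed factor (`schwarz_step`), while
locality of `K` lets the support grow by at most `7 H` (`localize_step`). After `m` steps with `1 +
7 m ≤ k` the iterate is a competitor in the `k`-layer patch, and the best approximation property
gives exponential decay in `k`. The triangle inequality over the `H^(-d)` elements and an inverse
estimate cost `H^(-d-1)`; the condition `k ≥ c₀ log(1/H)` supplies `H^(d+2)`, which leaves the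
factor `H`.

In time, the wave equation expresses higher derivatives of `u` through `M⁻¹K` and derivatives of
`f`. Energy estimates for the equation differentiated two and three times bound the derivatives
needed by the data (`regularity`), and `M⁻¹K u^(j) = f^(j) - u^(j+2)` is what the Ritz estimate asks
for. Finally `discrete_energy_estimate` is applied to `θ = U - R u`, whose residual is of size `H +
τ²` by Taylor expansion and the Ritz estimate.

The Poincaré constant is an infimum; the argument runs with `μ + 1`, once some admissible bound is
known to exist (`exists_isPoincareBound`). -/

noncomputable section
open scoped Classical

/-! ### Symmetric positive semi-definite bilinear forms -/

section Form

variable {E : Type*} [AddCommGroup E] [Module ℝ E]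

/-- A symmetric positive semi-definite real bilinear form. -/
structure IsPsdForm (B : E →ₗ[ℝ] E →ₗ[ℝ] ℝ) : Prop where
  symm : ∀ x y, B x y = B y x
  nonneg : ∀ x, 0 ≤ B x x

/-- The seminorm of a positive semi-definite form. -/
def formNorm (B : E →ₗ[ℝ] E →ₗ[ℝ] ℝ) (x : E) : ℝ := √(B x x)

variable {B : E →ₗ[ℝ] E →ₗ[ℝ] ℝ}

theorem formNorm_nonneg (x : E) : 0 ≤ formNorm B x := Real.sqrt_nonneg _

theorem formNorm_zero : formNorm B 0 = 0 := by simp [formNorm]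

namespace IsPsdForm

theorem sq_formNorm (hB : IsPsdForm B) (x : E) :
    formNorm B x ^ 2 = B x x := Real.sq_sqrt (hB.nonneg x)

theorem apply_sq_le (hB : IsPsdForm B) (x y : E) : B x y ^ 2 ≤ B x x * B y y := by
  have := LinearMap.BilinForm.apply_mul_apply_le_of_forall_zero_le B hB.nonneg x y
  rw [hB.symm y x] at this
  rw [sq]
  exact this

theorem abs_apply_le (hB : IsPsdForm B) (x y : E) : |B x y| ≤ formNorm B x * formNorm B y := by
  rw [formNorm, formNorm, ← Real.sqrt_mul (hB.nonneg x)]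
  exact Real.abs_le_sqrt (hB.apply_sq_le x y)

theorem apply_le (hB : IsPsdForm B) (x y : E) : B x y ≤ formNorm B x * formNorm B y :=
  (le_abs_self _).trans (hB.abs_apply_le x y)

theorem apply_add_self (hB : IsPsdForm B) (x y : E) :
    B (x + y) (x + y) = B x x + 2 * B x y + B y y := by
  simp only [map_add, LinearMap.add_apply, hB.symm y x]
  ring

theorem apply_sub_self (hB : IsPsdForm B) (x y : E) :
    B (x - y) (x - y) = B x x - 2 * B x y + B y y := by
  simp only [map_sub, LinearMap.sub_apply, hB.symm y x]
  ring

theorem two_mul_apply_le (hB : IsPsdForm B) (x y : E) : 2 * B x y ≤ B x x + B y y := by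
  have h := hB.nonneg (x - y)
  rw [hB.apply_sub_self] at h
  linarith

theorem apply_sub_self_le (hB : IsPsdForm B) (x y : E) :
    B (x - y) (x - y) ≤ 2 * (B x x + B y y) := by
  have h := hB.nonneg (x + y)
  rw [hB.apply_add_self] at h
  rw [hB.apply_sub_self]
  linarith

theorem formNorm_add_le (hB : IsPsdForm B) (x y : E) :
    formNorm B (x + y) ≤ formNorm B x + formNorm B y := by
  refine Real.sqrt_le_iff.2 ⟨add_nonneg (formNorm_nonneg _) (formNorm_nonneg _), ?_⟩
  rw [hB.apply_add_self, add_sq, hB.sq_formNorm, hB.sq_formNorm]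
  linarith [hB.apply_le x y]

theorem formNorm_smul (r : ℝ) (x : E) : formNorm B (r • x) = |r| * formNorm B x := by
  simp only [formNorm, map_smul, LinearMap.smul_apply, smul_eq_mul]
  rw [← mul_assoc, ← sq, Real.sqrt_mul (sq_nonneg r), Real.sqrt_sq_eq_abs]

theorem formNorm_neg (x : E) : formNorm B (-x) = formNorm B x := by
  simp [formNorm]

theorem formNorm_sub_le (hB : IsPsdForm B) (x y : E) :
    formNorm B (x - y) ≤ formNorm B x + formNorm B y := by
  rw [sub_eq_add_neg]
  exact (hB.formNorm_add_le _ _).trans_eq (by rw [formNorm_neg])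

theorem formNorm_sum_le (hB : IsPsdForm B) {ι : Type*} (s : Finset ι) (x : ι → E) :
    formNorm B (∑ p ∈ s, x p) ≤ ∑ p ∈ s, formNorm B (x p) := by
  induction s using Finset.induction_on with
  | empty => simp [formNorm_zero]
  | insert a s ha ih =>
    rw [Finset.sum_insert ha, Finset.sum_insert ha]
    exact (hB.formNorm_add_le _ _).trans (by gcongr)

/-- A seminorm bound by duality. -/
theorem formNorm_le_of_dual (hB : IsPsdForm B) {x : E} {b : ℝ} (hb : 0 ≤ b)
    (h : ∀ y, B x y ≤ b * formNorm B y) : formNorm B x ≤ b := by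
  have h1 := h x
  rw [← hB.sq_formNorm, sq] at h1
  rcases (formNorm_nonneg (B := B) x).eq_or_lt with h0 | h0
  · rw [← h0]; exact hb
  · exact le_of_mul_le_mul_right h1 h0

/-- The shape in which scalar Taylor remainders arrive: testing with `y` leaves a factor `formNorm B
y`, which duality removes. -/
theorem formNorm_le_of_abs_le (hB : IsPsdForm B) {D b : ℝ} (hb : 0 ≤ b) {x : E}
    (h : ∀ y, |B x y| ≤ b * (D * formNorm B y)) (hD : 0 ≤ D) : formNorm B x ≤ b * D :=
  hB.formNorm_le_of_dual (mul_nonneg hb hD) fun y =>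
    (le_abs_self _).trans ((h y).trans_eq (by ring))

/-- One damped step of an additive Schwarz iteration contracts the error. -/
theorem schwarz_step (hB : IsPsdForm B) {ι : Type*} [Fintype ι] {S : ι → Submodule ℝ E} {C₁ C₂ : ℝ}
    (hC₁ : 0 < C₁) (hC₂ : 0 < C₂) {e : E} {w P : ι → E}
    (hw : ∀ p, w p ∈ S p) (hsum : ∑ p, w p = e)
    (hstab : ∑ p, B (w p) (w p) ≤ C₁ * B e e)
    (hP : ∀ p, P p ∈ S p) (hPe : ∀ p, ∀ y ∈ S p, B (P p) y = B e y)
    (hov : B (∑ p, P p) (∑ p, P p) ≤ C₂ * ∑ p, B (P p) (P p)) :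
    B (e - C₂⁻¹ • ∑ p, P p) (e - C₂⁻¹ • ∑ p, P p) ≤ (1 - 1 / (C₁ * C₂)) * B e e := by
  set Q := ∑ p, B (P p) (P p) with hQ
  have hQ0 : 0 ≤ Q := Finset.sum_nonneg fun p _ => hB.nonneg _
  -- Each `P p` is the `B`-projection of `e` onto `S p`, so pairing it with `e` or with itself is
  -- the same.
  have hPQ : B e (∑ p, P p) = Q := by
    rw [map_sum]
    exact Finset.sum_congr rfl fun p _ => (hPe p _ (hP p)).symm
  have hee : B e e = ∑ p, B (P p) (w p) := by
    calc B e e = B e (∑ p, w p) := by rw [hsum]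
      _ = ∑ p, B e (w p) := map_sum _ _ _
      _ = _ := Finset.sum_congr rfl fun p _ => (hPe p _ (hw p)).symm
  -- `B e e ≤ C₁ Q`
  have hlow : B e e ≤ C₁ * Q := by
    -- Young's inequality weighted by `C₁`: after summation the stability bound lets half of `2 * C₁
    -- * B e e` absorb the `w` terms.
    have h1 : ∀ p, 2 * C₁ * B (P p) (w p) ≤ C₁ ^ 2 * B (P p) (P p) + B (w p) (w p) := by
      intro p
      have := hB.two_mul_apply_le (C₁ • P p) (w p)
      simp only [map_smul, LinearMap.smul_apply, smul_eq_mul] at this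
      nlinarith
    have h2 : 2 * C₁ * B e e ≤ C₁ ^ 2 * Q + C₁ * B e e := by
      rw [hee, Finset.mul_sum, ← hee]
      calc _ ≤ ∑ p, (C₁ ^ 2 * B (P p) (P p) + B (w p) (w p)) := Finset.sum_le_sum fun p _ => h1 p
        _ ≤ _ := by
          rw [Finset.sum_add_distrib, ← Finset.mul_sum]
          gcongr
    have h3 : C₁ * B e e ≤ C₁ * (C₁ * Q) := by nlinarith
    exact le_of_mul_le_mul_left h3 hC₁
  -- With damping `C₂⁻¹` the quadratic term is at most `C₂⁻¹ * Q`, half of the linear gain `2 * C₂⁻¹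
  -- * Q`; the rest is bounded below by `hlow`.
  rw [hB.apply_sub_self]
  simp only [map_smul, LinearMap.smul_apply, smul_eq_mul, hPQ]
  have h4 : C₂⁻¹ * (C₂⁻¹ * B (∑ p, P p) (∑ p, P p)) ≤ C₂⁻¹ * Q := by
    have : C₂⁻¹ * B (∑ p, P p) (∑ p, P p) ≤ Q := by
      rw [inv_mul_le_iff₀ hC₂]; exact hov
    gcongr
  have h5 : 1 / (C₁ * C₂) * B e e ≤ C₂⁻¹ * Q := by
    rw [one_div, mul_inv, mul_comm C₁⁻¹, mul_assoc]
    have : C₁⁻¹ * B e e ≤ Q := by rw [inv_mul_le_iff₀ hC₁]; exact hlow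
    gcongr
  linarith

/-- A form that is definite on a finite-dimensional subspace represents every functional there. -/
theorem exists_riesz [FiniteDimensional ℝ E] {S : Submodule ℝ E}
    (hdef : ∀ x ∈ S, B x x = 0 → x = 0) (F : E →ₗ[ℝ] ℝ) :
    ∃ r ∈ S, ∀ w ∈ S, B r w = F w := by
  let G : S →ₗ[ℝ] Module.Dual ℝ S :=
    { toFun := fun x => (B x).comp S.subtype
      map_add' := fun x y => by ext; simp
      map_smul' := fun r x => by ext; simp }
  have hinj : Function.Injective G := by
    rw [← LinearMap.ker_eq_bot, LinearMap.ker_eq_bot']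
    intro x hx
    have := LinearMap.congr_fun hx x
    exact Subtype.ext (hdef x x.2 (by simpa [G] using this))
  have hsurj : Function.Surjective G :=
    (LinearMap.injective_iff_surjective_of_finrank_eq_finrank
      (Subspace.dual_finrank_eq (K := ℝ) (V := S)).symm).1 hinj
  obtain ⟨r, hr⟩ := hsurj (F.comp S.subtype)
  exact ⟨r, r.2, fun w hw => by simpa [G] using LinearMap.congr_fun hr ⟨w, hw⟩⟩

theorem riesz_unique {S : Submodule ℝ E} (hdef : ∀ x ∈ S, B x x = 0 → x = 0) {F : E → ℝ}
    {r s : E} (hr : r ∈ S) (hs : s ∈ S) (h1 : ∀ w ∈ S, B r w = F w) (h2 : ∀ w ∈ S, B s w = F w) :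
    r = s := by
  refine sub_eq_zero.1 (hdef _ (S.sub_mem hr hs) ?_)
  rw [map_sub B, LinearMap.sub_apply, h1 _ (S.sub_mem hr hs), h2 _ (S.sub_mem hr hs), sub_self]

/-- Galerkin solutions are best approximations. -/
theorem galerkin_best (hB : IsPsdForm B) {S : Submodule ℝ E} {q r : E} (hr : r ∈ S)
    (h : ∀ w ∈ S, B r w = B q w) {x : E} (hx : x ∈ S) :
    B (q - r) (q - r) ≤ B (q - x) (q - x) := by
  have h0 : B (q - r) (r - x) = 0 := by
    rw [map_sub B, LinearMap.sub_apply, h _ (S.sub_mem hr hx), sub_self]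
  have : q - x = (q - r) + (r - x) := by abel
  rw [this, hB.apply_add_self, h0]
  linarith [hB.nonneg (r - x)]

end IsPsdForm

end Form

/-! ### The mass, Laplace and operator forms of a network -/

namespace SpatialNetwork

variable {d : ℕ} (net : SpatialNetwork d)

theorem massAt_nonneg (x : net.nodes) : 0 ≤ net.massAt x := by
  unfold massAt
  refine mul_nonneg (by norm_num) (Finset.sum_nonneg fun y _ => ?_)
  split_ifs
  · exact dist_nonneg
  · exact le_rfl

theorem massOn_comm (ω : Set (Pt d)) (u v : net.Fn) : net.massOn ω u v = net.massOn ω v u := by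
  unfold massOn
  refine Finset.sum_congr rfl fun x _ => ?_
  split_ifs
  · ring
  · rfl

/-- `(M_ω u, v)` as a bilinear form. -/
def massForm (ω : Set (Pt d)) : net.Fn →ₗ[ℝ] net.Fn →ₗ[ℝ] ℝ :=
  LinearMap.mk₂ ℝ (net.massOn ω)
    (fun u v w => by rw [massOn_comm, massOn_add_right, massOn_comm, massOn_comm _ _ w])
    (fun r u v => by rw [massOn_comm, massOn_smul_right, massOn_comm, smul_eq_mul])
    (fun u v w => massOn_add_right ..)
    (fun r u v => by rw [massOn_smul_right, smul_eq_mul])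

theorem massForm_apply (ω : Set (Pt d)) (u v : net.Fn) : net.massForm ω u v = net.massOn ω u v := rfl

theorem massForm_univ_apply (u v : net.Fn) : net.massForm Set.univ u v = net.mass u v := rfl

theorem mNorm_eq_formNorm (v : net.Fn) : net.mNorm v = formNorm (net.massForm Set.univ) v := rfl

theorem massOn_self_nonneg (ω : Set (Pt d)) (v : net.Fn) : 0 ≤ net.massOn ω v v := by
  unfold massOn
  refine Finset.sum_nonneg fun x _ => ?_
  split_ifs
  · rw [mul_assoc]; exact mul_nonneg (net.massAt_nonneg x) (mul_self_nonneg _)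
  · exact le_rfl

theorem isPsdForm_massForm (ω : Set (Pt d)) : IsPsdForm (net.massForm ω) :=
  ⟨net.massOn_comm ω, net.massOn_self_nonneg ω⟩

/-- Comparison of local masses of two functions. -/
theorem massOn_self_le {ω ω' : Set (Pt d)} {u v : net.Fn}
    (h : ∀ x : net.nodes, (x : Pt d) ∈ ω → (x : Pt d) ∈ ω' ∧ |u x| ≤ |v x|) :
    net.massOn ω u u ≤ net.massOn ω' v v := by
  unfold massOn
  refine Finset.sum_le_sum fun x _ => ?_
  by_cases hx : (x : Pt d) ∈ ω
  · rw [if_pos hx, if_pos (h x hx).1, mul_assoc, mul_assoc]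
    refine mul_le_mul_of_nonneg_left ?_ (net.massAt_nonneg x)
    rw [← sq, ← sq]
    exact sq_le_sq.2 (h x hx).2
  · rw [if_neg hx]
    split_ifs
    · rw [mul_assoc]; exact mul_nonneg (net.massAt_nonneg x) (mul_self_nonneg _)
    · exact le_rfl

theorem massOn_self_mono {ω ω' : Set (Pt d)} (h : ω ⊆ ω') (v : net.Fn) :
    net.massOn ω v v ≤ net.massOn ω' v v :=
  net.massOn_self_le fun _ hx => ⟨h hx, le_rfl⟩

theorem massOn_smul_self (ω : Set (Pt d)) (r : ℝ) (v : net.Fn) :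
    net.massOn ω (r • v) (r • v) = r ^ 2 * net.massOn ω v v := by
  rw [massOn_smul_right, massOn_comm, massOn_smul_right]
  ring

theorem mass_eq_sum (u v : net.Fn) : net.mass u v = ∑ x, net.massAt x * u x * v x := by
  simp [mass, massOn]

/-- As soon as there are two nodes, connectedness gives every node an edge, and edges have positive
length. A lone node would have mass zero. -/
theorem massAt_pos [Nontrivial net.nodes] (x : net.nodes) : 0 < net.massAt x := by
  obtain ⟨y, hy⟩ := net.connected.preconnected.exists_adj_of_nontrivial x
  unfold massAt
  refine mul_pos (by norm_num) (Finset.sum_pos' (fun y _ => ?_) ⟨y, Finset.mem_univ _, ?_⟩)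
  · split_ifs
    · exact dist_nonneg
    · exact le_rfl
  · rw [if_pos hy]
    exact dist_pos.2 fun h => hy.ne (Subtype.ext h)

theorem eq_zero_of_mass_self_eq_zero [Nontrivial net.nodes] {v : net.Fn} (h : net.mass v v = 0) :
    v = 0 := by
  rw [mass_eq_sum] at h
  have h0 : ∀ x ∈ Finset.univ, (0 : ℝ) ≤ net.massAt x * v x * v x := fun x _ => by
    rw [mul_assoc]; exact mul_nonneg (net.massAt_nonneg x) (mul_self_nonneg _)
  funext x
  have := (Finset.sum_eq_zero_iff_of_nonneg h0).1 h x (Finset.mem_univ _)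
  rw [mul_assoc] at this
  simpa [(net.massAt_pos x).ne'] using this

/-- The local contribution of the node `x` to `(L v, v)`. -/
def lapAt (v : net.Fn) (x : net.nodes) : ℝ :=
  (1 / 2) * ∑ y : net.nodes,
    if net.graph.Adj x y then (v x - v y) ^ 2 / dist (x : Pt d) (y : Pt d) else 0

theorem lapAt_nonneg (v : net.Fn) (x : net.nodes) : 0 ≤ net.lapAt v x := by
  unfold lapAt
  refine mul_nonneg (by norm_num) (Finset.sum_nonneg fun y _ => ?_)
  split_ifs
  · positivity
  · exact le_rfl

theorem lapOn_eq (ω : Set (Pt d)) (v : net.Fn) :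
    net.lapOn ω v = ∑ x : net.nodes, if (x : Pt d) ∈ ω then net.lapAt v x else 0 := rfl

theorem lap_eq_sum (v : net.Fn) : net.lap v = ∑ x, net.lapAt v x := by
  simp [lap, lapOn_eq]

theorem lapOn_nonneg (ω : Set (Pt d)) (v : net.Fn) : 0 ≤ net.lapOn ω v := by
  rw [lapOn_eq]
  refine Finset.sum_nonneg fun x _ => ?_
  split_ifs
  · exact net.lapAt_nonneg v x
  · exact le_rfl

theorem lap_nonneg (v : net.Fn) : 0 ≤ net.lap v := net.lapOn_nonneg _ v

theorem lapOn_mono {ω ω' : Set (Pt d)} (v : net.Fn)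
    (h : ∀ x : net.nodes, (x : Pt d) ∈ ω → (x : Pt d) ∈ ω') : net.lapOn ω v ≤ net.lapOn ω' v := by
  rw [lapOn_eq, lapOn_eq]
  refine Finset.sum_le_sum fun x _ => ?_
  by_cases hx : (x : Pt d) ∈ ω
  · rw [if_pos hx, if_pos (h x hx)]
  · rw [if_neg hx]
    split_ifs
    · exact net.lapAt_nonneg v x
    · exact le_rfl

theorem lapAt_sub_le (u v : net.Fn) (x : net.nodes) :
    net.lapAt (u - v) x ≤ 2 * (net.lapAt u x + net.lapAt v x) := by
  unfold lapAt
  rw [← mul_add, ← Finset.sum_add_distrib, mul_left_comm, Finset.mul_sum _ _ (2 : ℝ)]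
  refine mul_le_mul_of_nonneg_left (Finset.sum_le_sum fun y _ => ?_) (by norm_num)
  split_ifs
  · rw [← add_div, ← mul_div_assoc]
    refine div_le_div_of_nonneg_right ?_ dist_nonneg
    simp only [Pi.sub_apply]
    nlinarith [sq_nonneg ((u x - u y) + (v x - v y))]
  · simp

theorem lap_sub_le (u v : net.Fn) : net.lap (u - v) ≤ 2 * (net.lap u + net.lap v) := by
  rw [lap_eq_sum, lap_eq_sum, lap_eq_sum, ← Finset.sum_add_distrib, Finset.mul_sum]
  exact Finset.sum_le_sum fun x _ => net.lapAt_sub_le u v x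

/-- The edge-weighted sum of a function of the first endpoint. -/
theorem sum_adj_dist_fst (g : net.nodes → ℝ) :
    ∑ x, (1 / 2) * ∑ y : net.nodes,
      (if net.graph.Adj x y then dist (x : Pt d) (y : Pt d) * g x else 0) =
    ∑ x, net.massAt x * g x := by
  refine Finset.sum_congr rfl fun x _ => ?_
  unfold massAt
  rw [mul_assoc, Finset.sum_mul]
  congr 1
  exact Finset.sum_congr rfl fun y _ => by split_ifs <;> simp

/-- The edge-weighted sum of a function of the second endpoint. -/
theorem sum_adj_dist_snd (g : net.nodes → ℝ) :
    ∑ x, (1 / 2) * ∑ y : net.nodes,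
      (if net.graph.Adj x y then dist (x : Pt d) (y : Pt d) * g y else 0) =
    ∑ x, net.massAt x * g x := by
  rw [← sum_adj_dist_fst, ← Finset.mul_sum, ← Finset.mul_sum, Finset.sum_comm]
  congr 1
  refine Finset.sum_congr rfl fun x _ => Finset.sum_congr rfl fun y _ => ?_
  simp only [net.graph.adj_comm y x, dist_comm (y : Pt d)]

theorem mul_mem_V {Γ : Set (Pt d)} (φ : net.Fn) {v : net.Fn} (hv : v ∈ net.V Γ) :
    φ * v ∈ net.V Γ := by
  intro x hx
  simp [hv x hx]

namespace LocalOperator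

variable {net} (K : net.LocalOperator)

/-- `(K_ω u, v)` as a bilinear form. -/
def bilinOn (ω : Set (Pt d)) : net.Fn →ₗ[ℝ] net.Fn →ₗ[ℝ] ℝ :=
  LinearMap.mk₂ ℝ (K.formOn ω)
    (fun u v w => by
      simp only [formOn, ← Finset.sum_add_distrib]
      refine Finset.sum_congr rfl fun x _ => ?_
      split_ifs <;> simp [Matrix.mulVec_add, dotProduct_add])
    (fun r u v => by
      simp only [formOn, smul_eq_mul, Finset.mul_sum]
      refine Finset.sum_congr rfl fun x _ => ?_
      split_ifs <;> simp [Matrix.mulVec_smul])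
    (fun u v w => by
      simp only [formOn, ← Finset.sum_add_distrib]
      refine Finset.sum_congr rfl fun x _ => ?_
      split_ifs <;> simp [add_dotProduct])
    (fun r u v => by
      simp only [formOn, smul_eq_mul, Finset.mul_sum]
      refine Finset.sum_congr rfl fun x _ => ?_
      split_ifs <;> simp)

/-- `(K u, v)` as a bilinear form. -/
def bilin : net.Fn →ₗ[ℝ] net.Fn →ₗ[ℝ] ℝ := K.bilinOn Set.univ

theorem bilinOn_apply (ω : Set (Pt d)) (u v : net.Fn) : K.bilinOn ω u v = K.formOn ω u v := rfl

theorem bilin_apply (u v : net.Fn) : K.bilin u v = K.form u v := rfl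

theorem kNorm_eq_formNorm (v : net.Fn) : K.kNorm v = formNorm K.bilin v := rfl

theorem loc_form_comm (x : net.nodes) (u v : net.Fn) :
    v ⬝ᵥ ((K.loc x).mulVec u) = u ⬝ᵥ ((K.loc x).mulVec v) := by
  have h := (K.posSemidef x).isHermitian
  rw [Matrix.IsHermitian, Matrix.conjTranspose_eq_transpose_of_trivial] at h
  rw [Matrix.dotProduct_mulVec, ← Matrix.mulVec_transpose, h, dotProduct_comm]

theorem loc_form_nonneg (x : net.nodes) (v : net.Fn) : 0 ≤ v ⬝ᵥ ((K.loc x).mulVec v) := by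
  simpa using (K.posSemidef x).dotProduct_mulVec_nonneg v

theorem isPsdForm_bilinOn (ω : Set (Pt d)) : IsPsdForm (K.bilinOn ω) where
  symm u v := by
    simp only [bilinOn_apply, formOn]
    exact Finset.sum_congr rfl fun x _ => by rw [K.loc_form_comm x u v]
  nonneg v := by
    rw [bilinOn_apply, formOn]
    refine Finset.sum_nonneg fun x _ => ?_
    split_ifs
    · exact K.loc_form_nonneg x v
    · exact le_rfl

theorem isPsdForm_bilin : IsPsdForm K.bilin := K.isPsdForm_bilinOn _

theorem bilinOn_self_le (ω : Set (Pt d)) (v : net.Fn) : K.bilinOn ω v v ≤ K.bilin v v := by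
  rw [bilin, bilinOn_apply, bilinOn_apply, formOn, formOn]
  refine Finset.sum_le_sum fun x _ => ?_
  rw [if_pos (Set.mem_univ _)]
  split_ifs
  · exact le_rfl
  · exact K.loc_form_nonneg x v

/-- Locality: the form vanishes if no stencil around a node of `ω` meets both supports. -/
theorem bilinOn_eq_zero {ω : Set (Pt d)} {u v : net.Fn}
    (h : ∀ x y z : net.nodes, (x : Pt d) ∈ ω → (y = x ∨ net.graph.Adj x y) →
      (z = x ∨ net.graph.Adj x z) → v y = 0 ∨ u z = 0) : K.bilinOn ω u v = 0 := by
  rw [bilinOn_apply, formOn]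
  refine Finset.sum_eq_zero fun x _ => ?_
  split_ifs with hx
  · simp only [dotProduct, Matrix.mulVec, Finset.mul_sum]
    refine Finset.sum_eq_zero fun y _ => Finset.sum_eq_zero fun z _ => ?_
    by_cases hl : K.loc x y z = 0
    · simp [hl]
    · obtain ⟨hy, hz⟩ := K.support x y z hl
      rcases h x y z hx hy hz with h0 | h0 <;> simp [h0]
  · rfl

theorem form_eq_dotProduct (u v : net.Fn) :
    K.form u v = v ⬝ᵥ (∑ y, (K.loc y).mulVec u) := by
  simp [form, formOn, dotProduct_sum]

/-- `M⁻¹K` as a linear map. -/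
def invMassKLin (Γ : Set (Pt d)) : net.Fn →ₗ[ℝ] net.Fn where
  toFun := K.invMassK Γ
  map_add' u v := by
    funext x
    simp only [invMassK, Pi.add_apply, Matrix.mulVec_add, Finset.sum_add_distrib]
    split_ifs
    · simp
    · ring
  map_smul' r v := by
    funext x
    simp only [invMassK, Pi.smul_apply, Matrix.mulVec_smul, ← Finset.smul_sum, smul_eq_mul,
      RingHom.id_apply]
    split_ifs
    · simp
    · ring

theorem invMassKLin_apply (Γ : Set (Pt d)) (v : net.Fn) : K.invMassKLin Γ v = K.invMassK Γ v := rfl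

theorem invMassK_mem_V (Γ : Set (Pt d)) (v : net.Fn) : K.invMassK Γ v ∈ net.V Γ := by
  intro x hx
  simp [invMassK, hx]

/-- Off `Γ` the division by the mass cancels; on `Γ`, where `invMassK` is set to zero, the test
function vanishes. -/
theorem mass_invMassK [Nontrivial net.nodes] {Γ : Set (Pt d)} (v : net.Fn) {w : net.Fn}
    (hw : w ∈ net.V Γ) : net.mass (K.invMassK Γ v) w = K.form v w := by
  rw [form_eq_dotProduct, mass_eq_sum, dotProduct]
  refine Finset.sum_congr rfl fun x _ => ?_
  by_cases hx : (x : Pt d) ∈ Γ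
  · simp [hw x hx]
  · rw [invMassK, if_neg hx, mul_div_cancel₀ _ (net.massAt_pos x).ne', mul_comm]

/-! ### Galerkin solutions -/

/-- Definiteness on `S` rules out the default value in `galerkin`. -/
theorem galerkin_spec {S : Submodule ℝ net.Fn} (hdef : ∀ x ∈ S, K.bilin x x = 0 → x = 0)
    (F : net.Fn →ₗ[ℝ] ℝ) :
    K.galerkin S F ∈ S ∧ ∀ w ∈ S, K.bilin (K.galerkin S F) w = F w := by
  have h : ∃ r ∈ S, ∀ w ∈ S, K.form r w = F w := IsPsdForm.exists_riesz hdef F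
  rw [galerkin, dif_pos h]
  exact h.choose_spec

end LocalOperator

end SpatialNetwork

/-! ### Geometry of the coarse mesh -/

theorem meshSize_pos (i : ℕ) : 0 < meshSize i := by unfold meshSize; positivity

theorem meshSize_le_one (i : ℕ) : meshSize i ≤ 1 := by
  unfold meshSize
  exact inv_le_one_of_one_le₀ (one_le_pow₀ (by norm_num))

theorem two_pow_mul_meshSize (i : ℕ) : (2 : ℝ) ^ i * meshSize i = 1 := by
  unfold meshSize
  exact mul_inv_cancel₀ (by positivity)

/-- For `H = 1` no box of radius `H` fits into the cube, so inner boxes at mesh scale need this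
distinction. -/
theorem meshSize_eq_one_or_le_half (i : ℕ) : meshSize i = 1 ∨ meshSize i ≤ 1 / 2 := by
  cases i with
  | zero => left; simp [meshSize]
  | succ n =>
    right
    have := meshSize_le_one n
    have h : meshSize (n + 1) = meshSize n * (1 / 2) := by
      unfold meshSize; rw [pow_succ, mul_inv]; norm_num
    rw [h]; linarith

theorem div_meshSize_eq_two_pow_iff {i : ℕ} {t : ℝ} : t / meshSize i = 2 ^ i ↔ t = 1 := by
  rw [div_eq_iff (meshSize_pos i).ne', two_pow_mul_meshSize]

theorem div_meshSize_le_two_pow_iff {i : ℕ} {t : ℝ} : t / meshSize i ≤ 2 ^ i ↔ t ≤ 1 := by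
  rw [div_le_iff₀ (meshSize_pos i), two_pow_mul_meshSize]

section Mesh

variable {d : ℕ} {i : ℕ}

/-- Rescaling by `H` turns elements into integer boxes; the second alternative is the closed upper
face on the boundary of `Ω`. -/
theorem mem_element_iff {c : Fin d → Fin (2 ^ i)} {z : Pt d} :
    z ∈ element i c ↔ z ∈ unitCube d ∧ ∀ j, ((c j : ℕ) : ℝ) ≤ z j / meshSize i ∧
      (z j / meshSize i < ((c j : ℕ) : ℝ) + 1 ∨
        (z j / meshSize i = 2 ^ i ∧ ((c j : ℕ) : ℝ) + 1 = 2 ^ i)) := by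
  have hH := meshSize_pos i
  unfold element box
  simp only [Set.mem_ofPred_eq, elementCenter]
  refine and_congr_right fun _ => forall_congr' fun j => ?_
  have e1 : (((c j : ℕ) : ℝ) + 1 / 2) * meshSize i - meshSize i / 2 = (c j : ℕ) * meshSize i := by
    ring
  have e2 : (((c j : ℕ) : ℝ) + 1 / 2) * meshSize i + meshSize i / 2 =
      (((c j : ℕ) : ℝ) + 1) * meshSize i := by ring
  rw [e1, e2, div_meshSize_eq_two_pow_iff, le_div_iff₀ hH, div_lt_iff₀ hH]
  refine and_congr_right fun _ => or_congr_right (and_congr_right fun _ => ?_)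
  rw [← two_pow_mul_meshSize i, mul_left_inj' hH.ne']

theorem abs_sub_elementCenter_le {c : Fin d → Fin (2 ^ i)} {z : Pt d} (hz : z ∈ element i c)
    (j : Fin d) : |z j - elementCenter i c j| ≤ meshSize i / 2 := by
  have h := hz.2 j
  rw [abs_le]
  rcases h with ⟨h1, h2 | ⟨h2, h3⟩⟩ <;> constructor <;> linarith

/-- The mesh element that contains a point of the cube. -/
def cellOf (i : ℕ) (z : Pt d) : Fin d → Fin (2 ^ i) := fun j =>
  -- The minimum puts points with `z j = 1`, where the floor is `2 ^ i`, into the last element.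
  ⟨min ⌊z j / meshSize i⌋₊ (2 ^ i - 1), by
    have h : 0 < 2 ^ i := by positivity
    omega⟩

theorem mem_element_iff_eq_cellOf {c : Fin d → Fin (2 ^ i)} {z : Pt d} (hz : z ∈ unitCube d) :
    z ∈ element i c ↔ cellOf i z = c := by
  rw [mem_element_iff, and_iff_right hz, funext_iff]
  refine forall_congr' fun j => ?_
  rw [Fin.ext_iff]
  have h0 : 0 ≤ z j / meshSize i := div_nonneg (hz j).1 (meshSize_pos i).le
  have h1 : z j / meshSize i ≤ 2 ^ i := div_meshSize_le_two_pow_iff.2 (hz j).2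
  simp only [cellOf]
  set s := z j / meshSize i
  have hc : (c j : ℕ) < 2 ^ i := (c j).2
  constructor
  · rintro ⟨h2, h3 | ⟨h3, h4⟩⟩
    · rw [(Nat.floor_eq_iff h0).2 ⟨h2, h3⟩]
      omega
    · have : ⌊s⌋₊ = 2 ^ i := by rw [h3]; exact_mod_cast Nat.floor_natCast (R := ℝ) (2 ^ i)
      have h5 : (c j : ℕ) + 1 = 2 ^ i := by exact_mod_cast h4
      omega
  · intro h
    have hfl := Nat.floor_le h0
    have hlt := Nat.lt_floor_add_one s
    rcases le_total ⌊s⌋₊ (2 ^ i - 1) with h2 | h2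
    · rw [min_eq_left h2] at h
      rw [← h]
      exact ⟨hfl, Or.inl hlt⟩
    · rw [min_eq_right h2] at h
      have h5 : (c j : ℕ) + 1 = 2 ^ i := by omega
      have h6 : ((c j : ℕ) : ℝ) + 1 = 2 ^ i := by exact_mod_cast h5
      have h7 : ((c j : ℕ) : ℝ) ≤ ⌊s⌋₊ := by
        rw [← h]; exact_mod_cast h2
      refine ⟨h7.trans hfl, ?_⟩
      rcases h1.eq_or_lt with h8 | h8
      · exact Or.inr ⟨h8, h6⟩
      · exact Or.inl (by rw [h6]; exact h8)

theorem mem_element_cellOf {z : Pt d} (hz : z ∈ unitCube d) : z ∈ element i (cellOf i z) :=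
  (mem_element_iff_eq_cellOf hz).2 rfl

/-- The elements partition the cube. -/
theorem sum_ite_mem_element {z : Pt d} (hz : z ∈ unitCube d) (a : ℝ) :
    (∑ c : Fin d → Fin (2 ^ i), if z ∈ element i c then a else 0) = a := by
  simp only [mem_element_iff_eq_cellOf hz]
  simp

/-! #### Counting -/

/-- An open interval of length `2 * r` around `s` meets the integers only in `⌊s⌋ - r + 1, …, ⌊s⌋ +
r`. -/
theorem card_filter_abs_sub_lt (N r : ℕ) (s : ℝ) :
    (Finset.univ.filter fun m : Fin N => |s - ((m : ℕ) : ℝ)| < r).card ≤ 2 * r := by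
  have : (Finset.univ.filter fun m : Fin N => |s - ((m : ℕ) : ℝ)| < r).card ≤
      (Finset.Icc (⌊s⌋ - r + 1) (⌊s⌋ + r)).card := by
    refine Finset.card_le_card_of_injOn (fun m => ((m : ℕ) : ℤ)) ?_ ?_
    · intro m hm
      simp only [Finset.coe_filter, Finset.mem_univ, true_and, Set.mem_ofPred_eq, abs_lt] at hm
      have h1 := Int.floor_le s
      have h2 := Int.lt_floor_add_one s
      simp only [Finset.coe_Icc, Set.mem_Icc]
      constructor
      · have : ((⌊s⌋ - r : ℤ) : ℝ) < ((m : ℕ) : ℤ) := by push_cast; linarith [hm.2]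
        have := Int.cast_lt.1 this
        omega
      · have : (((m : ℕ) : ℤ) : ℝ) < ((⌊s⌋ + r + 1 : ℤ) : ℝ) := by push_cast; linarith [hm.1]
        have := Int.cast_lt.1 this
        omega
    · intro a _ b _ hab
      exact Fin.ext (by simpa using hab)
  refine this.trans ?_
  rw [Int.card_Icc]
  omega

/-- At most `(2 * r)^d` multi-indices are at distance less than `r` from a given point. -/
theorem card_filter_forall_abs_sub_lt (N r : ℕ) (s : Fin d → ℝ) :
    (Finset.univ.filter fun p : Fin d → Fin N => ∀ j, |s j - ((p j : ℕ) : ℝ)| < r).card ≤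
      (2 * r) ^ d := by
  have : (Finset.univ.filter fun p : Fin d → Fin N => ∀ j, |s j - ((p j : ℕ) : ℝ)| < r) =
      Fintype.piFinset fun j => Finset.univ.filter fun m : Fin N => |s j - ((m : ℕ) : ℝ)| < r := by
    ext p
    simp [Fintype.mem_piFinset]
  rw [this, Fintype.card_piFinset]
  calc _ ≤ ∏ _j : Fin d, 2 * r := Finset.prod_le_prod' fun j _ => card_filter_abs_sub_lt N r (s j)
    _ = _ := by simp

/-- Summation over nearby multi-indices. -/
theorem sum_ite_le_of_near {N r : ℕ} (s : Fin d → ℝ) {P : (Fin d → Fin N) → Prop}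
    [DecidablePred P] (hP : ∀ p, P p → ∀ j, |s j - ((p j : ℕ) : ℝ)| < r) {a : ℝ} (ha : 0 ≤ a) :
    (∑ p, if P p then a else 0) ≤ (2 * r : ℝ) ^ d * a := by
  rw [← Finset.sum_filter, Finset.sum_const, nsmul_eq_mul]
  gcongr
  calc ((Finset.univ.filter P).card : ℝ)
      ≤ (Finset.univ.filter fun p : Fin d → Fin N =>
          ∀ j, |s j - ((p j : ℕ) : ℝ)| < r).card := by
        exact_mod_cast Finset.card_le_card fun p hp => by
          simp only [Finset.mem_filter, Finset.mem_univ, true_and] at hp ⊢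
          exact hP p hp
    _ ≤ (2 * r : ℝ) ^ d := by exact_mod_cast card_filter_forall_abs_sub_lt N r s

/-! #### Lagrange basis functions -/

theorem hat_nonneg (p : Fin d → Fin (2 ^ i + 1)) (z : Pt d) : 0 ≤ hat i p z :=
  Finset.prod_nonneg fun _ _ => le_max_left _ _

theorem hat_factor_le_one (s t : ℝ) : max 0 (1 - |s - t|) ≤ 1 :=
  max_le zero_le_one (by linarith [abs_nonneg (s - t)])

theorem hat_le_one (p : Fin d → Fin (2 ^ i + 1)) (z : Pt d) : hat i p z ≤ 1 :=
  Finset.prod_le_one (fun _ _ => le_max_left _ _) fun _ _ => hat_factor_le_one _ _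

theorem abs_div_sub_lt_one_of_hat_ne_zero {p : Fin d → Fin (2 ^ i + 1)} {z : Pt d}
    (h : hat i p z ≠ 0) (j : Fin d) : |z j / meshSize i - ((p j : ℕ) : ℝ)| < 1 := by
  by_contra h'
  refine h (Finset.prod_eq_zero (Finset.mem_univ j) ?_)
  rw [max_eq_left]
  linarith [not_lt.1 h']

theorem abs_sub_meshNode {p : Fin d → Fin (2 ^ i + 1)} (z : Pt d) (j : Fin d) :
    |z j - meshNode i p j| = |z j / meshSize i - ((p j : ℕ) : ℝ)| * meshSize i := by
  have hH := meshSize_pos i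
  rw [← abs_of_pos hH, ← abs_mul, abs_of_pos hH, sub_mul, div_mul_cancel₀ _ hH.ne']
  rfl

theorem abs_sub_meshNode_lt_of_hat_ne_zero {p : Fin d → Fin (2 ^ i + 1)} {z : Pt d}
    (h : hat i p z ≠ 0) (j : Fin d) : |z j - meshNode i p j| < meshSize i := by
  rw [abs_sub_meshNode]
  exact mul_lt_of_lt_one_left (meshSize_pos i) (abs_div_sub_lt_one_of_hat_ne_zero h j)

theorem meshNode_mem_unitCube (p : Fin d → Fin (2 ^ i + 1)) : meshNode i p ∈ unitCube d := by
  intro j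
  have hH := meshSize_pos i
  have : ((p j : ℕ) : ℝ) ≤ 2 ^ i := by exact_mod_cast Nat.lt_succ_iff.1 (p j).2
  refine ⟨mul_nonneg (Nat.cast_nonneg _) hH.le, ?_⟩
  calc ((p j : ℕ) : ℝ) * meshSize i ≤ 2 ^ i * meshSize i := by gcongr
    _ = 1 := two_pow_mul_meshSize i

/-- Adding one more node: for `s ≤ n` the new hat vanishes, and for `s` in `[n, n + 1]` only the
last two hats contribute. -/
theorem sum_hat_one_dim (n : ℕ) {s : ℝ} (h0 : 0 ≤ s) (h1 : s ≤ n) :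
    ∑ m : Fin (n + 1), max 0 (1 - |s - ((m : ℕ) : ℝ)|) = 1 := by
  rw [Fin.sum_univ_eq_sum_range (fun m => max 0 (1 - |s - (m : ℝ)|))]
  induction n with
  | zero =>
    have : s = 0 := le_antisymm (by simpa using h1) h0
    simp [this]
  | succ n ih =>
    rw [Finset.sum_range_succ]
    rcases le_total s n with h | h
    · rw [ih h, max_eq_left, add_zero]
      push_cast
      rw [abs_of_nonpos (by linarith)]
      linarith
    · push_cast at h1 ⊢
      rw [Finset.sum_range_succ, Finset.sum_eq_zero, abs_of_nonneg (by linarith),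
        abs_of_nonpos (by linarith), max_eq_right (by linarith), max_eq_right (by linarith)]
      · ring
      · intro m hm
        have : (m : ℝ) + 1 ≤ n := by exact_mod_cast Finset.mem_range.1 hm
        rw [max_eq_left]
        rw [abs_of_nonneg (by linarith)]
        linarith

/-- The Lagrange basis functions form a partition of unity. -/
theorem sum_hat {z : Pt d} (hz : z ∈ unitCube d) :
    ∑ p : Fin d → Fin (2 ^ i + 1), hat i p z = 1 := by
  unfold hat
  rw [← Fintype.piFinset_univ, ← Finset.prod_univ_sum (fun _ => Finset.univ)
    (fun j (m : Fin (2 ^ i + 1)) => max 0 (1 - |z j / meshSize i - ((m : ℕ) : ℝ)|))]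
  refine Finset.prod_eq_one fun j _ => ?_
  refine sum_hat_one_dim (2 ^ i) (div_nonneg (hz j).1 (meshSize_pos i).le) ?_
  have := (div_meshSize_le_two_pow_iff (i := i)).2 (hz j).2
  exact_mod_cast this

/-- The factors are exchanged one at a time, all others being at most one. This yields the Lipschitz
constant `d / H` of the hat functions. -/
theorem abs_prod_sub_prod_le {ι : Type*} (s : Finset ι) {a b : ι → ℝ}
    (ha : ∀ j, 0 ≤ a j ∧ a j ≤ 1) (hb : ∀ j, 0 ≤ b j ∧ b j ≤ 1) :
    |∏ j ∈ s, a j - ∏ j ∈ s, b j| ≤ ∑ j ∈ s, |a j - b j| := by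
  induction s using Finset.induction_on with
  | empty => simp
  | insert x s hx ih =>
    rw [Finset.prod_insert hx, Finset.prod_insert hx, Finset.sum_insert hx]
    have e : a x * ∏ j ∈ s, a j - b x * ∏ j ∈ s, b j =
        (a x - b x) * ∏ j ∈ s, a j + b x * (∏ j ∈ s, a j - ∏ j ∈ s, b j) := by ring
    rw [e]
    refine (abs_add_le _ _).trans (add_le_add ?_ ?_)
    · rw [abs_mul, abs_of_nonneg (Finset.prod_nonneg fun j _ => (ha j).1)]
      exact mul_le_of_le_one_right (abs_nonneg _)
        (Finset.prod_le_one (fun j _ => (ha j).1) fun j _ => (ha j).2)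
    · rw [abs_mul, abs_of_nonneg (hb x).1]
      exact (mul_le_of_le_one_left (abs_nonneg _) (hb x).2).trans ih

theorem abs_coord_sub_le_dist (x y : Pt d) (j : Fin d) : |x j - y j| ≤ dist x y := by
  rw [← Real.dist_eq]
  exact EuclideanSpace.dist_eq x y ▸ Real.le_sqrt_of_sq_le
    (Finset.single_le_sum (f := fun l => dist (x l) (y l) ^ 2) (fun l _ => sq_nonneg _)
      (Finset.mem_univ j))

theorem abs_hat_sub_le (p : Fin d → Fin (2 ^ i + 1)) (x y : Pt d) :
    |hat i p x - hat i p y| ≤ d * dist x y / meshSize i := by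
  have hH := meshSize_pos i
  unfold hat
  refine (abs_prod_sub_prod_le _ (fun j => ⟨le_max_left _ _, hat_factor_le_one _ _⟩)
    (fun j => ⟨le_max_left _ _, hat_factor_le_one _ _⟩)).trans ?_
  calc _ ≤ ∑ _j : Fin d, dist x y / meshSize i := Finset.sum_le_sum fun j _ => ?_
    _ = _ := by simp [mul_div_assoc]
  have h1 := abs_max_sub_max_le_max 0 (1 - |x j / meshSize i - ((p j : ℕ) : ℝ)|)
    0 (1 - |y j / meshSize i - ((p j : ℕ) : ℝ)|)
  rw [sub_self, abs_zero, max_eq_right (a := (0 : ℝ)) (abs_nonneg _)] at h1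
  refine h1.trans ?_
  have h2 := abs_abs_sub_abs_le (y j / meshSize i - ((p j : ℕ) : ℝ))
    (x j / meshSize i - ((p j : ℕ) : ℝ))
  have e1 : 1 - |x j / meshSize i - ((p j : ℕ) : ℝ)| - (1 - |y j / meshSize i - ((p j : ℕ) : ℝ)|)
    = |y j / meshSize i - ((p j : ℕ) : ℝ)| - |x j / meshSize i - ((p j : ℕ) : ℝ)| := by ring
  have e2 : y j / meshSize i - ((p j : ℕ) : ℝ) - (x j / meshSize i - ((p j : ℕ) : ℝ)) =
    (y j - x j) / meshSize i := by ring
  rw [e1]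
  refine h2.trans ?_
  rw [e2, abs_div, abs_of_pos hH, abs_sub_comm]
  gcongr
  exact abs_coord_sub_le_dist x y j

/-- `p` is a vertex of the element `c`. -/
def IsVertex (c : Fin d → Fin (2 ^ i)) (p : Fin d → Fin (2 ^ i + 1)) : Prop :=
  ∀ j, (p j : ℕ) = c j ∨ (p j : ℕ) = c j + 1

theorem isVertex_ownElement (p : Fin d → Fin (2 ^ i + 1)) : IsVertex (ownElement i p) p := by
  intro j
  have h : 0 < 2 ^ i := by positivity
  have := (p j).2
  simp only [ownElement]
  omega

/-- Stated on the closed element because it is also applied to points of `Γ`, which need not belong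
to the half-open element. -/
theorem isVertex_of_hat_ne_zero {c : Fin d → Fin (2 ^ i)} {p : Fin d → Fin (2 ^ i + 1)} {z : Pt d}
    (hz : ∀ j, ((c j : ℕ) : ℝ) ≤ z j / meshSize i ∧ z j / meshSize i ≤ ((c j : ℕ) : ℝ) + 1)
    (h : hat i p z ≠ 0) : IsVertex c p := by
  intro j
  have h1 := abs_lt.1 (abs_div_sub_lt_one_of_hat_ne_zero h j)
  have h2 := hz j
  have h3 : ((c j : ℕ) : ℝ) < (p j : ℕ) + 1 := by linarith
  have h4 : ((p j : ℕ) : ℝ) < (c j : ℕ) + 2 := by linarith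
  have h5 : (c j : ℕ) < (p j : ℕ) + 1 := by exact_mod_cast h3
  have h6 : (p j : ℕ) < (c j : ℕ) + 2 := by exact_mod_cast h4
  omega

theorem div_meshSize_mem_of_mem_element {c : Fin d → Fin (2 ^ i)} {z : Pt d}
    (hz : z ∈ element i c) (j : Fin d) :
    ((c j : ℕ) : ℝ) ≤ z j / meshSize i ∧ z j / meshSize i ≤ ((c j : ℕ) : ℝ) + 1 := by
  obtain ⟨h1, h2 | ⟨h2, h3⟩⟩ := (mem_element_iff.1 hz).2 j
  · exact ⟨h1, h2.le⟩
  · exact ⟨h1, (h2.trans h3.symm).le⟩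

theorem hat_eq_zero_of_not_isVertex {c : Fin d → Fin (2 ^ i)} {p : Fin d → Fin (2 ^ i + 1)}
    {z : Pt d} (hz : z ∈ element i c) (h : ¬ IsVertex c p) : hat i p z = 0 :=
  by_contra fun hne => h (isVertex_of_hat_ne_zero (div_meshSize_mem_of_mem_element hz) hne)

/-- A vertex is at sup-distance less than one mesh unit from the center of its element. -/
theorem abs_sub_lt_of_isVertex {c : Fin d → Fin (2 ^ i)} {p : Fin d → Fin (2 ^ i + 1)}
    (h : IsVertex c p) (j : Fin d) : |(((c j : ℕ) : ℝ) + 1 / 2) - ((p j : ℕ) : ℝ)| < 1 := by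
  rw [abs_lt]
  rcases h j with h | h <;> rw [h] <;> push_cast <;> constructor <;> linarith

theorem abs_sub_meshNode_le_of_isVertex {c : Fin d → Fin (2 ^ i)} {p : Fin d → Fin (2 ^ i + 1)}
    (h : IsVertex c p) {z : Pt d} (hz : z ∈ element i c) (j : Fin d) :
    |z j - meshNode i p j| ≤ meshSize i := by
  rw [abs_sub_meshNode]
  refine mul_le_of_le_one_left (meshSize_pos i).le ?_
  have := div_meshSize_mem_of_mem_element hz j
  rw [abs_le]
  rcases h j with h | h <;> rw [h] <;> push_cast <;> constructor <;> linarith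

theorem closedCube_elementCenter_subset (c : Fin d → Fin (2 ^ i)) :
    closedCube (elementCenter i c) (meshSize i / 2) ⊆ unitCube d := by
  intro z hz j
  have hH := meshSize_pos i
  have h := hz j
  have hc : (((c j : ℕ) : ℝ) + 1) ≤ 2 ^ i := by exact_mod_cast (c j).2
  have h2 : (((c j : ℕ) : ℝ) + 1) * meshSize i ≤ 1 := by
    calc _ ≤ 2 ^ i * meshSize i := by gcongr
      _ = 1 := two_pow_mul_meshSize i
  have h3 : 0 ≤ ((c j : ℕ) : ℝ) * meshSize i := by positivity
  simp only [elementCenter] at h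
  constructor <;> nlinarith [h.1, h.2]

/-! #### Corner boxes -/

/-- Center of the box of radius `r` in the corner of the element `c` at its vertex `p`. -/
def cornerCenter (c : Fin d → Fin (2 ^ i)) (p : Fin d → Fin (2 ^ i + 1)) (r : ℝ) : Pt d :=
  WithLp.toLp 2 fun j => ((p j : ℕ) : ℝ) * meshSize i + if (p j : ℕ) = c j then r else -r

/-- The homogeneity bound holds only on inner boxes. A small box pushed into the corner at `p` is
one of them, and `hat i p` is close to one on it, so it provides a lower bound for the mass of
coarse functions. -/
theorem cornerBox_subset {c : Fin d → Fin (2 ^ i)} {p : Fin d → Fin (2 ^ i + 1)}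
    (hp : IsVertex c p) {r : ℝ} (hr : 0 < r) (hrH : 2 * r ≤ meshSize i) :
    closedCube (cornerCenter c p r) r ⊆ unitCube d ∧
      box (cornerCenter c p r) r ⊆ element i c ∧
      ∀ z ∈ box (cornerCenter c p r) r, ∀ j, |z j / meshSize i - ((p j : ℕ) : ℝ)| ≤
        2 * r / meshSize i := by
  have hH := meshSize_pos i
  have key : ∀ j, elementCenter i c j - meshSize i / 2 ≤ cornerCenter c p r j - r ∧
      cornerCenter c p r j + r ≤ elementCenter i c j + meshSize i / 2 := by
    intro j
    simp only [elementCenter, cornerCenter]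
    rcases hp j with h | h
    · rw [if_pos h, h]; constructor <;> linarith
    · rw [if_neg (by omega), h]; push_cast; constructor <;> linarith
  refine ⟨fun z hz => closedCube_elementCenter_subset c fun j => ?_, fun z hz => ⟨hz.1, fun j => ?_⟩,
    fun z hz j => ?_⟩
  · exact ⟨(key j).1.trans (hz j).1, (hz j).2.trans (key j).2⟩
  · refine ⟨(key j).1.trans (hz.2 j).1, ?_⟩
    rcases (hz.2 j).2 with h | ⟨h, h'⟩
    · exact Or.inl (h.trans_le (key j).2)
    · rcases (key j).2.eq_or_lt with h2 | h2
      · exact Or.inr ⟨h, by linarith⟩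
      · exact Or.inl (by linarith)
  · rw [le_div_iff₀ hH, ← abs_sub_meshNode]
    have h := hz.2 j
    have h2 : z j ≤ cornerCenter c p r j + r := by
      rcases h.2 with h | ⟨h, h'⟩ <;> linarith
    have h1 := h.1
    simp only [cornerCenter] at h1 h2
    simp only [meshNode]
    rw [abs_le]
    split_ifs at h1 h2 <;> constructor <;> linarith

/-! #### Patches -/

/-- Moving a point of the closed cube slightly towards the center puts it strictly below all upper
faces. -/
theorem closedCube_subset_closure_element (c : Fin d → Fin (2 ^ i)) :
    closedCube (elementCenter i c) (meshSize i / 2) ⊆ closure (element i c) := by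
  intro z hz
  have hH := meshSize_pos i
  have hcl := closedCube_elementCenter_subset c
  have hmem : ∀ t : ℝ, 0 < t → t ≤ 1 → z + t • (elementCenter i c - z) ∈ element i c := by
    intro t ht ht1
    have hj : ∀ j, (z + t • (elementCenter i c - z)) j =
        z j + t * (elementCenter i c j - z j) := fun j => by simp
    have hlow : ∀ j, elementCenter i c j - meshSize i / 2 ≤
        (z + t • (elementCenter i c - z)) j := by
      intro j; rw [hj]; nlinarith [(hz j).1]
    have hup : ∀ j, (z + t • (elementCenter i c - z)) j <
        elementCenter i c j + meshSize i / 2 := by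
      intro j; rw [hj]; nlinarith [(hz j).2]
    exact ⟨hcl fun j => ⟨hlow j, (hup j).le⟩, fun j => ⟨hlow j, Or.inl (hup j)⟩⟩
  have hlim : Filter.Tendsto (fun t : ℝ => z + t • (elementCenter i c - z))
      (nhdsWithin 0 (Set.Ioi 0)) (nhds z) := by
    have h : Continuous fun t : ℝ => z + t • (elementCenter i c - z) := by fun_prop
    have := (h.tendsto 0).mono_left (nhdsWithin_le_nhds (s := Set.Ioi 0))
    simpa using this
  refine mem_closure_of_tendsto hlim ?_
  have h1 : Set.Ioc (0 : ℝ) 1 ∈ nhdsWithin 0 (Set.Ioi 0) := Ioc_mem_nhdsGT one_pos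
  filter_upwards [h1] with t ht
  exact hmem t ht.1 ht.2

/-- The mesh node with the larger of the two indices in each coordinate belongs to both closures. -/
theorem closure_element_inter_nonempty {b c : Fin d → Fin (2 ^ i)}
    (h : ∀ j, (b j : ℕ) ≤ c j + 1 ∧ (c j : ℕ) ≤ b j + 1) :
    (closure (element i b) ∩ closure (element i c)).Nonempty := by
  have hH := meshSize_pos i
  refine ⟨WithLp.toLp 2 fun j => ((max (b j : ℕ) (c j : ℕ) : ℕ) : ℝ) * meshSize i,
    closedCube_subset_closure_element b fun j => ?_,
    closedCube_subset_closure_element c fun j => ?_⟩ <;>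
  · obtain ⟨h1, h2⟩ := h j
    simp only [elementCenter]
    have h1' : ((b j : ℕ) : ℝ) ≤ (c j : ℕ) + 1 := by exact_mod_cast h1
    have h2' : ((c j : ℕ) : ℝ) ≤ (b j : ℕ) + 1 := by exact_mod_cast h2
    push_cast
    rcases le_total ((b j : ℕ) : ℝ) (c j : ℕ) with h3 | h3
    · rw [max_eq_right h3]; constructor <;> nlinarith
    · rw [max_eq_left h3]; constructor <;> nlinarith

/-- Each layer allows the index `c` to move by one towards `b` in all coordinates simultaneously. -/
theorem element_subset_iterPatch (k : ℕ) {ω : Set (Pt d)} {b c : Fin d → Fin (2 ^ i)}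
    (hc : element i c ⊆ ω) (h : ∀ j, (b j : ℕ) ≤ c j + k ∧ (c j : ℕ) ≤ b j + k) :
    element i b ⊆ iterPatch i k ω := by
  induction k generalizing ω c with
  | zero =>
    have : b = c := funext fun j => Fin.ext (by have := h j; omega)
    rw [this]; exact hc
  | succ k ih =>
    rw [iterPatch]
    let a : Fin d → Fin (2 ^ i) := fun j =>
      ⟨if (b j : ℕ) < c j then c j - 1 else if (c j : ℕ) < b j then c j + 1 else c j, by
        have := (b j).2; have := (c j).2; split_ifs <;> omega⟩
    have ha : ∀ j, (a j : ℕ) =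
      if (b j : ℕ) < c j then (c j - 1 : ℕ) else if (c j : ℕ) < b j then c j + 1 else c j :=
      fun j => rfl
    refine ih (c := a) ?_ fun j => ?_
    · intro z hz
      refine ⟨a, hz, ?_⟩
      refine (closure_element_inter_nonempty (b := a) (c := c) fun j => ?_).mono
        (Set.inter_subset_inter_right _ (closure_mono hc))
      rw [ha]; split_ifs <;> omega
    · have := h j
      rw [ha]; split_ifs <;> omega

/-- Points at sup-distance less than `(k + 1/2) H` from the center of an element lie in its
`k`-layer patch. -/
theorem mem_iterPatch_of_near (k : ℕ) {c : Fin d → Fin (2 ^ i)} {z : Pt d} (hz : z ∈ unitCube d)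
    (h : ∀ j, |z j - elementCenter i c j| < (k + 1 / 2) * meshSize i) :
    z ∈ iterPatch i k (element i c) := by
  have hH := meshSize_pos i
  have hb := mem_element_cellOf (i := i) hz
  set b := cellOf i z
  refine element_subset_iterPatch k (b := b) (c := c) subset_rfl (fun j => ?_) hb
  have h1 := abs_sub_elementCenter_le hb j
  have h2 : |(((b j : ℕ) : ℝ) - (c j : ℕ)) * meshSize i| < (k + 1) * meshSize i := by
    have e : (((b j : ℕ) : ℝ) - (c j : ℕ)) * meshSize i =
        (z j - elementCenter i c j) - (z j - elementCenter i b j) := by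
      simp only [elementCenter]; ring
    rw [e]
    refine (abs_sub _ _).trans_lt ?_
    have := h j
    linarith
  rw [abs_mul, abs_of_pos hH] at h2
  have h3 := abs_lt.1 (lt_of_mul_lt_mul_right h2 hH.le)
  have h4 : ((b j : ℕ) : ℝ) < (c j : ℕ) + (k + 1) := by linarith
  have h5 : ((c j : ℕ) : ℝ) < (b j : ℕ) + (k + 1) := by linarith
  have h6 : (b j : ℕ) < (c j : ℕ) + (k + 1) := by exact_mod_cast h4
  have h7 : (c j : ℕ) < (b j : ℕ) + (k + 1) := by exact_mod_cast h5
  omega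

/-! #### Inner boxes around a point -/

/-- Radius of the inner box around a point at mesh scale. -/
def innerRadius (i : ℕ) : ℝ := min (meshSize i) (1 / 2)

/-- Center of an inner box of radius `innerRadius i` around `y`. -/
def innerCenter (i : ℕ) (y : Pt d) : Pt d :=
  WithLp.toLp 2 fun j => max (innerRadius i) (min (y j) (1 - innerRadius i))

theorem innerRadius_le : innerRadius i ≤ meshSize i := min_le_left _ _

theorem half_le_innerRadius : meshSize i / 2 ≤ innerRadius i :=
  le_min (by linarith [meshSize_pos i]) (by linarith [meshSize_le_one i])

theorem closedCube_innerCenter_subset (y : Pt d) :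
    closedCube (innerCenter i y) (innerRadius i) ⊆ unitCube d := by
  intro z hz j
  have h1 : innerRadius i ≤ 1 / 2 := min_le_right _ _
  have h := hz j
  have h2 : innerRadius i ≤ innerCenter i y j := le_max_left _ _
  have h3 : innerCenter i y j ≤ 1 - innerRadius i := max_le (by linarith) (min_le_right _ _)
  constructor <;> linarith [h.1, h.2]

/-- In the last case, `H = 1`, the inner box fills the whole cube; otherwise its radius is `H` and
the center is clamped at distance `H` from the boundary. -/
theorem innerCenter_cases {y : Pt d} (hy : y ∈ unitCube d) (j : Fin d) :
    (innerCenter i y j = y j ∧ innerRadius i = meshSize i) ∨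
    (innerCenter i y j = innerRadius i ∧ y j ≤ innerRadius i ∧ innerRadius i = meshSize i) ∨
    (innerCenter i y j = 1 - innerRadius i ∧ 1 - innerRadius i ≤ y j ∧
      innerRadius i = meshSize i) ∨
    (innerCenter i y j = 1 / 2 ∧ innerRadius i = 1 / 2 ∧ meshSize i = 1) := by
  have hy := hy j
  simp only [innerCenter]
  rcases meshSize_eq_one_or_le_half i with h | h
  · have hr : innerRadius i = 1 / 2 := by rw [innerRadius, h]; norm_num
    right; right; right
    refine ⟨?_, hr, h⟩
    rw [hr, max_eq_left]
    exact (min_le_right _ _).trans (by norm_num)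
  · have hr : innerRadius i = meshSize i := min_eq_left h
    rcases le_total (y j) (1 - innerRadius i) with h1 | h1
    · rw [min_eq_left h1]
      rcases le_total (innerRadius i) (y j) with h2 | h2
      · left; exact ⟨max_eq_right h2, hr⟩
      · right; left; exact ⟨max_eq_left h2, h2, hr⟩
    · right; right; left
      rw [min_eq_right h1, max_eq_right (by linarith)]
      exact ⟨rfl, h1, hr⟩

theorem mem_closedCube_innerCenter {y z : Pt d} (hy : y ∈ unitCube d) (hz : z ∈ unitCube d)
    (h : ∀ j, |z j - y j| ≤ meshSize i) : z ∈ closedCube (innerCenter i y) (innerRadius i) := by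
  intro j
  have h1 := abs_le.1 (h j)
  have h2 := hz j
  have hy' := hy j
  rcases innerCenter_cases (i := i) hy j with ⟨e1, e2⟩ | ⟨e1, e2, e3⟩ | ⟨e1, e2, e3⟩ | ⟨e1, e2, e3⟩
    <;> constructor <;> linarith

/-- Homogeneity and Friedrichs are only available on inner boxes; this places the `H`-neighborhood
of a mesh node, including its part of the face `z j = 1`, in such a box of radius at most `H`. -/
theorem mem_box_innerCenter {y z : Pt d} (hy : y ∈ unitCube d) (hz : z ∈ unitCube d)
    (h : ∀ j, y j - meshSize i ≤ z j ∧
      (z j < y j + meshSize i ∨ (z j = 1 ∧ z j ≤ y j + meshSize i))) :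
    z ∈ box (innerCenter i y) (innerRadius i) := by
  have hcl : z ∈ closedCube (innerCenter i y) (innerRadius i) :=
    mem_closedCube_innerCenter hy hz fun j => abs_le.2
      ⟨by linarith [(h j).1], by rcases (h j).2 with h | h <;> linarith⟩
  refine ⟨hz, fun j => ⟨(hcl j).1, ?_⟩⟩
  have h0 : innerRadius i ≤ 1 / 2 := min_le_right _ _
  have h1 : innerCenter i y j ≤ 1 - innerRadius i := max_le (by linarith) (min_le_right _ _)
  have h2 := hz j
  have hy' := hy j
  rcases h2.2.eq_or_lt with h3 | h3
  · exact Or.inr ⟨h3, by linarith [(hcl j).2]⟩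
  · left
    rcases (h j).2 with h4 | h4
    · rcases innerCenter_cases (i := i) hy j with
        ⟨e1, e2⟩ | ⟨e1, e2, e3⟩ | ⟨e1, e2, e3⟩ | ⟨e1, e2, e3⟩ <;> linarith
    · linarith

theorem abs_innerCenter_sub_le {y : Pt d} (hy : y ∈ unitCube d) (j : Fin d) :
    |innerCenter i y j - y j| ≤ meshSize i := by
  have hy' := hy j
  have := meshSize_pos i
  rw [abs_le]
  rcases innerCenter_cases (i := i) hy j with ⟨e1, e2⟩ | ⟨e1, e2, e3⟩ | ⟨e1, e2, e3⟩ | ⟨e1, e2, e3⟩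
    <;> constructor <;> linarith

/-! #### The Dirichlet boundary -/

/-- A face has a normal direction, so a nonempty `Γ` excludes `d = 0`. Later constants divide by
`d`. -/
theorem pos_of_isUnionOfBoundaryFaces {Γ : Set (Pt d)} (hne : Γ.Nonempty)
    (h : IsUnionOfBoundaryFaces i Γ) : 1 ≤ d := by
  obtain ⟨z, hz⟩ := hne
  obtain ⟨c, j, _⟩ := h z hz
  have := j.2
  omega

/-- A hat that is nonzero at a point of a boundary face belongs to a vertex of that face, which then
lies in `Γ`. This is what makes coarse functions satisfy the boundary condition. -/
theorem hat_eq_zero_on_boundary {Γ : Set (Pt d)} (h : IsUnionOfBoundaryFaces i Γ)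
    {p : Fin d → Fin (2 ^ i + 1)} (hp : meshNode i p ∉ Γ) {z : Pt d} (hz : z ∈ Γ) :
    hat i p z = 0 := by
  by_contra hne
  have hH := meshSize_pos i
  obtain ⟨c, j, e, he, ⟨hze, hzc⟩, hsub⟩ := h z hz
  have hv : IsVertex c p := by
    refine isVertex_of_hat_ne_zero (fun l => ?_) hne
    have := hzc l
    simp only [elementCenter] at this
    rw [le_div_iff₀ hH, div_le_iff₀ hH]
    constructor <;> nlinarith [this.1, this.2]
  refine hp (hsub ⟨?_, fun l => ?_⟩)
  · have h1 := abs_lt.1 (abs_div_sub_lt_one_of_hat_ne_zero hne j)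
    rw [hze] at h1
    simp only [meshNode]
    rcases he with rfl | rfl
    · have : ((p j : ℕ) : ℝ) < 1 := by rw [zero_div] at h1; linarith [h1.1]
      have : (p j : ℕ) < 1 := by exact_mod_cast this
      have : (p j : ℕ) = 0 := by omega
      simp [this]
    · have e : 1 / meshSize i = 2 ^ i := by
        rw [div_eq_iff hH.ne', two_pow_mul_meshSize]
      rw [e] at h1
      have : (2 : ℝ) ^ i < (p j : ℕ) + 1 := by linarith
      have : 2 ^ i < (p j : ℕ) + 1 := by exact_mod_cast this
      have h3 : (p j : ℕ) = 2 ^ i := by have := (p j).2; omega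
      rw [h3]
      push_cast
      exact two_pow_mul_meshSize i
  · simp only [meshNode, elementCenter]
    rcases hv l with h | h <;> rw [h] <;> push_cast <;> constructor <;> linarith

end Mesh

/-! ### Existence of a Poincaré bound -/

namespace SpatialNetwork

variable {d : ℕ} {net : SpatialNetwork d}

/-- A single edge already contributes `(v a - v b) ^ 2 / (2 * |a - b|)` to the local Laplace form,
and locality bounds its length by `R₀`. -/
theorem sq_sub_le_of_adj {Γ : Set (Pt d)} {R₀ σ ρ : ℝ} (hp : net.HasProperties Γ R₀ σ ρ)
    {ω : Set (Pt d)} (v : net.Fn) {a b : net.nodes} (hab : net.graph.Adj a b)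
    (ha : (a : Pt d) ∈ ω) : (v a - v b) ^ 2 ≤ 2 * R₀ * net.lapOn ω v := by
  have hd : 0 < dist (a : Pt d) (b : Pt d) := dist_pos.2 fun h => hab.ne (Subtype.ext h)
  have h1 : (1 / 2) * ((v a - v b) ^ 2 / dist (a : Pt d) (b : Pt d)) ≤ net.lapAt v a := by
    unfold lapAt
    refine mul_le_mul_of_nonneg_left ?_ (by norm_num)
    have := Finset.single_le_sum (f := fun y : net.nodes =>
      if net.graph.Adj a y then (v a - v y) ^ 2 / dist (a : Pt d) (y : Pt d) else 0)
      (fun y _ => by split_ifs <;> positivity) (Finset.mem_univ b)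
    simpa only [if_pos hab] using this
  have h2 : net.lapAt v a ≤ net.lapOn ω v := by
    rw [lapOn_eq]
    have := Finset.single_le_sum (f := fun x : net.nodes =>
      if (x : Pt d) ∈ ω then net.lapAt v x else 0)
      (fun y _ => by split_ifs; exacts [net.lapAt_nonneg _ _, le_rfl])
      (Finset.mem_univ a)
    simpa only [if_pos ha] using this
  have h3 : (v a - v b) ^ 2 / dist (a : Pt d) (b : Pt d) ≤ 2 * net.lapOn ω v := by linarith
  rw [div_le_iff₀ hd] at h3
  have h4 := net.lapOn_nonneg ω v
  nlinarith [(hp.locality a b hab).le]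

theorem abs_sub_le_of_walk {V : Type*} {G : SimpleGraph V} {v : V → ℝ} {δ : ℝ}
    (h : ∀ a b, G.Adj a b → |v a - v b| ≤ δ) {x y : V} (p : G.Walk x y) :
    |v x - v y| ≤ p.length * δ := by
  induction p with
  | nil => simp
  | cons hab p ih =>
    rw [SimpleGraph.Walk.length_cons]
    push_cast
    have := abs_sub_le (v _) (v _) (v _) |>.trans (add_le_add (h _ _ hab) ih)
    linarith

/-- Oscillation bound on a connected subgraph. -/
theorem sq_sub_le_of_subgraph {Γ : Set (Pt d)} {R₀ σ ρ : ℝ} (hp : net.HasProperties Γ R₀ σ ρ)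
    {ω : Set (Pt d)} (v : net.Fn) {S : net.graph.Subgraph} (hS : S.Connected)
    (hω : ∀ a b, S.Adj a b → (a : Pt d) ∈ ω) {x y : net.nodes} (hx : x ∈ S.verts)
    (hy : y ∈ S.verts) :
    (v x - v y) ^ 2 ≤ (net.nodes.card : ℝ) ^ 2 * (2 * R₀) * net.lapOn ω v := by
  set δ := √(2 * R₀ * net.lapOn ω v) with hδ
  have h0 : 0 ≤ 2 * R₀ * net.lapOn ω v :=
    mul_nonneg (mul_nonneg zero_le_two hp.R₀_pos.le) (net.lapOn_nonneg ω v)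
  have hadj : ∀ a b : S.verts, S.coe.Adj a b → |v a - v b| ≤ δ := fun a b hab =>
    Real.abs_le_sqrt (sq_sub_le_of_adj hp v (S.adj_sub hab) (hω _ _ hab))
  -- A path repeats no node, so its length is at most the number of nodes.
  obtain ⟨p, hpath⟩ := (hS.coe.preconnected ⟨x, hx⟩ ⟨y, hy⟩).exists_isPath
  have h1 := abs_sub_le_of_walk (v := fun a : S.verts => v a) hadj p
  have h2 : p.length ≤ net.nodes.card := by
    refine hpath.length_lt.le.trans ?_
    rw [← Fintype.card_coe net.nodes]
    exact Fintype.card_subtype_le _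
  have h3 : |v x - v y| ≤ net.nodes.card * δ :=
    h1.trans (mul_le_mul_of_nonneg_right (by exact_mod_cast h2) (Real.sqrt_nonneg _))
  calc (v x - v y) ^ 2 = |v x - v y| ^ 2 := (sq_abs _).symm
    _ ≤ (net.nodes.card * δ) ^ 2 := by gcongr
    _ = _ := by rw [mul_pow, hδ, Real.sq_sqrt h0]; ring

theorem massAt_eq_zero_of_forall_not_adj {x : net.nodes} (h : ∀ y, ¬ net.graph.Adj x y) :
    net.massAt x = 0 := by
  simp [massAt, h]

/-- A pointwise oscillation bound gives a crude Poincaré bound. -/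
theorem sqrt_massOn_le_of_osc {ω ω' : Set (Pt d)} {v w : net.Fn} {R₀ R : ℝ} (hR₀ : 0 < R₀)
    (hR : R₀ ≤ R)
    (h : ∀ x : net.nodes, (x : Pt d) ∈ ω → net.massAt x ≠ 0 →
      w x ^ 2 ≤ (net.nodes.card : ℝ) ^ 2 * (2 * R₀) * net.lapOn ω' v) :
    √(net.massOn ω w w) ≤
      √((∑ x, net.massAt x) * (net.nodes.card ^ 2 * (2 * R₀)) / R₀ ^ 2) * R *
        √(net.lapOn ω' v) := by
  have hM : 0 ≤ ∑ x, net.massAt x := Finset.sum_nonneg fun x _ => net.massAt_nonneg x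
  have hl := net.lapOn_nonneg ω' v
  have h1 : net.massOn ω w w ≤
      (∑ x, net.massAt x) * (net.nodes.card ^ 2 * (2 * R₀)) * net.lapOn ω' v := by
    rw [massOn, mul_assoc, Finset.sum_mul]
    refine Finset.sum_le_sum fun x _ => ?_
    have hx0 := net.massAt_nonneg x
    split_ifs with hx
    · by_cases h0 : net.massAt x = 0
      · simp [h0]
      · rw [mul_assoc, ← sq]
        exact mul_le_mul_of_nonneg_left (h x hx h0) hx0
    · positivity
  have hRpos : 0 ≤ R := hR₀.le.trans hR
  -- The constant is divided by `R₀ ^ 2` so that it does not depend on `R`: the factor `R₀` split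
  -- off here is enlarged to `R`.
  have h2 : √((∑ x, net.massAt x) * (net.nodes.card ^ 2 * (2 * R₀)) / R₀ ^ 2) * R₀ =
      √((∑ x, net.massAt x) * (net.nodes.card ^ 2 * (2 * R₀))) := by
    rw [Real.sqrt_div' _ (sq_nonneg _), Real.sqrt_sq hR₀.le, div_mul_cancel₀ _ hR₀.ne']
  calc √(net.massOn ω w w)
      ≤ √((∑ x, net.massAt x) * (net.nodes.card ^ 2 * (2 * R₀)) * net.lapOn ω' v) :=
        Real.sqrt_le_sqrt h1
    _ = √((∑ x, net.massAt x) * (net.nodes.card ^ 2 * (2 * R₀)) / R₀ ^ 2) * R₀ *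
        √(net.lapOn ω' v) := by
      rw [h2, Real.sqrt_mul (by positivity)]
    _ ≤ _ := by gcongr

/-- On a Friedrichs box there is a node in `Γ`. -/
theorem exists_boundary_node_mem_box {i : ℕ} {Γ : Set (Pt d)} (hΓ : IsUnionOfBoundaryFaces i Γ)
    {R₀ σ ρ : ℝ} (hp : net.HasProperties Γ R₀ σ ρ) {x : Pt d} {R : ℝ} (hR : 2 * R₀ ≤ R)
    (hx : closedCube x R ⊆ unitCube d) {y : Pt d} {j : Fin d}
    (hy : flatCube y j R ⊆ Γ ∩ closedCube x R) :
    ∃ a : net.nodes, (a : Pt d) ∈ Γ ∧ (a : Pt d) ∈ box x R := by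
  have hR₀ := hp.R₀_pos
  have hyf : y ∈ flatCube y j R := ⟨rfl, fun l _ => ⟨by linarith, by linarith⟩⟩
  -- The candidate is a node within `R₀ ≤ R / 2` of the center of the flat cube.
  obtain ⟨a, haΓ, had⟩ := hp.boundary_density y (hy hyf).1
  have hcoord : ∀ l, |(a : Pt d) l - y l| < R₀ := fun l =>
    (abs_coord_sub_le_dist _ _ l).trans_lt had
  have haU := net.nodes_mem a a.2
  -- the tangential directions
  have htan : ∀ l, l ≠ j → x l - R ≤ y l - R / 2 ∧ y l + R / 2 ≤ x l + R := by
    intro l hl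
    have hmem : ∀ s : ℝ, |s| ≤ R / 2 →
        (WithLp.toLp 2 (fun m => if m = l then y l + s else y m) : Pt d) ∈ flatCube y j R := by
      intro s hs
      have hs := abs_le.1 hs
      refine ⟨by simp [hl.symm], fun m _ => ?_⟩
      by_cases hm : m = l
      · subst hm; simp only [if_true]; constructor <;> linarith
      · simp only [if_neg hm]; constructor <;> linarith
    have h1 := (hy (hmem (-(R / 2)) (by rw [abs_neg, abs_of_nonneg]; linarith))).2 l
    have h2 := (hy (hmem (R / 2) (by rw [abs_of_nonneg]; linarith))).2 l
    simp only [if_true] at h1 h2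
    exact ⟨by linarith [h1.1], h2.2⟩
  have hxin : ∀ l, 0 ≤ x l - R ∧ x l + R ≤ 1 := by
    intro l
    have h1 := hx (show (WithLp.toLp 2 (fun m => x m - R) : Pt d) ∈ closedCube x R from
      fun m => ⟨le_rfl, by simp only; linarith⟩) l
    have h2 := hx (show (WithLp.toLp 2 (fun m => x m + R) : Pt d) ∈ closedCube x R from
      fun m => ⟨by simp only; linarith, le_rfl⟩) l
    exact ⟨h1.1, h2.2⟩
  -- the normal direction
  have hnorm : y j = 0 ∨ y j = 1 := by
    obtain ⟨c, l, e, he, ⟨hye, -⟩, -⟩ := hΓ y (hy hyf).1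
    by_cases hl : l = j
    · subst hl; rcases he with rfl | rfl <;> simp [hye]
    -- If the boundary face through `y` were normal to `l ≠ j`, the flat cube, which extends by `R /
    -- 2` on both sides in direction `l`, would leave `Ω`.
    · exfalso
      have h1 := htan l hl
      have h2 := hxin l
      rcases he with rfl | rfl <;> linarith
  refine ⟨a, haΓ, haU, fun l => ?_⟩
  have h1 := abs_lt.1 (hcoord l)
  by_cases hl : l = j
  · subst hl
    have h2 := hxin l
    have h3 := (hy hyf).2 l
    have h4 := haU l
    rcases hnorm with h0 | h0
    · exact ⟨by linarith [h3.1], Or.inl (by linarith)⟩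
    · refine ⟨by linarith [h3.2], ?_⟩
      rcases h4.2.eq_or_lt with h5 | h5
      · exact Or.inr ⟨h5, by linarith [h3.2]⟩
      · exact Or.inl (by linarith [h3.2])
  · have h2 := htan l hl
    exact ⟨by linarith, Or.inl (by linarith)⟩

/-- Nodes without edges may be missing from the subgraph, but they carry no mass. -/
theorem mem_verts_of_mem_box {ω : Set (Pt d)} {S : net.graph.Subgraph}
    (h : ∀ a b : net.nodes, net.graph.Adj a b → (a : Pt d) ∈ ω → S.Adj a b) {x : net.nodes}
    (hx : (x : Pt d) ∈ ω) (hm : net.massAt x ≠ 0) : x ∈ S.verts := by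
  by_contra hx'
  refine hm (massAt_eq_zero_of_forall_not_adj fun y hy => hx' ?_)
  exact (h x y hy hx).fst_mem

/-- `poincareConst` is an `sInf`, which would be `0` for an empty set, so some bound must be
exhibited. The bound found here comes from paths in a finite connected graph and is not uniform; it
enters no constant of the final estimate. -/
theorem exists_isPoincareBound {i : ℕ} {Γ : Set (Pt d)} (hne : Γ.Nonempty)
    (hΓ : IsUnionOfBoundaryFaces i Γ) {R₀ σ ρ : ℝ} (hp : net.HasProperties Γ R₀ σ ρ) :
    ∃ μ, net.IsPoincareBound Γ R₀ μ := by
  have hR₀ := hp.R₀_pos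
  set D := √((∑ x, net.massAt x) * (net.nodes.card ^ 2 * (2 * R₀)) / R₀ ^ 2) with hD
  have hD0 : 0 ≤ D := Real.sqrt_nonneg _
  -- The box inequalities carry a factor `R` and need only `D`. The global one has no such factor
  -- and uses `R = R₀`, which accounts for the maximum.
  refine ⟨D * max 1 R₀, by positivity, ?_, ?_, ?_⟩
  · intro x R hR hx v
    obtain ⟨S, hS, hS1, hS2⟩ := hp.connectivity x R hR hx
    obtain ⟨x₀, hx₀⟩ := hS.nonempty
    refine ⟨v x₀, (sqrt_massOn_le_of_osc (v := v) (ω' := box x (R + R₀)) hR₀ hR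
      fun y hy hm => ?_).trans ?_⟩
    · exact sq_sub_le_of_subgraph hp v hS hS2 (mem_verts_of_mem_box hS1 hy hm) hx₀
    · have : 0 ≤ R := hR₀.le.trans hR
      gcongr
      exact le_mul_of_one_le_right hD0 (le_max_left _ _)
  · rintro x R hR hx ⟨y, j, hy⟩ v hv
    have hR' : R₀ ≤ R := by linarith
    obtain ⟨S, hS, hS1, hS2⟩ := hp.connectivity x R hR' hx
    obtain ⟨a, haΓ, hab⟩ := exists_boundary_node_mem_box hΓ hp hR hx hy
    refine (sqrt_massOn_le_of_osc (v := v) (ω' := box x (R + R₀)) hR₀ hR'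
      fun z hz hm => ?_).trans ?_
    · have hz' := mem_verts_of_mem_box hS1 hz hm
      -- If `a ≠ z`, the network has two nodes, so `a` has an edge and connectivity puts it into
      -- `S`.
      have ha' : a ∈ S.verts := by
        by_cases hza : a = z
        · rw [hza]; exact hz'
        · have : Nontrivial net.nodes := ⟨a, z, hza⟩
          exact mem_verts_of_mem_box hS1 hab (net.massAt_pos a).ne'
      have := sq_sub_le_of_subgraph hp v hS hS2 hz' ha'
      rwa [hv a haΓ, sub_zero] at this
    · have : 0 ≤ R := hR₀.le.trans hR'
      gcongr
      exact le_mul_of_one_le_right hD0 (le_max_left _ _)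
  · intro v hv
    obtain ⟨y, hy⟩ := hne
    obtain ⟨a, haΓ, -⟩ := hp.boundary_density y hy
    have hS : (⊤ : net.graph.Subgraph).Connected := by
      rw [SimpleGraph.Subgraph.connected_iff_forall_exists_walk_subgraph]
      refine ⟨⟨a, trivial⟩, fun {u w} _ _ => ?_⟩
      obtain ⟨p⟩ := net.connected.preconnected u w
      exact ⟨p, le_top⟩
    refine (sqrt_massOn_le_of_osc (v := v) (ω' := Set.univ) hR₀ le_rfl
      fun z _ _ => ?_).trans ?_
    · have := sq_sub_le_of_subgraph (ω := Set.univ) hp v hS (fun _ _ _ => trivial)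
        (x := z) (y := a) trivial trivial
      rwa [hv a haΓ, sub_zero] at this
    · change _ ≤ _ * √(net.lapOn Set.univ v)
      gcongr
      exact le_max_right _ _

/-- Any number above the Poincaré constant is admissible. -/
theorem isPoincareBound_add_one {i : ℕ} {Γ : Set (Pt d)} (hne : Γ.Nonempty)
    (hΓ : IsUnionOfBoundaryFaces i Γ) {R₀ σ ρ : ℝ} (hp : net.HasProperties Γ R₀ σ ρ) {μ : ℝ}
    (hμ : net.poincareConst Γ R₀ ≤ μ) : net.IsPoincareBound Γ R₀ (μ + 1) := by
  -- Whether the infimum is attained plays no role: some admissible number lies below `μ + 1`, and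
  -- admissibility is preserved upwards.
  obtain ⟨ν, hν, hlt⟩ := exists_lt_of_csInf_lt
    (s := {μ : ℝ | net.IsPoincareBound Γ R₀ μ}) (exists_isPoincareBound hne hΓ hp)
    (b := μ + 1) (lt_of_le_of_lt hμ (lt_add_one μ))
  have hν : net.IsPoincareBound Γ R₀ ν := hν
  have hR₀ := hp.R₀_pos
  refine ⟨hν.nonneg.trans hlt.le, fun x R hR hx v => ?_, fun x R hR hx hy v hv => ?_,
    fun v hv => ?_⟩
  · obtain ⟨a, ha⟩ := hν.poincare x R hR hx v
    have : 0 ≤ R := hR₀.le.trans hR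
    exact ⟨a, ha.trans (by gcongr)⟩
  · have : 0 ≤ R := by linarith
    exact (hν.friedrichs x R hR hx hy v hv).trans (by gcongr)
  · exact (hν.global v hv).trans (by gcongr)

end SpatialNetwork

/-! ### Dual functions and the interpolant -/

namespace SpatialNetwork

variable {d : ℕ}

/-- The standing assumptions on network, Dirichlet boundary and mesh. -/
structure IsAdmissible (net : SpatialNetwork d) (Γ : Set (Pt d)) (R₀ σ ρ μ : ℝ) (i : ℕ) : Prop where
  nonempty : Γ.Nonempty
  faces : IsUnionOfBoundaryFaces i Γ
  props : net.HasProperties Γ R₀ σ ρ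
  poincare : net.IsPoincareBound Γ R₀ μ
  mesh : 8 * d * R₀ ≤ meshSize i

/-- The coefficient functional of the interpolant at the mesh node `p`. -/
def coef (net : SpatialNetwork d) (i : ℕ) (p : Fin d → Fin (2 ^ i + 1)) (v : net.Fn) : ℝ :=
  net.massOn (element i (ownElement i p)) (net.dualFn i p) v

namespace IsAdmissible

variable {net : SpatialNetwork d} {Γ : Set (Pt d)} {R₀ σ ρ μ : ℝ} {i : ℕ}

theorem one_le_dim (h : net.IsAdmissible Γ R₀ σ ρ μ i) : 1 ≤ d :=
  pos_of_isUnionOfBoundaryFaces h.nonempty h.faces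

theorem one_le_dim_real (h : net.IsAdmissible Γ R₀ σ ρ μ i) : (1 : ℝ) ≤ d := by
  exact_mod_cast h.one_le_dim

theorem eight_mul_le (h : net.IsAdmissible Γ R₀ σ ρ μ i) : 8 * R₀ ≤ meshSize i := by
  have := h.mesh
  have := h.one_le_dim_real
  have := h.props.R₀_pos
  nlinarith

theorem massOn_box_le (h : net.IsAdmissible Γ R₀ σ ρ μ i) {x : Pt d} {R : ℝ} (hR : R₀ ≤ R)
    (hx : closedCube x R ⊆ unitCube d) : net.massOn (box x R) 1 1 ≤ σ * ρ * (2 * R) ^ d := by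
  have hR0 : 0 < R := h.props.R₀_pos.trans_le hR
  have := (h.props.homogeneity x R hR hx).2
  rwa [div_le_iff₀ (by positivity)] at this

theorem le_massOn_box (h : net.IsAdmissible Γ R₀ σ ρ μ i) {x : Pt d} {R : ℝ} (hR : R₀ ≤ R)
    (hx : closedCube x R ⊆ unitCube d) : ρ * (2 * R) ^ d ≤ net.massOn (box x R) 1 1 := by
  have hR0 : 0 < R := h.props.R₀_pos.trans_le hR
  have := (h.props.homogeneity x R hR hx).1
  rwa [le_div_iff₀ (by positivity)] at this

theorem R₀_le_innerRadius (h : net.IsAdmissible Γ R₀ σ ρ μ i) : 2 * R₀ ≤ innerRadius i := by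
  have := h.eight_mul_le
  have := half_le_innerRadius (i := i)
  have := h.props.R₀_pos
  linarith

/-- The two homogeneity bounds are compared on one inner box, which exists because `R₀` is small
relative to `H`. -/
theorem one_le_σ (h : net.IsAdmissible Γ R₀ σ ρ μ i) : 1 ≤ σ := by
  have hR : R₀ ≤ innerRadius i := by linarith [h.R₀_le_innerRadius, h.props.R₀_pos]
  have := h.props.homogeneity (innerCenter i 0) (innerRadius i) hR (closedCube_innerCenter_subset 0)
  have h1 := this.1.trans this.2
  have := h.props.ρ_pos
  nlinarith

/-- A one-node network has no mass, contrary to the lower homogeneity bound. -/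
theorem nontrivial (h : net.IsAdmissible Γ R₀ σ ρ μ i) : Nontrivial net.nodes := by
  have hR : R₀ ≤ innerRadius i := by linarith [h.R₀_le_innerRadius, h.props.R₀_pos]
  have h1 := h.le_massOn_box hR (closedCube_innerCenter_subset (0 : Pt d))
  have hR0 : 0 < innerRadius i := h.props.R₀_pos.trans_le hR
  have h2 : 0 < ρ * (2 * innerRadius i) ^ d := mul_pos h.props.ρ_pos (by positivity)
  by_contra hn
  rw [not_nontrivial_iff_subsingleton] at hn
  have h3 : net.massOn (box (innerCenter i (0 : Pt d)) (innerRadius i)) 1 1 = 0 := by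
    refine Finset.sum_eq_zero fun x _ => ?_
    have : net.massAt x = 0 := massAt_eq_zero_of_forall_not_adj fun y hy =>
      hy.ne (Subsingleton.elim _ _)
    simp [this]
  linarith

/-- The volume scale of an element, weighted by the density. -/
theorem vol_pos (h : net.IsAdmissible Γ R₀ σ ρ μ i) : 0 < ρ * meshSize i ^ d :=
  mul_pos h.props.ρ_pos (pow_pos (meshSize_pos i) d)

theorem massOn_element_le (h : net.IsAdmissible Γ R₀ σ ρ μ i) (c : Fin d → Fin (2 ^ i)) :
    net.massOn (element i c) 1 1 ≤ σ * (ρ * meshSize i ^ d) := by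
  have := h.massOn_box_le (R := meshSize i / 2)
    (by linarith [h.eight_mul_le, h.props.R₀_pos]) (closedCube_elementCenter_subset c)
  rwa [mul_div_cancel₀ _ two_ne_zero, mul_assoc] at this

theorem sum_massAt_hat_le (h : net.IsAdmissible Γ R₀ σ ρ μ i) (p : Fin d → Fin (2 ^ i + 1)) :
    ∑ x : net.nodes, net.massAt x * (if hat i p (x : Pt d) ≠ 0 then 1 else 0) ≤
      σ * 2 ^ d * (ρ * meshSize i ^ d) := by
  have hR : R₀ ≤ innerRadius i := by linarith [h.R₀_le_innerRadius, h.props.R₀_pos]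
  have h1 := h.massOn_box_le hR (closedCube_innerCenter_subset (meshNode i p))
  have hR0 : 0 < innerRadius i := h.props.R₀_pos.trans_le hR
  have h0 := h.one_le_σ
  have hρ := h.props.ρ_pos
  calc _ ≤ net.massOn (box (innerCenter i (meshNode i p)) (innerRadius i)) 1 1 := by
        unfold massOn
        refine Finset.sum_le_sum fun x _ => ?_
        have hm := net.massAt_nonneg x
        by_cases hx : hat i p (x : Pt d) ≠ 0
        · rw [if_pos hx, if_pos (mem_box_innerCenter (meshNode_mem_unitCube p)
            (net.nodes_mem x x.2) fun j => ?_)]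
          · simp
          · have := abs_lt.1 (abs_sub_meshNode_lt_of_hat_ne_zero hx j)
            exact ⟨by linarith, Or.inl (by linarith)⟩
        · rw [if_neg hx]
          split_ifs <;> simp [hm]
    _ ≤ σ * ρ * (2 * innerRadius i) ^ d := h1
    _ ≤ σ * ρ * (2 * meshSize i) ^ d := by
        gcongr
        exact innerRadius_le
    _ = _ := by rw [mul_pow]; ring

theorem one_sub_hat_le {p : Fin d → Fin (2 ^ i + 1)} (z : Pt d) :
    1 - hat i p z ≤ ∑ j, |z j / meshSize i - ((p j : ℕ) : ℝ)| := by
  have h := abs_prod_sub_prod_le (Finset.univ : Finset (Fin d)) (a := fun _ => (1 : ℝ))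
    (b := fun j => max 0 (1 - |z j / meshSize i - ((p j : ℕ) : ℝ)|))
    (fun _ => ⟨zero_le_one, le_rfl⟩) (fun j => ⟨le_max_left _ _, hat_factor_le_one _ _⟩)
  rw [Finset.prod_const_one] at h
  refine (le_abs_self _).trans (h.trans (Finset.sum_le_sum fun j _ => ?_))
  rw [abs_of_nonneg (sub_nonneg.2 (hat_factor_le_one _ _))]
  linarith [le_max_right 0 (1 - |z j / meshSize i - ((p j : ℕ) : ℝ)|)]

/-- A coarse function is controlled from below near the vertex with the largest coefficient. -/
theorem half_abs_le_of_near_vertex {c : Fin d → Fin (2 ^ i)}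
    {p : Fin d → Fin (2 ^ i + 1)} {a : (Fin d → Fin (2 ^ i + 1)) → ℝ}
    (hmax : ∀ q, IsVertex c q → |a q| ≤ |a p|) {z : Pt d} (hz : z ∈ element i c)
    (hnear : 3 / 4 ≤ hat i p z) : |a p| / 2 ≤ |∑ q, a q * hat i q z| := by
  have hU : z ∈ unitCube d := hz.1
  -- By the partition of unity the deviation from `a p` is an average of `a q - a p` over the other
  -- vertices, at most `2 * |a p| * (1 - hat i p z) ≤ |a p| / 2`.
  have e : ∑ q, a q * hat i q z - a p = ∑ q, (a q - a p) * hat i q z := by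
    simp only [sub_mul, Finset.sum_sub_distrib]
    rw [← Finset.mul_sum, sum_hat hU, mul_one]
  have h1 : |∑ q, (a q - a p) * hat i q z| ≤ 2 * |a p| * (1 - hat i p z) := by
    have e2 : 1 - hat i p z = ∑ q, if q = p then 0 else hat i q z := by
      rw [← sum_hat hU (i := i), ← Finset.add_sum_erase _ _ (Finset.mem_univ p), add_sub_cancel_left,
        ← Finset.sum_filter_add_sum_filter_not _ (fun q => q = p) (fun q => if q = p then _ else _)]
      rw [Finset.sum_eq_zero (s := Finset.filter _ _) (fun q hq => if_pos (Finset.mem_filter.1 hq).2),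
        zero_add]
      refine Finset.sum_congr (by ext; simp) fun q hq => ?_
      rw [if_neg (by simpa using hq)]
    rw [e2, Finset.mul_sum]
    refine (Finset.abs_sum_le_sum_abs _ _).trans (Finset.sum_le_sum fun q _ => ?_)
    rw [abs_mul, abs_of_nonneg (hat_nonneg q z)]
    by_cases hq : q = p
    · simp [hq]
    · rw [if_neg hq]
      by_cases hv : IsVertex c q
      · refine mul_le_mul_of_nonneg_right ?_ (hat_nonneg q z)
        exact (abs_sub _ _).trans (by linarith [hmax q hv])
      · rw [hat_eq_zero_of_not_isVertex hz hv]; simp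
  rw [← e] at h1
  have h2 : |a p| - |∑ q, a q * hat i q z| ≤ |∑ q, a q * hat i q z - a p| := by
    rw [abs_sub_comm]; exact abs_sub_abs_le_abs_sub _ _
  nlinarith [abs_nonneg (a p)]

theorem sum_smul_basisFn_apply (a : (Fin d → Fin (2 ^ i + 1)) → ℝ) (x : net.nodes) :
    (∑ q, a q • net.basisFn i q) x = ∑ q, a q * hat i q (x : Pt d) := by
  simp [basisFn]

/-- The coefficients of a coarse function at the vertices of an element are controlled by its mass
there. -/
theorem sq_coeff_le (h : net.IsAdmissible Γ R₀ σ ρ μ i) {c : Fin d → Fin (2 ^ i)}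
    {p : Fin d → Fin (2 ^ i + 1)} (hp : IsVertex c p) (a : (Fin d → Fin (2 ^ i + 1)) → ℝ) :
    a p ^ 2 * (ρ * meshSize i ^ d) ≤ 4 * (4 * d) ^ d *
      net.massOn (element i c) (∑ q, a q • net.basisFn i q) (∑ q, a q • net.basisFn i q) := by
  have hH := meshSize_pos i
  have hd := h.one_le_dim_real
  have hd0 : (0 : ℝ) < d := by linarith
  obtain ⟨m, hm, hmax⟩ := Finset.exists_max_image
    (Finset.univ.filter fun q : Fin d → Fin (2 ^ i + 1) => IsVertex c q) (fun q => |a q|)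
    ⟨p, by simpa using hp⟩
  simp only [Finset.mem_filter, Finset.mem_univ, true_and] at hm hmax
  -- The largest radius that the mesh condition guarantees to be at least `R₀`; the corner box of
  -- side `2 * r` has `1 - hat ≤ d * (2 * r / H) = 1 / 4`.
  set r := meshSize i / (8 * d) with hr
  have hr0 : 0 < r := by positivity
  have hrR : R₀ ≤ r := by
    rw [hr, le_div_iff₀ (by positivity), mul_comm]; exact h.mesh
  have hrd : d * (2 * r / meshSize i) = 1 / 4 := by rw [hr]; field_simp; norm_num
  have hrH : 2 * r ≤ meshSize i := by
    have h1 : 2 * r / meshSize i ≤ 1 := by nlinarith [show 0 ≤ 2 * r / meshSize i by positivity]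
    rwa [div_le_one hH] at h1
  obtain ⟨hb1, hb2, hb3⟩ := cornerBox_subset hm hr0 hrH
  have h1 := h.le_massOn_box hrR hb1
  have h2 : net.massOn (box (cornerCenter c m r) r) ((|a m| / 2) • 1) ((|a m| / 2) • 1) ≤
      net.massOn (element i c) (∑ q, a q • net.basisFn i q) (∑ q, a q • net.basisFn i q) := by
    refine net.massOn_self_le fun x hx => ⟨hb2 hx, ?_⟩
    rw [sum_smul_basisFn_apply]
    have h3 : 3 / 4 ≤ hat i m (x : Pt d) := by
      have h4 := one_sub_hat_le (i := i) (p := m) (x : Pt d)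
      have h5 : ∑ j, |(x : Pt d) j / meshSize i - ((m j : ℕ) : ℝ)| ≤
          ∑ _j : Fin d, 2 * r / meshSize i := Finset.sum_le_sum fun j _ => hb3 x hx j
      rw [Finset.sum_const, Finset.card_univ, Fintype.card_fin, nsmul_eq_mul, hrd] at h5
      linarith
    have := half_abs_le_of_near_vertex hmax (hb2 hx) h3
    simpa [abs_of_nonneg (show 0 ≤ |a m| / 2 by positivity)] using this
  rw [massOn_smul_self] at h2
  have h3 : a p ^ 2 ≤ |a m| ^ 2 := by
    rw [← sq_abs (a p)]
    exact pow_le_pow_left₀ (abs_nonneg _) (hmax p hp) 2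
  have e : ρ * meshSize i ^ d = (4 * d) ^ d * (ρ * (2 * r) ^ d) := by
    have : meshSize i = 4 * d * (2 * r) := by rw [hr]; field_simp; norm_num
    conv_lhs => rw [this, mul_pow]
    ring
  rw [e]
  have hρ := h.props.ρ_pos
  calc a p ^ 2 * ((4 * d) ^ d * (ρ * (2 * r) ^ d))
      ≤ |a m| ^ 2 * ((4 * d) ^ d * net.massOn (box (cornerCenter c m r) r) 1 1) := by gcongr
    _ = 4 * (4 * d) ^ d * ((|a m| / 2) ^ 2 * net.massOn (box (cornerCenter c m r) r) 1 1) := by ring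
    _ ≤ _ := by gcongr

theorem massOn_basisFn_eq_zero {c : Fin d → Fin (2 ^ i)} {q : Fin d → Fin (2 ^ i + 1)}
    (hq : ¬ IsVertex c q) (v : net.Fn) : net.massOn (element i c) v (net.basisFn i q) = 0 := by
  refine Finset.sum_eq_zero fun x _ => ?_
  split_ifs with hx
  · simp [basisFn, hat_eq_zero_of_not_isVertex hx hq]
  · rfl

/-- A square linear system for the coefficients. In its kernel a coarse function has no mass on the
element, so by `sq_coeff_le` its coefficients at the vertices vanish; injectivity gives solvability.
-/
theorem exists_isDual (h : net.IsAdmissible Γ R₀ σ ρ μ i) (p : Fin d → Fin (2 ^ i + 1)) :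
    ∃ ψ, net.IsDual i p ψ := by
  set c := ownElement i p with hc
  let Φ : ((Fin d → Fin (2 ^ i + 1)) → ℝ) →ₗ[ℝ] net.Fn :=
    { toFun := fun a => ∑ q, a q • net.basisFn i q
      map_add' := fun a b => by simp [add_smul, Finset.sum_add_distrib]
      map_smul' := fun r a => by simp [Finset.smul_sum, mul_smul] }
  -- Basis functions of other mesh nodes vanish on the element; identity rows there keep the system
  -- square and injective.
  let G : ((Fin d → Fin (2 ^ i + 1)) → ℝ) →ₗ[ℝ] ((Fin d → Fin (2 ^ i + 1)) → ℝ) :=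
    { toFun := fun a q => if IsVertex c q then
        net.massForm (element i c) (Φ a) (net.basisFn i q) else a q
      map_add' := fun a b => by
        funext q
        simp only [map_add, LinearMap.add_apply, Pi.add_apply]
        split_ifs <;> rfl
      map_smul' := fun r a => by
        funext q
        simp only [map_smul, LinearMap.smul_apply, Pi.smul_apply, RingHom.id_apply]
        split_ifs <;> rfl }
  have hG : ∀ a q, G a q = if IsVertex c q then
        net.massForm (element i c) (Φ a) (net.basisFn i q) else a q := fun _ _ => rfl
  have hinj : Function.Injective G := by
    rw [← LinearMap.ker_eq_bot, LinearMap.ker_eq_bot']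
    intro a ha
    have h0 : net.massForm (element i c) (Φ a) (Φ a) = 0 := by
      have : net.massForm (element i c) (Φ a) (Φ a) =
          ∑ q, a q * net.massForm (element i c) (Φ a) (net.basisFn i q) := by
        change net.massForm (element i c) (Φ a) (∑ q, a q • net.basisFn i q) = _
        simp [map_sum]
      rw [this]
      refine Finset.sum_eq_zero fun q _ => ?_
      have hq := congrFun ha q
      rw [hG] at hq
      by_cases hv : IsVertex c q
      · rw [if_pos hv] at hq; rw [hq]; simp
      · rw [massForm_apply, massOn_basisFn_eq_zero hv, mul_zero]
    funext q
    have hq := congrFun ha q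
    rw [hG] at hq
    by_cases hv : IsVertex c q
    · have h1 := h.sq_coeff_le hv a
      have h2 : net.massOn (element i c) (∑ q, a q • net.basisFn i q)
        (∑ q, a q • net.basisFn i q) = 0 := h0
      rw [h2, mul_zero] at h1
      have h3 : a q ^ 2 ≤ 0 := nonpos_of_mul_nonpos_left h1 h.vol_pos
      exact pow_eq_zero_iff two_ne_zero |>.1 (le_antisymm h3 (sq_nonneg _))
    · rwa [if_neg hv] at hq
  obtain ⟨a, ha⟩ := LinearMap.injective_iff_surjective.1 hinj (Pi.single p 1)
  refine ⟨Φ a, ?_, fun q => ?_⟩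
  · exact Submodule.sum_mem _ fun q _ => Submodule.smul_mem _ _
      (Submodule.subset_span (Set.mem_range_self q))
  · have hq := congrFun ha q
    rw [hG, Pi.single_apply] at hq
    by_cases hv : IsVertex c q
    · rwa [if_pos hv] at hq
    · rw [← hc, massOn_basisFn_eq_zero hv, if_neg]
      rintro rfl
      exact hv (isVertex_ownElement _)

theorem isDual_dualFn (h : net.IsAdmissible Γ R₀ σ ρ μ i) (p : Fin d → Fin (2 ^ i + 1)) :
    net.IsDual i p (net.dualFn i p) := by
  have := h.exists_isDual p
  rw [dualFn, dif_pos this]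
  exact this.choose_spec

/-- By duality the mass of the dual function on its element is its own coefficient `a p`. Since
`sq_coeff_le` bounds `a p ^ 2` by that mass, one factor `a p` cancels. -/
theorem massOn_dualFn_le (h : net.IsAdmissible Γ R₀ σ ρ μ i) (p : Fin d → Fin (2 ^ i + 1)) :
    net.massOn (element i (ownElement i p)) (net.dualFn i p) (net.dualFn i p) *
      (ρ * meshSize i ^ d) ≤ 4 * (4 * d) ^ d := by
  obtain ⟨hspan, hdual⟩ := h.isDual_dualFn p
  set ψ := net.dualFn i p
  set T := element i (ownElement i p) with hT
  obtain ⟨a, ha⟩ := (Submodule.mem_span_range_iff_exists_fun ℝ).1 hspan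
  have h1 : net.massOn T ψ ψ = a p := by
    calc net.massOn T ψ ψ = net.massForm T ψ (∑ q, a q • net.basisFn i q) := by
          rw [ha]; rfl
      _ = ∑ q, a q * net.massOn T ψ (net.basisFn i q) := by
          simp [map_sum, massForm_apply]
      _ = a p := by simp [hdual]
  have h2 := h.sq_coeff_le (isVertex_ownElement p) a
  rw [ha, h1] at h2
  have h3 : 0 ≤ a p := h1 ▸ net.massOn_self_nonneg T ψ
  rw [h1]
  rcases h3.eq_or_lt with h4 | h4
  · rw [← h4, zero_mul]; positivity
  · have : a p * (a p * (ρ * meshSize i ^ d)) ≤ a p * (4 * (4 * d) ^ d) := by nlinarith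
    exact le_of_mul_le_mul_left this h4

/-- Stability of the coefficient functionals. -/
theorem sq_coef_le (h : net.IsAdmissible Γ R₀ σ ρ μ i) (p : Fin d → Fin (2 ^ i + 1)) (v : net.Fn) :
    net.coef i p v ^ 2 * (ρ * meshSize i ^ d) ≤
      4 * (4 * d) ^ d * net.massOn (element i (ownElement i p)) v v := by
  have h1 := (net.isPsdForm_massForm (element i (ownElement i p))).apply_sq_le (net.dualFn i p) v
  simp only [massForm_apply] at h1
  have h2 := h.massOn_dualFn_le p
  have h3 := net.massOn_self_nonneg (element i (ownElement i p)) v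
  have h4 := h.vol_pos
  calc _ ≤ net.massOn (element i (ownElement i p)) (net.dualFn i p) (net.dualFn i p) *
        net.massOn (element i (ownElement i p)) v v * (ρ * meshSize i ^ d) :=
        mul_le_mul_of_nonneg_right h1 h4.le
    _ = (net.massOn (element i (ownElement i p)) (net.dualFn i p) (net.dualFn i p) *
        (ρ * meshSize i ^ d)) * net.massOn (element i (ownElement i p)) v v := by ring
    _ ≤ _ := by gcongr

theorem coef_basisFn (h : net.IsAdmissible Γ R₀ σ ρ μ i) (p q : Fin d → Fin (2 ^ i + 1)) :
    net.coef i p (net.basisFn i q) = if q = p then 1 else 0 := (h.isDual_dualFn p).2 q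

theorem coef_sum (p : Fin d → Fin (2 ^ i + 1)) (a : (Fin d → Fin (2 ^ i + 1)) → ℝ) :
    net.coef i p (∑ q, a q • net.basisFn i q) = ∑ q, a q * net.coef i p (net.basisFn i q) := by
  change net.massForm _ _ _ = _
  simp [map_sum, massForm_apply, coef]

theorem interp_eq (v : net.Fn) :
    net.interp Γ i v =
      ∑ q, (if meshNode i q ∈ Γ then 0 else net.coef i q v) • net.basisFn i q := by
  unfold interp
  exact Finset.sum_congr rfl fun q _ => by split_ifs <;> simp [coef]

theorem coef_interp (h : net.IsAdmissible Γ R₀ σ ρ μ i) {p : Fin d → Fin (2 ^ i + 1)}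
    (hp : meshNode i p ∉ Γ) (v : net.Fn) : net.coef i p (net.interp Γ i v) = net.coef i p v := by
  rw [interp_eq, coef_sum]
  simp [h.coef_basisFn, hp]

theorem interp_interp (h : net.IsAdmissible Γ R₀ σ ρ μ i) (v : net.Fn) :
    net.interp Γ i (net.interp Γ i v) = net.interp Γ i v := by
  rw [interp_eq (net.interp Γ i v), interp_eq v]
  refine Finset.sum_congr rfl fun q _ => ?_
  split_ifs with hq
  · rfl
  · rw [← interp_eq v, h.coef_interp hq]

theorem coef_eq_zero (h : net.IsAdmissible Γ R₀ σ ρ μ i) {p : Fin d → Fin (2 ^ i + 1)}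
    (hp : meshNode i p ∉ Γ) {v : net.Fn} (hv : net.interp Γ i v = 0) : net.coef i p v = 0 := by
  rw [← h.coef_interp hp, hv]
  simp [coef, massOn]

theorem VH_le_V (h : net.IsAdmissible Γ R₀ σ ρ μ i) : net.VH Γ i ≤ net.V Γ := by
  refine Submodule.span_le.2 ?_
  rintro _ ⟨p, hp, rfl⟩ x hx
  exact hat_eq_zero_on_boundary h.faces hp hx

theorem interp_mem_VH (v : net.Fn) : net.interp Γ i v ∈ net.VH Γ i := by
  rw [interp_eq]
  refine Submodule.sum_mem _ fun q _ => ?_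
  split_ifs with hq
  · simp
  · exact Submodule.smul_mem _ _ (Submodule.subset_span ⟨q, hq, rfl⟩)

theorem interp_mem_V (h : net.IsAdmissible Γ R₀ σ ρ μ i) (v : net.Fn) :
    net.interp Γ i v ∈ net.V Γ := h.VH_le_V (interp_mem_VH v)

end IsAdmissible

end SpatialNetwork

/-! ### Stability and approximation estimates -/

namespace SpatialNetwork

variable {d : ℕ} {net : SpatialNetwork d}

/-- Lifting an edgewise estimate to the Laplace form. -/
theorem sum_lap_le {ι : Type*} [Fintype ι] (v : ι → net.Fn) (w : net.Fn) (r : ℝ)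
    (G : net.nodes → ℝ)
    (h : ∀ x y, net.graph.Adj x y →
      ∑ p, (v p x - v p y) ^ 2 / dist (x : Pt d) (y : Pt d) ≤
        r * ((w x - w y) ^ 2 / dist (x : Pt d) (y : Pt d)) +
          (dist (x : Pt d) (y : Pt d) * G x + dist (x : Pt d) (y : Pt d) * G y)) :
    ∑ p, net.lap (v p) ≤ r * net.lap w + 2 * ∑ x, net.massAt x * G x := by
  have e : 2 * ∑ x, net.massAt x * G x = ∑ x, (1 / 2) * ∑ y : net.nodes,
      (if net.graph.Adj x y then dist (x : Pt d) (y : Pt d) * G x else 0) +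
      ∑ x, (1 / 2) * ∑ y : net.nodes,
      (if net.graph.Adj x y then dist (x : Pt d) (y : Pt d) * G y else 0) := by
    rw [sum_adj_dist_fst, sum_adj_dist_snd]; ring
  rw [e, ← Finset.sum_add_distrib, lap_eq_sum, Finset.mul_sum, ← Finset.sum_add_distrib]
  simp only [lap_eq_sum]
  rw [Finset.sum_comm]
  refine Finset.sum_le_sum fun x _ => ?_
  unfold lapAt
  rw [← Finset.mul_sum, ← mul_add, mul_left_comm, ← mul_add]
  refine mul_le_mul_of_nonneg_left ?_ (by norm_num)
  rw [Finset.sum_comm, Finset.mul_sum, ← Finset.sum_add_distrib, ← Finset.sum_add_distrib]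
  refine Finset.sum_le_sum fun y _ => ?_
  by_cases hxy : net.graph.Adj x y
  · simp only [if_pos hxy]; exact h x y hxy
  · simp [if_neg hxy]

theorem sum_massOn_element (i : ℕ) (u v : net.Fn) :
    ∑ c : Fin d → Fin (2 ^ i), net.massOn (element i c) u v = net.mass u v := by
  unfold massOn
  rw [Finset.sum_comm, mass_eq_sum]
  exact Finset.sum_congr rfl fun x _ => sum_ite_mem_element (net.nodes_mem x x.2) _

theorem LocalOperator.sum_bilinOn_element (K : net.LocalOperator) (i : ℕ) (u v : net.Fn) :
    ∑ c : Fin d → Fin (2 ^ i), K.bilinOn (element i c) u v = K.bilin u v := by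
  simp only [LocalOperator.bilin, LocalOperator.bilinOn_apply, LocalOperator.formOn]
  rw [Finset.sum_comm]
  simp only [Set.mem_univ, if_true]
  exact Finset.sum_congr rfl fun x _ => sum_ite_mem_element (net.nodes_mem x x.2) _

/-- At most `2 ^ d` hats are nonzero at each of the two points, and each hat has Lipschitz constant
`d / H`. -/
theorem sum_sq_hat_sub_le (i : ℕ) (x y : Pt d) :
    ∑ q : Fin d → Fin (2 ^ i + 1), (hat i q x - hat i q y) ^ 2 ≤
      2 * 2 ^ d * (d * dist x y / meshSize i) ^ 2 := by
  set A := (d * dist x y / meshSize i) ^ 2 with hA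
  have hA0 : 0 ≤ A := sq_nonneg _
  have h1 : ∀ z : Pt d, (∑ q : Fin d → Fin (2 ^ i + 1), if hat i q z ≠ 0 then A else 0) ≤
      2 ^ d * A := by
    intro z
    have := sum_ite_le_of_near (N := 2 ^ i + 1) (r := 1) (fun j => z j / meshSize i)
      (P := fun q => hat i q z ≠ 0) (fun q hq j => by
        simpa using abs_div_sub_lt_one_of_hat_ne_zero hq j) hA0
    rwa [Nat.cast_one, mul_one] at this
  calc _ ≤ ∑ q : Fin d → Fin (2 ^ i + 1), ((if hat i q x ≠ 0 then A else 0) +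
        if hat i q y ≠ 0 then A else 0) := by
        refine Finset.sum_le_sum fun q _ => ?_
        have hq : (hat i q x - hat i q y) ^ 2 ≤ A := by
          rw [← sq_abs]
          exact pow_le_pow_left₀ (abs_nonneg _) (abs_hat_sub_le q x y) 2
        by_cases hx : hat i q x = 0 <;> by_cases hy : hat i q y = 0 <;>
          simp [hx, hy] at hq ⊢ <;> linarith
    _ ≤ _ := by
        rw [Finset.sum_add_distrib]
        linarith [h1 x, h1 y]

namespace IsAdmissible

variable {Γ : Set (Pt d)} {R₀ σ ρ μ : ℝ} {i : ℕ}

/-- Inverse estimate for coarse functions. -/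
theorem lap_sum_basisFn_le (h : net.IsAdmissible Γ R₀ σ ρ μ i)
    (a : (Fin d → Fin (2 ^ i + 1)) → ℝ) :
    net.lap (∑ q, a q • net.basisFn i q) ≤
      4 * 2 ^ d * d ^ 2 / meshSize i ^ 2 * (σ * 2 ^ d * (ρ * meshSize i ^ d)) * ∑ q, a q ^ 2 := by
  have hH := meshSize_pos i
  let D : (Fin d → Fin (2 ^ i + 1)) → net.nodes → ℝ := fun q x =>
    if hat i q (x : Pt d) ≠ 0 then 1 else 0
  set A := 2 * 2 ^ d * d ^ 2 / meshSize i ^ 2 with hA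
  have hA0 : 0 ≤ A := by positivity
  -- A family of one function with `w = 0`: edge differences of coarse functions are paid for
  -- entirely by the mass terms of the endpoints.
  have key := sum_lap_le (net := net) (ι := Unit) (fun _ => ∑ q, a q • net.basisFn i q) 0 0
    (fun x => A * ∑ q, a q ^ 2 * D q x) ?_
  · simp only [Finset.univ_unique, Finset.sum_singleton, zero_mul, zero_add] at key
    refine key.trans ?_
    have e : ∑ x, net.massAt x * (A * ∑ q, a q ^ 2 * D q x) =
        A * ∑ q, a q ^ 2 * ∑ x, net.massAt x * D q x := by
      simp only [Finset.mul_sum]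
      rw [Finset.sum_comm]
      exact Finset.sum_congr rfl fun q _ => Finset.sum_congr rfl fun x _ => by ring
    rw [e]
    have h2 : ∑ q, a q ^ 2 * ∑ x, net.massAt x * D q x ≤
        ∑ q, a q ^ 2 * (σ * 2 ^ d * (ρ * meshSize i ^ d)) :=
      Finset.sum_le_sum fun q _ => mul_le_mul_of_nonneg_left (h.sum_massAt_hat_le q) (sq_nonneg _)
    rw [← Finset.sum_mul] at h2
    calc _ ≤ 2 * (A * ((∑ q, a q ^ 2) * (σ * 2 ^ d * (ρ * meshSize i ^ d)))) := by gcongr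
      _ = _ := by rw [hA]; ring
  · intro x y hxy
    have hd : 0 < dist (x : Pt d) (y : Pt d) := dist_pos.2 fun h => hxy.ne (Subtype.ext h)
    simp only [Finset.univ_unique, Finset.sum_singleton, zero_mul, zero_add]
    rw [div_le_iff₀ hd, sum_smul_basisFn_apply, sum_smul_basisFn_apply, ← Finset.sum_sub_distrib]
    -- An edge sees only the hats active at one of its endpoints; dropping the other coefficients
    -- before Cauchy-Schwarz keeps the bound local.
    have e : ∀ q, a q * hat i q (x : Pt d) - a q * hat i q (y : Pt d) =
        (if hat i q (x : Pt d) ≠ 0 ∨ hat i q (y : Pt d) ≠ 0 then a q else 0) *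
          (hat i q (x : Pt d) - hat i q (y : Pt d)) := by
      intro q
      split_ifs with hq
      · ring
      · push Not at hq; rw [hq.1, hq.2]; ring
    rw [Finset.sum_congr rfl fun q _ => e q]
    have h1 := Finset.sum_mul_sq_le_sq_mul_sq Finset.univ
      (fun q => if hat i q (x : Pt d) ≠ 0 ∨ hat i q (y : Pt d) ≠ 0 then a q else 0)
      (fun q => hat i q (x : Pt d) - hat i q (y : Pt d))
    have h2 := sum_sq_hat_sub_le i (x : Pt d) (y : Pt d)
    have h3 : ∑ q, (if hat i q (x : Pt d) ≠ 0 ∨ hat i q (y : Pt d) ≠ 0 then a q else 0) ^ 2 ≤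
        ∑ q, a q ^ 2 * D q x + ∑ q, a q ^ 2 * D q y := by
      rw [← Finset.sum_add_distrib]
      refine Finset.sum_le_sum fun q _ => ?_
      have := sq_nonneg (a q)
      by_cases hx : hat i q (x : Pt d) = 0 <;> by_cases hy : hat i q (y : Pt d) = 0 <;>
        simp [D, hx, hy]
      exact this
    have h4 : 0 ≤ ∑ q, a q ^ 2 * D q x + ∑ q, a q ^ 2 * D q y :=
      le_trans (Finset.sum_nonneg fun q _ => sq_nonneg _) h3
    calc _ ≤ _ := h1
      _ ≤ (∑ q, a q ^ 2 * D q x + ∑ q, a q ^ 2 * D q y) *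
          (2 * 2 ^ d * (d * dist (x : Pt d) (y : Pt d) / meshSize i) ^ 2) := by
        gcongr
      _ = _ := by rw [hA]; ring

/-- An element is the own element of vertices of itself only, hence of at most `2 ^ d` mesh nodes.
-/
theorem sum_massOn_ownElement_le (v : net.Fn) :
    ∑ p, net.massOn (element i (ownElement i p)) v v ≤ 2 ^ d * net.mass v v := by
  have e : ∀ p, net.massOn (element i (ownElement i p)) v v =
      ∑ c, if ownElement i p = c then net.massOn (element i c) v v else 0 := by
    intro p; simp
  rw [Finset.sum_congr rfl fun p _ => e p, Finset.sum_comm, ← sum_massOn_element i, Finset.mul_sum]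
  refine Finset.sum_le_sum fun c _ => ?_
  have := sum_ite_le_of_near (N := 2 ^ i + 1) (r := 1) (fun j => ((c j : ℕ) : ℝ) + 1 / 2)
    (P := fun p => ownElement i p = c) (fun p hp j => by
      have := abs_sub_lt_of_isVertex (hp ▸ isVertex_ownElement p : IsVertex c p) j
      simpa using this) (net.massOn_self_nonneg (element i c) v)
  rwa [Nat.cast_one, mul_one] at this

/-- Stability of the interpolant from `M` to `L`. -/
theorem lap_interp_le (h : net.IsAdmissible Γ R₀ σ ρ μ i) (u : net.Fn) :
    net.lap (net.interp Γ i u) ≤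
      4 * 2 ^ d * d ^ 2 * (σ * 2 ^ d) * (4 * (4 * d) ^ d * 2 ^ d) / meshSize i ^ 2 *
        net.mass u u := by
  have hH := meshSize_pos i
  have hσ := h.one_le_σ
  rw [interp_eq]
  refine (h.lap_sum_basisFn_le _).trans ?_
  have h1 : (∑ q, (if meshNode i q ∈ Γ then 0 else net.coef i q u) ^ 2) *
      (ρ * meshSize i ^ d) ≤ 4 * (4 * d) ^ d * (2 ^ d * net.mass u u) := by
    calc _ ≤ ∑ q, 4 * (4 * d) ^ d * net.massOn (element i (ownElement i q)) u u := by
          rw [Finset.sum_mul]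
          refine Finset.sum_le_sum fun q _ => ?_
          split_ifs
          · rw [zero_pow two_ne_zero, zero_mul]
            exact mul_nonneg (by positivity) (net.massOn_self_nonneg _ _)
          · exact h.sq_coef_le q u
      _ ≤ _ := by
          rw [← Finset.mul_sum]
          gcongr
          exact sum_massOn_ownElement_le u
  calc _ = 4 * 2 ^ d * d ^ 2 / meshSize i ^ 2 * (σ * 2 ^ d) *
        ((∑ q, (if meshNode i q ∈ Γ then 0 else net.coef i q u) ^ 2) * (ρ * meshSize i ^ d)) := by
        ring
    _ ≤ 4 * 2 ^ d * d ^ 2 / meshSize i ^ 2 * (σ * 2 ^ d) *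
        (4 * (4 * d) ^ d * (2 ^ d * net.mass u u)) := by gcongr
    _ = _ := by ring

theorem sum_sq_hat_le_one {z : Pt d} (hz : z ∈ unitCube d) :
    ∑ p : Fin d → Fin (2 ^ i + 1), hat i p z ^ 2 ≤ 1 := by
  rw [← sum_hat hz (i := i)]
  exact Finset.sum_le_sum fun p _ => pow_le_of_le_one (hat_nonneg p z) (hat_le_one p z) two_ne_zero

/-- Localization by the partition of unity in `M`. -/
theorem sum_mass_basisFn_mul_le (w : net.Fn) :
    ∑ p, net.mass (net.basisFn i p * w) (net.basisFn i p * w) ≤ net.mass w w := by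
  simp only [mass_eq_sum]
  rw [Finset.sum_comm]
  refine Finset.sum_le_sum fun x _ => ?_
  have h1 := sum_sq_hat_le_one (i := i) (net.nodes_mem x x.2)
  have h2 : 0 ≤ net.massAt x * w x * w x := by
    rw [mul_assoc]; exact mul_nonneg (net.massAt_nonneg x) (mul_self_nonneg _)
  calc _ = (∑ p : Fin d → Fin (2 ^ i + 1), hat i p (x : Pt d) ^ 2) *
        (net.massAt x * w x * w x) := by
        rw [Finset.sum_mul]
        exact Finset.sum_congr rfl fun p _ => by simp only [Pi.mul_apply, basisFn]; ring
    _ ≤ _ := mul_le_of_le_one_left h2 h1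

/-- Localization by the partition of unity in `L`. -/
theorem sum_lap_basisFn_mul_le (w : net.Fn) :
    ∑ p, net.lap (net.basisFn i p * w) ≤
      2 * net.lap w + 8 * 2 ^ d * d ^ 2 / meshSize i ^ 2 * net.mass w w := by
  have hH := meshSize_pos i
  have key := sum_lap_le (net := net) (fun p => net.basisFn i p * w) w 2
    (fun x => 4 * 2 ^ d * d ^ 2 / meshSize i ^ 2 * w x ^ 2) ?_
  · refine key.trans_eq ?_
    rw [mass_eq_sum, Finset.mul_sum, Finset.mul_sum]
    congr 1
    exact Finset.sum_congr rfl fun x _ => by ring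
  · intro x y hxy
    have hd : 0 < dist (x : Pt d) (y : Pt d) := dist_pos.2 fun h => hxy.ne (Subtype.ext h)
    rw [← Finset.sum_div, div_le_iff₀ hd]
    -- Discrete product rule: `φ x * w x - φ y * w y = φ x * (w x - w y) + w y * (φ x - φ y)`.
    have h1 : ∀ p, ((net.basisFn i p * w) x - (net.basisFn i p * w) y) ^ 2 ≤
        2 * (w x - w y) ^ 2 * hat i p (x : Pt d) ^ 2 +
          2 * w y ^ 2 * (hat i p (x : Pt d) - hat i p (y : Pt d)) ^ 2 := by
      intro p
      simp only [Pi.mul_apply, basisFn]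
      nlinarith [sq_nonneg (hat i p (x : Pt d) * (w x - w y) -
        w y * (hat i p (x : Pt d) - hat i p (y : Pt d)))]
    have h2 := sum_sq_hat_le_one (i := i) (net.nodes_mem x x.2)
    have h3 := sum_sq_hat_sub_le i (x : Pt d) (y : Pt d)
    calc _ ≤ ∑ p, (2 * (w x - w y) ^ 2 * hat i p (x : Pt d) ^ 2 +
          2 * w y ^ 2 * (hat i p (x : Pt d) - hat i p (y : Pt d)) ^ 2) :=
          Finset.sum_le_sum fun p _ => h1 p
      _ ≤ 2 * (w x - w y) ^ 2 * 1 + 2 * w y ^ 2 *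
          (2 * 2 ^ d * (d * dist (x : Pt d) (y : Pt d) / meshSize i) ^ 2) := by
          rw [Finset.sum_add_distrib, ← Finset.mul_sum, ← Finset.mul_sum]
          gcongr
      _ ≤ 2 * (w x - w y) ^ 2 + (4 * 2 ^ d * d ^ 2 / meshSize i ^ 2 * w x ^ 2 +
          4 * 2 ^ d * d ^ 2 / meshSize i ^ 2 * w y ^ 2) * dist (x : Pt d) (y : Pt d) ^ 2 := by
          have : 0 ≤ 4 * 2 ^ d * d ^ 2 / meshSize i ^ 2 * w x ^ 2 * dist (x : Pt d) (y : Pt d) ^ 2 := by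
            positivity
          have e : 2 * w y ^ 2 *
            (2 * 2 ^ d * (d * dist (x : Pt d) (y : Pt d) / meshSize i) ^ 2) =
            4 * 2 ^ d * d ^ 2 / meshSize i ^ 2 * w y ^ 2 * dist (x : Pt d) (y : Pt d) ^ 2 := by ring
          rw [e]
          linarith
      _ = _ := by field_simp

/-- The lower corner of an element. -/
def lowerCorner (c : Fin d → Fin (2 ^ i)) : Fin d → Fin (2 ^ i + 1) := fun j => (c j).castSucc

theorem ownElement_lowerCorner (c : Fin d → Fin (2 ^ i)) : ownElement i (lowerCorner c) = c := by
  funext j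
  apply Fin.ext
  have := (c j).2
  simp only [ownElement, lowerCorner, Fin.val_castSucc]
  omega

theorem coef_one (h : net.IsAdmissible Γ R₀ σ ρ μ i) (p : Fin d → Fin (2 ^ i + 1)) :
    net.coef i p 1 = 1 := by
  have e : (1 : net.Fn) = ∑ q, (1 : ℝ) • net.basisFn i q := by
    funext x
    rw [sum_smul_basisFn_apply]
    simp [sum_hat (net.nodes_mem x x.2)]
  rw [e, coef_sum]
  simp [h.coef_basisFn]

/-- Points at sup-distance less than `3 * H` from the center of an element. -/
def nearElement (c : Fin d → Fin (2 ^ i)) : Set (Pt d) :=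
  {z | ∀ j, |z j - elementCenter i c j| < 3 * meshSize i}

/-- The coefficient functional at the lower corner annihilates `w` and reproduces constants. Applied
to `w - a`, with `a` from the Poincaré inequality, it returns `-a`, so `a` is controlled by `w - a`
and no boundary condition is needed. -/
theorem massOn_element_le_of_notMem (h : net.IsAdmissible Γ R₀ σ ρ μ i) {w : net.Fn}
    (hI : net.interp Γ i w = 0) {c : Fin d → Fin (2 ^ i)} (hc : meshNode i (lowerCorner c) ∉ Γ) :
    net.massOn (element i c) w w ≤
      (2 + 8 * σ * (4 * d) ^ d) * μ ^ 2 * meshSize i ^ 2 * net.lapOn (nearElement c) w := by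
  have hH := meshSize_pos i
  have hR₀ := h.props.R₀_pos
  have h8 := h.eight_mul_le
  have hσ := h.one_le_σ
  obtain ⟨a, ha⟩ := h.poincare.poincare (elementCenter i c) (meshSize i / 2) (by linarith)
    (closedCube_elementCenter_subset c) w
  set t := net.massOn (element i c) (fun y => w y - a) (fun y => w y - a) with ht
  have ht0 : 0 ≤ t := net.massOn_self_nonneg _ _
  have e : (fun y => w y - a) = w - a • (1 : net.Fn) := by
    funext y; simp
  have hl : net.lapOn (box (elementCenter i c) (meshSize i / 2 + R₀)) w ≤
      net.lapOn (nearElement c) w := by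
    refine net.lapOn_mono w fun x hx j => ?_
    have := hx.2 j
    rw [abs_lt]
    rcases this with ⟨h1, h2 | ⟨h2, h3⟩⟩ <;> constructor <;> linarith
  have ht1 : t ≤ μ ^ 2 * meshSize i ^ 2 * net.lapOn (nearElement c) w := by
    have h1 : √t ≤ μ * (meshSize i / 2) *
      √(net.lapOn (box (elementCenter i c) (meshSize i / 2 + R₀)) w) := ha
    have h2 := pow_le_pow_left₀ (Real.sqrt_nonneg _) h1 2
    rw [Real.sq_sqrt ht0, mul_pow, Real.sq_sqrt (net.lapOn_nonneg _ _)] at h2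
    have h3 := net.lapOn_nonneg (nearElement c) w
    calc t ≤ _ := h2
      _ ≤ (μ * (meshSize i / 2)) ^ 2 * net.lapOn (nearElement c) w := by gcongr
      _ ≤ (μ * meshSize i) ^ 2 * net.lapOn (nearElement c) w := by
          have := h.poincare.nonneg
          gcongr
          linarith
      _ = _ := by ring
  have ha2 : a ^ 2 * (ρ * meshSize i ^ d) ≤ 4 * (4 * d) ^ d * t := by
    have h1 := h.sq_coef_le (lowerCorner c) (w - a • (1 : net.Fn))
    have h2 : net.coef i (lowerCorner c) (w - a • (1 : net.Fn)) = - a := by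
      have : net.coef i (lowerCorner c) (w - a • (1 : net.Fn)) =
          net.coef i (lowerCorner c) w - a * net.coef i (lowerCorner c) 1 := by
        change net.massForm _ _ _ = _
        rw [map_sub, map_smul, smul_eq_mul]
        rfl
      rw [this, h.coef_eq_zero hc hI, h.coef_one]; ring
    rw [h2, neg_sq, ownElement_lowerCorner, ← e] at h1
    exact h1
  have e2 : w = (w - a • (1 : net.Fn)) - (-a) • (1 : net.Fn) := by
    funext y; simp
  have h3 : net.massOn (element i c) w w ≤
      2 * (t + a ^ 2 * net.massOn (element i c) 1 1) := by
    have := (net.isPsdForm_massForm (element i c)).apply_sub_self_le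
      (w - a • (1 : net.Fn)) ((-a) • (1 : net.Fn))
    rw [← e2, massForm_apply, massForm_apply, massForm_apply, massOn_smul_self, neg_sq, ← e] at this
    exact this
  have h4 : a ^ 2 * net.massOn (element i c) 1 1 ≤ σ * (4 * (4 * d) ^ d * t) := by
    calc _ ≤ a ^ 2 * (σ * (ρ * meshSize i ^ d)) := by
          gcongr
          exact h.massOn_element_le c
      _ = σ * (a ^ 2 * (ρ * meshSize i ^ d)) := by ring
      _ ≤ _ := by gcongr
  calc _ ≤ _ := h3
    _ ≤ 2 * (t + σ * (4 * (4 * d) ^ d * t)) := by gcongr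
    _ = (2 + 8 * σ * (4 * d) ^ d) * t := by ring
    _ ≤ (2 + 8 * σ * (4 * d) ^ d) * (μ ^ 2 * meshSize i ^ 2 * net.lapOn (nearElement c) w) := by
        gcongr
    _ = _ := by ring

/-- Here the coefficient at the lower corner carries no information about `w`. Instead a face of `Γ`
passes through that corner, and Friedrichs applies on the inner box around it. -/
theorem massOn_element_le_of_mem (h : net.IsAdmissible Γ R₀ σ ρ μ i) {w : net.Fn}
    (hw : w ∈ net.V Γ) {c : Fin d → Fin (2 ^ i)} (hc : meshNode i (lowerCorner c) ∈ Γ) :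
    net.massOn (element i c) w w ≤ μ ^ 2 * meshSize i ^ 2 * net.lapOn (nearElement c) w := by
  have hH := meshSize_pos i
  have hR₀ := h.props.R₀_pos
  have h8 := h.eight_mul_le
  set y := meshNode i (lowerCorner c) with hy
  have hyU : y ∈ unitCube d := meshNode_mem_unitCube _
  have hR0 : 0 < innerRadius i := by linarith [h.R₀_le_innerRadius]
  have hyc : ∀ j, elementCenter i c j = y j + meshSize i / 2 := by
    intro j
    simp only [hy, elementCenter, meshNode, lowerCorner, Fin.val_castSucc]; ring
  have hflat : ∃ y' j, flatCube y' j (innerRadius i) ⊆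
      Γ ∩ closedCube (innerCenter i y) (innerRadius i) := by
    obtain ⟨b, j, e, he, ⟨hye, hyb⟩, hsub⟩ := h.faces y hc
    -- The flat cube is centered in the face through the corner; it lies in that face because
    -- `innerRadius i ≤ H`.
    refine ⟨WithLp.toLp 2 fun l => if l = j then e else elementCenter i b l, j, fun z hz => ?_⟩
    have hzb : z ∈ closedCube (elementCenter i b) (meshSize i / 2) := by
      intro l
      by_cases hl : l = j
      · subst hl
        have h1 := hz.1
        simp only [if_true] at h1
        rw [h1, ← hye]
        exact hyb l
      · have h1 := hz.2 l hl
        simp only [if_neg hl] at h1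
        have := innerRadius_le (i := i)
        constructor <;> linarith [h1.1, h1.2]
    have hzf : z ∈ meshFace i b j e := ⟨by simpa using hz.1, hzb⟩
    refine ⟨hsub hzf, mem_closedCube_innerCenter hyU (closedCube_elementCenter_subset b hzb)
      fun l => ?_⟩
    have h1 := hyb l
    have h2 := hzb l
    rw [abs_le]
    constructor <;> linarith [h1.1, h1.2, h2.1, h2.2]
  have hfr := h.poincare.friedrichs (innerCenter i y) (innerRadius i) h.R₀_le_innerRadius
    (closedCube_innerCenter_subset y) hflat w hw
  have h1 : net.massOn (element i c) w w ≤
      net.massOn (box (innerCenter i y) (innerRadius i)) w w := by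
    refine net.massOn_self_mono (fun z hz => ?_) w
    refine mem_box_innerCenter hyU hz.1 fun j => ?_
    have h1 := hz.2 j
    rw [hyc] at h1
    refine ⟨by linarith [h1.1], ?_⟩
    rcases h1.2 with h2 | ⟨h2, h3⟩
    · exact Or.inl (by linarith)
    · exact Or.inr ⟨h2, by linarith⟩
  have hl : net.lapOn (box (innerCenter i y) (innerRadius i + R₀)) w ≤
      net.lapOn (nearElement c) w := by
    refine net.lapOn_mono w fun x hx j => ?_
    have h1 := hx.2 j
    have h2 := abs_le.1 (abs_innerCenter_sub_le (i := i) hyU j)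
    have h3 := innerRadius_le (i := i)
    rw [hyc, abs_lt]
    rcases h1 with ⟨h1, h4 | ⟨h4, h5⟩⟩ <;> constructor <;> linarith
  have h2 := pow_le_pow_left₀ (Real.sqrt_nonneg _) hfr 2
  rw [Real.sq_sqrt (net.massOn_self_nonneg _ _), mul_pow, Real.sq_sqrt (net.lapOn_nonneg _ _)] at h2
  have h3 := net.lapOn_nonneg (nearElement c) w
  have h4 := h.poincare.nonneg
  calc _ ≤ _ := h1
    _ ≤ _ := h2
    _ ≤ (μ * meshSize i) ^ 2 * net.lapOn (nearElement c) w := by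
        have := innerRadius_le (i := i)
        have := net.lapOn_nonneg (box (innerCenter i y) (innerRadius i + R₀)) w
        gcongr
    _ = _ := by ring

/-- Fine-scale functions are small in `M`. -/
theorem mass_le_of_interp_eq_zero (h : net.IsAdmissible Γ R₀ σ ρ μ i) {w : net.Fn}
    (hw : w ∈ net.V Γ) (hI : net.interp Γ i w = 0) :
    net.mass w w ≤ 6 ^ d * (2 + 8 * σ * (4 * d) ^ d) * μ ^ 2 * meshSize i ^ 2 * net.lap w := by
  have hH := meshSize_pos i
  have hσ := h.one_le_σ
  have hloc : ∀ c : Fin d → Fin (2 ^ i), net.massOn (element i c) w w ≤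
      (2 + 8 * σ * (4 * d) ^ d) * μ ^ 2 * meshSize i ^ 2 * net.lapOn (nearElement c) w := by
    intro c
    by_cases hc : meshNode i (lowerCorner c) ∈ Γ
    · refine (h.massOn_element_le_of_mem hw hc).trans ?_
      have h1 := net.lapOn_nonneg (nearElement c) w
      have h2 : 0 ≤ 8 * σ * (4 * d) ^ d := by positivity
      have h3 : 0 ≤ μ ^ 2 * meshSize i ^ 2 * net.lapOn (nearElement c) w := by positivity
      nlinarith
    · exact h.massOn_element_le_of_notMem hI hc
  -- A point is within `3 * H` of at most `(2 * 3) ^ d` element centers.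
  have hov : ∑ c : Fin d → Fin (2 ^ i), net.lapOn (nearElement c) w ≤ 6 ^ d * net.lap w := by
    simp only [lapOn_eq]
    rw [Finset.sum_comm, lap_eq_sum, Finset.mul_sum]
    refine Finset.sum_le_sum fun x _ => ?_
    have := sum_ite_le_of_near (N := 2 ^ i) (r := 3)
      (fun j => (x : Pt d) j / meshSize i - 1 / 2) (P := fun c => (x : Pt d) ∈ nearElement c)
      (fun c hc j => by
        have h1 := hc j
        have e : (x : Pt d) j - elementCenter i c j =
            ((x : Pt d) j / meshSize i - 1 / 2 - (c j : ℕ)) * meshSize i := by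
          simp only [elementCenter]; field_simp; ring
        rw [e, abs_mul, abs_of_pos hH] at h1
        rw [Nat.cast_ofNat]
        exact lt_of_mul_lt_mul_right h1 hH.le) (net.lapAt_nonneg w x)
    norm_num at this
    exact this
  rw [← sum_massOn_element i]
  calc _ ≤ _ := Finset.sum_le_sum fun c _ => hloc c
    _ ≤ (2 + 8 * σ * (4 * d) ^ d) * μ ^ 2 * meshSize i ^ 2 * (6 ^ d * net.lap w) := by
        rw [← Finset.mul_sum]
        gcongr
    _ = _ := by ring

end IsAdmissible

end SpatialNetwork

/-! ### Localization of the corrector and the Ritz projection -/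

/-- Constant of the approximation estimate on the fine-scale space. -/
def fineConst (d : ℕ) (σ μ : ℝ) : ℝ := 6 ^ d * (2 + 8 * σ * (4 * d) ^ d) * μ ^ 2

/-- Constant of the stability estimate of the interpolant. -/
def interpConst (d : ℕ) (σ : ℝ) : ℝ :=
  4 * 2 ^ d * d ^ 2 * (σ * 2 ^ d) * (4 * (4 * d) ^ d * 2 ^ d)

/-- Stability constant of the decomposition of the fine-scale space. -/
def splitConst (d : ℕ) (σ μ α β : ℝ) : ℝ :=
  2 + |2 * β / α * (2 + (8 * 2 ^ d * d ^ 2 + interpConst d σ) * fineConst d σ μ)|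

/-- Contraction factor of the localization. -/
def contraction (d : ℕ) (σ μ α β : ℝ) : ℝ := 1 - 1 / (splitConst d σ μ α β * 14 ^ d)

/-- The summand `2` and the absolute value in `splitConst` make this hold without sign conditions,
so `contraction` lies in `(0, 1)` and the layer factor is positive for all parameters. -/
theorem two_le_splitConst (d : ℕ) (σ μ α β : ℝ) : 2 ≤ splitConst d σ μ α β := by
  unfold splitConst
  linarith [abs_nonneg (2 * β / α * (2 + (8 * 2 ^ d * d ^ 2 + interpConst d σ) * fineConst d σ μ))]

theorem contraction_pos (d : ℕ) (σ μ α β : ℝ) : 0 < contraction d σ μ α β := by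
  have h1 := two_le_splitConst d σ μ α β
  have h2 : (1 : ℝ) ≤ 14 ^ d := one_le_pow₀ (by norm_num)
  have h3 : 2 ≤ splitConst d σ μ α β * 14 ^ d := by nlinarith
  unfold contraction
  rw [sub_pos, div_lt_one (by linarith)]
  linarith

theorem contraction_lt_one (d : ℕ) (σ μ α β : ℝ) : contraction d σ μ α β < 1 := by
  have h1 := two_le_splitConst d σ μ α β
  unfold contraction
  have : 0 < 1 / (splitConst d σ μ α β * 14 ^ d) := by positivity
  linarith

namespace SpatialNetwork

variable {d : ℕ} {net : SpatialNetwork d}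

/-- The interpolant as a linear map. -/
def interpLin (net : SpatialNetwork d) (Γ : Set (Pt d)) (i : ℕ) : net.Fn →ₗ[ℝ] net.Fn where
  toFun := net.interp Γ i
  map_add' := net.interp_add Γ i
  map_smul' := net.interp_smul Γ i

theorem interpLin_apply (Γ : Set (Pt d)) (i : ℕ) (v : net.Fn) :
    net.interpLin Γ i v = net.interp Γ i v := rfl

/-- Fine-scale functions supported near the mesh node `p`. -/
def nodeSpace (net : SpatialNetwork d) (Γ : Set (Pt d)) (i : ℕ) (p : Fin d → Fin (2 ^ i + 1)) :
    Submodule ℝ net.Fn :=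
  net.fineSpaceOn Γ i {z | ∀ j, |z j - meshNode i p j| < 3 * meshSize i}

theorem fineSpaceOn_mono {Γ : Set (Pt d)} {i : ℕ} {ω ω' : Set (Pt d)} (h : ω ⊆ ω') :
    net.fineSpaceOn Γ i ω ≤ net.fineSpaceOn Γ i ω' :=
  fun _ hv => ⟨hv.1, hv.2.1, fun x hx => hv.2.2 x fun hx' => hx (h hx')⟩

theorem fineSpaceOn_le_V {Γ : Set (Pt d)} {i : ℕ} {ω : Set (Pt d)} :
    net.fineSpaceOn Γ i ω ≤ net.V Γ := fun _ hv => hv.1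

theorem lt_of_ne_zero_of_mem_nodeSpace {Γ : Set (Pt d)} {i : ℕ} {p : Fin d → Fin (2 ^ i + 1)}
    {v : net.Fn} (hv : v ∈ net.nodeSpace Γ i p) {x : net.nodes} (hx : v x ≠ 0) (j : Fin d) :
    |(x : Pt d) j - meshNode i p j| < 3 * meshSize i := by
  by_contra hj
  exact hx (hv.2.2 x fun h => hj (h j))

namespace IsAdmissible

variable {Γ : Set (Pt d)} {R₀ σ ρ μ α β : ℝ} {i : ℕ} {K : net.LocalOperator}

theorem abs_coord_sub_le_of_stencil (h : net.IsAdmissible Γ R₀ σ ρ μ i) {x y : net.nodes}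
    (hy : y = x ∨ net.graph.Adj x y) (j : Fin d) : |(y : Pt d) j - (x : Pt d) j| < R₀ := by
  rcases hy with rfl | hy
  · simpa using h.props.R₀_pos
  · refine (abs_coord_sub_le_dist _ _ j).trans_lt ?_
    rw [dist_comm]
    exact h.props.locality x y hy

/-- Functions with separated supports are `K`-orthogonal. -/
theorem bilin_eq_zero_of_separated (h : net.IsAdmissible Γ R₀ σ ρ μ i) {u v : net.Fn}
    (hs : ∀ y z : net.nodes, v y ≠ 0 → u z ≠ 0 →
      ∃ j, meshSize i ≤ |(y : Pt d) j - (z : Pt d) j|) : K.bilin u v = 0 := by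
  refine K.bilinOn_eq_zero fun x y z _ hy hz => ?_
  by_contra hne
  push Not at hne
  obtain ⟨j, hj⟩ := hs y z hne.1 hne.2
  have h1 := abs_lt.1 (h.abs_coord_sub_le_of_stencil hy j)
  have h2 := abs_lt.1 (h.abs_coord_sub_le_of_stencil hz j)
  have h3 := h.eight_mul_le
  have h4 := h.props.R₀_pos
  have h5 : |(y : Pt d) j - (z : Pt d) j| < 2 * R₀ := by
    rw [abs_lt]; constructor <;> linarith
  linarith

theorem lap_le (hK : K.IsBoundedCoercive Γ α β) {v : net.Fn} (hv : v ∈ net.V Γ) :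
    net.lap v ≤ K.bilin v v / α := by
  rw [le_div_iff₀ hK.1, mul_comm]
  exact (hK.2.2 v hv).1

theorem mass_le_lap (h : net.IsAdmissible Γ R₀ σ ρ μ i) {v : net.Fn} (hv : v ∈ net.V Γ) :
    net.mass v v ≤ μ ^ 2 * net.lap v := by
  have h0 : net.mNorm v ^ 2 = net.mass v v := Real.sq_sqrt (net.massOn_self_nonneg _ v)
  have h1 := pow_le_pow_left₀ (show 0 ≤ net.mNorm v from Real.sqrt_nonneg _)
    (h.poincare.global v hv) 2
  rwa [mul_pow, Real.sq_sqrt (net.lap_nonneg v), h0] at h1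

/-- `K` need not be definite on all of `net.Fn`. On `V`, coercivity and the global Friedrichs
inequality bound the mass, and the mass is definite. -/
theorem definite (h : net.IsAdmissible Γ R₀ σ ρ μ i) (hK : K.IsBoundedCoercive Γ α β) {v : net.Fn}
    (hv : v ∈ net.V Γ) (h0 : K.bilin v v = 0) : v = 0 := by
  have := h.nontrivial
  refine net.eq_zero_of_mass_self_eq_zero (le_antisymm ?_ (net.massOn_self_nonneg _ v))
  have h1 := lap_le hK hv
  rw [h0, zero_div] at h1
  have h2 := h.mass_le_lap hv
  nlinarith [net.lap_nonneg v, sq_nonneg μ]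

/-- The fine-scale part of a localized function. -/
def split (net : SpatialNetwork d) (Γ : Set (Pt d)) (i : ℕ) (w : net.Fn)
    (p : Fin d → Fin (2 ^ i + 1)) : net.Fn :=
  net.basisFn i p * w - net.interp Γ i (net.basisFn i p * w)

theorem exists_ne_zero_of_coef_ne_zero {p : Fin d → Fin (2 ^ i + 1)} {v : net.Fn}
    (hv : net.coef i p v ≠ 0) :
    ∃ z : net.nodes, (z : Pt d) ∈ element i (ownElement i p) ∧ v z ≠ 0 := by
  by_contra hne
  push Not at hne
  refine hv (Finset.sum_eq_zero fun z _ => ?_)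
  split_ifs with hz
  · rw [hne z hz, mul_zero]
  · rfl

/-- The radius `3 * H` collects three steps: from `p` to a point where `hat i p` is active, from
there to a mesh node `q` owning its element, and from `q` to a point of the support of `hat i q`. -/
theorem split_mem (h : net.IsAdmissible Γ R₀ σ ρ μ i) {w : net.Fn} (hw : w ∈ net.V Γ)
    (p : Fin d → Fin (2 ^ i + 1)) : split net Γ i w p ∈ net.nodeSpace Γ i p := by
  have hH := meshSize_pos i
  refine ⟨Submodule.sub_mem _ (net.mul_mem_V _ hw) (h.interp_mem_V _), ?_, fun x hx => ?_⟩
  · rw [split, ← interpLin_apply, map_sub, interpLin_apply, interpLin_apply, h.interp_interp,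
      sub_self]
  · by_contra hne
    refine hx fun j => ?_
    by_cases h1 : hat i p (x : Pt d) = 0
    · have h2 : net.interp Γ i (net.basisFn i p * w) x ≠ 0 := by
        intro h2
        refine hne ?_
        simp [split, h2, basisFn, h1]
      rw [interp_eq, sum_smul_basisFn_apply] at h2
      obtain ⟨q, -, hq⟩ := Finset.exists_ne_zero_of_sum_ne_zero h2
      have hq1 := left_ne_zero_of_mul hq
      have hq2 := right_ne_zero_of_mul hq
      have hq3 : net.coef i q (net.basisFn i p * w) ≠ 0 := by
        intro h0; rw [h0] at hq1; simp at hq1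
      obtain ⟨z, hz, hz0⟩ := exists_ne_zero_of_coef_ne_zero hq3
      have hz1 : hat i p (z : Pt d) ≠ 0 := left_ne_zero_of_mul hz0
      have a1 := abs_lt.1 (abs_sub_meshNode_lt_of_hat_ne_zero hq2 j)
      have a2 := abs_lt.1 (abs_sub_meshNode_lt_of_hat_ne_zero hz1 j)
      have a3 := abs_le.1 (abs_sub_meshNode_le_of_isVertex (isVertex_ownElement q) hz j)
      rw [abs_lt]
      constructor <;> linarith
    · have := abs_sub_meshNode_lt_of_hat_ne_zero h1 j
      linarith

/-- The hats sum to one, and the removed interpolants add up to the interpolant of `w`, which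
vanishes. -/
theorem sum_split {w : net.Fn} (hw : net.interp Γ i w = 0) : ∑ p, split net Γ i w p = w := by
  have e : ∑ p, net.basisFn i p * w = w := by
    rw [← Finset.sum_mul]
    funext x
    simp [basisFn, sum_hat (net.nodes_mem x x.2)]
  simp only [split]
  rw [Finset.sum_sub_distrib, e]
  simp only [← interpLin_apply]
  rw [← map_sum, e, interpLin_apply, hw, sub_zero]

theorem fineConst_nonneg (h : net.IsAdmissible Γ R₀ σ ρ μ i) : 0 ≤ fineConst d σ μ := by
  have := h.one_le_σ
  unfold fineConst
  positivity

theorem interpConst_nonneg (h : net.IsAdmissible Γ R₀ σ ρ μ i) : 0 ≤ interpConst d σ := by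
  have := h.one_le_σ
  unfold interpConst
  positivity

/-- Stability of the decomposition of the fine-scale space. -/
theorem sum_bilin_split_le (h : net.IsAdmissible Γ R₀ σ ρ μ i) (hK : K.IsBoundedCoercive Γ α β)
    {w : net.Fn} (hw : w ∈ net.V Γ) (hI : net.interp Γ i w = 0) :
    ∑ p, K.bilin (split net Γ i w p) (split net Γ i w p) ≤ splitConst d σ μ α β * K.bilin w w := by
  have hH := meshSize_pos i
  have hα := hK.1
  have hβ : 0 < β := hα.trans_le hK.2.1
  have hF := h.fineConst_nonneg
  have hJ := h.interpConst_nonneg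
  have hl := net.lap_nonneg w
  have hm : net.mass w w ≤ fineConst d σ μ * meshSize i ^ 2 * net.lap w :=
    h.mass_le_of_interp_eq_zero hw hI
  have h1 : ∀ p, K.bilin (split net Γ i w p) (split net Γ i w p) ≤
      2 * β * (net.lap (net.basisFn i p * w) + interpConst d σ / meshSize i ^ 2 *
        net.mass (net.basisFn i p * w) (net.basisFn i p * w)) := by
    intro p
    have a1 := (hK.2.2 _ (fineSpaceOn_le_V (h.split_mem hw p))).2
    have a2 := net.lap_sub_le (net.basisFn i p * w) (net.interp Γ i (net.basisFn i p * w))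
    have a3 : net.lap (net.interp Γ i (net.basisFn i p * w)) ≤
      interpConst d σ / meshSize i ^ 2 * net.mass (net.basisFn i p * w) (net.basisFn i p * w) :=
      h.lap_interp_le _
    calc _ ≤ _ := a1
      _ ≤ β * (2 * (net.lap (net.basisFn i p * w) + interpConst d σ / meshSize i ^ 2 *
        net.mass (net.basisFn i p * w) (net.basisFn i p * w))) := by
        refine mul_le_mul_of_nonneg_left (a2.trans ?_) hβ.le
        linarith
      _ = _ := by ring
  have hB : 2 * β / α * (2 + (8 * 2 ^ d * d ^ 2 + interpConst d σ) * fineConst d σ μ) ≤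
      splitConst d σ μ α β := by
    unfold splitConst
    linarith [le_abs_self (2 * β / α * (2 + (8 * 2 ^ d * d ^ 2 + interpConst d σ) *
      fineConst d σ μ))]
  calc _ ≤ _ := Finset.sum_le_sum fun p _ => h1 p
    _ = 2 * β * (∑ p, net.lap (net.basisFn i p * w) + interpConst d σ / meshSize i ^ 2 *
        ∑ p, net.mass (net.basisFn i p * w) (net.basisFn i p * w)) := by
        rw [← Finset.mul_sum, Finset.sum_add_distrib, ← Finset.mul_sum]
    _ ≤ 2 * β * ((2 * net.lap w + 8 * 2 ^ d * d ^ 2 / meshSize i ^ 2 * net.mass w w) +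
        interpConst d σ / meshSize i ^ 2 * net.mass w w) := by
        gcongr
        · exact sum_lap_basisFn_mul_le w
        · exact sum_mass_basisFn_mul_le w
    _ = 2 * β * (2 * net.lap w + (8 * 2 ^ d * d ^ 2 + interpConst d σ) / meshSize i ^ 2 *
        net.mass w w) := by ring
    -- The fine-scale estimate provides the factor `H ^ 2` that cancels the inverse power produced
    -- by cut-off and interpolation.
    _ ≤ 2 * β * (2 * net.lap w + (8 * 2 ^ d * d ^ 2 + interpConst d σ) / meshSize i ^ 2 *
        (fineConst d σ μ * meshSize i ^ 2 * net.lap w)) := by gcongr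
    _ = 2 * β * (2 + (8 * 2 ^ d * d ^ 2 + interpConst d σ) * fineConst d σ μ) * net.lap w := by
        field_simp
    _ ≤ 2 * β * (2 + (8 * 2 ^ d * d ^ 2 + interpConst d σ) * fineConst d σ μ) *
        (K.bilin w w / α) := by
        gcongr
        exact lap_le hK hw
    _ = 2 * β / α * (2 + (8 * 2 ^ d * d ^ 2 + interpConst d σ) * fineConst d σ μ) *
        K.bilin w w := by ring
    _ ≤ _ := mul_le_mul_of_nonneg_right hB (K.isPsdForm_bilin.nonneg w)

theorem abs_meshNode_sub (p q : Fin d → Fin (2 ^ i + 1)) (j : Fin d) :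
    |meshNode i p j - meshNode i q j| = |((p j : ℕ) : ℝ) - ((q j : ℕ) : ℝ)| * meshSize i := by
  have hH := meshSize_pos i
  simp only [meshNode]
  rw [← sub_mul, abs_mul, abs_of_pos hH]

/-- Finite overlap of the node spaces. -/
theorem bilin_sum_le (h : net.IsAdmissible Γ R₀ σ ρ μ i) {P : (Fin d → Fin (2 ^ i + 1)) → net.Fn}
    (hP : ∀ p, P p ∈ net.nodeSpace Γ i p) :
    K.bilin (∑ p, P p) (∑ p, P p) ≤ 14 ^ d * ∑ p, K.bilin (P p) (P p) := by
  have hH := meshSize_pos i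
  have hB := K.isPsdForm_bilin
  -- At seven mesh units, two supports of radius `3 * H` are still separated by `H`, which exceeds
  -- the reach of `K`.
  let near : (Fin d → Fin (2 ^ i + 1)) → (Fin d → Fin (2 ^ i + 1)) → Prop := fun p q =>
    ∀ j, |((p j : ℕ) : ℝ) - ((q j : ℕ) : ℝ)| < (7 : ℕ)
  have h1 : ∀ p q, K.bilin (P p) (P q) ≤
      (if near p q then K.bilin (P p) (P p) / 2 else 0) +
      (if near q p then K.bilin (P q) (P q) / 2 else 0) := by
    intro p q
    have hsymm : near q p ↔ near p q :=
      forall_congr' fun j => by rw [abs_sub_comm]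
    by_cases hn : near p q
    · rw [if_pos hn, if_pos (hsymm.2 hn)]
      linarith [hB.two_mul_apply_le (P p) (P q)]
    · rw [if_neg hn, if_neg fun h' => hn (hsymm.1 h'), add_zero]
      refine le_of_eq (h.bilin_eq_zero_of_separated fun y z hy hz => ?_)
      simp only [near, not_forall, not_lt] at hn
      obtain ⟨j, hj⟩ := hn
      refine ⟨j, ?_⟩
      have a1 := lt_of_ne_zero_of_mem_nodeSpace (hP q) hy j
      have a2 := lt_of_ne_zero_of_mem_nodeSpace (hP p) hz j
      have a3 : 7 * meshSize i ≤ |meshNode i p j - meshNode i q j| := by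
        rw [abs_meshNode_sub]
        push_cast at hj
        gcongr
      have a4 : meshNode i p j - meshNode i q j = ((y : Pt d) j - meshNode i q j) -
        ((z : Pt d) j - meshNode i p j) - ((y : Pt d) j - (z : Pt d) j) := by ring
      have a5 := abs_sub ((y : Pt d) j - meshNode i q j) ((z : Pt d) j - meshNode i p j)
      have a6 := abs_sub (((y : Pt d) j - meshNode i q j) -
        ((z : Pt d) j - meshNode i p j)) ((y : Pt d) j - (z : Pt d) j)
      rw [← a4] at a6
      linarith
  have h2 : ∀ p, (∑ q, if near p q then K.bilin (P p) (P p) / 2 else 0) ≤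
      14 ^ d * (K.bilin (P p) (P p) / 2) := by
    intro p
    have := sum_ite_le_of_near (N := 2 ^ i + 1) (r := 7) (fun j => ((p j : ℕ) : ℝ))
      (P := near p) (fun q hq => hq) (div_nonneg (hB.nonneg (P p)) zero_le_two)
    norm_num at this ⊢
    exact this
  calc K.bilin (∑ p, P p) (∑ p, P p) = ∑ p, ∑ q, K.bilin (P p) (P q) := by
        simp only [map_sum, LinearMap.sum_apply]
        exact Finset.sum_comm
    _ ≤ ∑ p, ∑ q, ((if near p q then K.bilin (P p) (P p) / 2 else 0) +
      (if near q p then K.bilin (P q) (P q) / 2 else 0)) :=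
        Finset.sum_le_sum fun p _ => Finset.sum_le_sum fun q _ => h1 p q
    _ = (∑ p, ∑ q, if near p q then K.bilin (P p) (P p) / 2 else 0) +
      ∑ p, ∑ q, if near p q then K.bilin (P p) (P p) / 2 else 0 := by
        simp only [Finset.sum_add_distrib]
        congr 1
        exact Finset.sum_comm
    _ ≤ ∑ p, 14 ^ d * (K.bilin (P p) (P p) / 2) + ∑ p, 14 ^ d * (K.bilin (P p) (P p) / 2) :=
        add_le_add (Finset.sum_le_sum fun p _ => h2 p) (Finset.sum_le_sum fun p _ => h2 p)
    _ = _ := by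
        rw [← Finset.sum_add_distrib, Finset.mul_sum]
        exact Finset.sum_congr rfl fun p _ => by ring

/-- The fine-scale space. -/
abbrev fineSpace (net : SpatialNetwork d) (Γ : Set (Pt d)) (i : ℕ) : Submodule ℝ net.Fn :=
  net.fineSpaceOn Γ i Set.univ

/-- One step of the localization: the error contracts while the support grows by `7 * H`. -/
theorem localize_step (h : net.IsAdmissible Γ R₀ σ ρ μ i) (hK : K.IsBoundedCoercive Γ α β)
    {c : Fin d → Fin (2 ^ i)} {v q : net.Fn} (hq : q ∈ fineSpace net Γ i)
    (hqv : ∀ y ∈ fineSpace net Γ i, K.bilin q y = K.bilinOn (element i c) v y)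
    {r : ℝ} (hr : meshSize i ≤ r) {x : net.Fn} (hx : x ∈ fineSpace net Γ i)
    (hxs : ∀ z : net.nodes, x z ≠ 0 → ∀ j, |(z : Pt d) j - elementCenter i c j| < r) :
    ∃ x' ∈ fineSpace net Γ i,
      (∀ z : net.nodes, x' z ≠ 0 → ∀ j,
        |(z : Pt d) j - elementCenter i c j| < r + 7 * meshSize i) ∧
      K.bilin (q - x') (q - x') ≤ contraction d σ μ α β * K.bilin (q - x) (q - x) := by
  have hH := meshSize_pos i
  have hB := K.isPsdForm_bilin
  have he : q - x ∈ fineSpace net Γ i := Submodule.sub_mem _ hq hx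
  have hsub : ∀ p, net.nodeSpace Γ i p ≤ fineSpace net Γ i :=
    fun p => fineSpaceOn_mono (Set.subset_univ _)
  choose P hP hPe using fun p => IsPsdForm.exists_riesz (B := K.bilin)
    (S := net.nodeSpace Γ i p) (fun y hy => h.definite hK (fineSpaceOn_le_V hy)) (K.bilin (q - x))
  -- Far from the current support the residual is zero: on such node spaces neither the element form
  -- of `v` nor `K x` acts, so the projection of the error vanishes.
  have hfar : ∀ p j, r + 4 * meshSize i ≤ |meshNode i p j - elementCenter i c j| → P p = 0 := by
    intro p j hpj
    have hmin : ∀ y ∈ net.nodeSpace Γ i p, ∀ z : net.nodes, y z ≠ 0 →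
        r + meshSize i < |(z : Pt d) j - elementCenter i c j| := by
      intro y hy z hz
      have a1 := lt_of_ne_zero_of_mem_nodeSpace hy hz j
      have a2 : meshNode i p j - elementCenter i c j = ((z : Pt d) j - elementCenter i c j) -
        ((z : Pt d) j - meshNode i p j) := by ring
      have a3 := abs_sub ((z : Pt d) j - elementCenter i c j) ((z : Pt d) j - meshNode i p j)
      rw [← a2] at a3
      linarith
    refine h.definite hK (fineSpaceOn_le_V (hP p)) ?_
    rw [hPe p _ (hP p), map_sub, LinearMap.sub_apply, hqv _ (hsub p (hP p))]
    rw [K.bilinOn_eq_zero, h.bilin_eq_zero_of_separated, sub_zero]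
    · intro y z hy hz
      refine ⟨j, ?_⟩
      have a1 := hmin _ (hP p) y hy
      have a2 := hxs z hz j
      have a3 : (y : Pt d) j - elementCenter i c j = ((y : Pt d) j - (z : Pt d) j) +
        ((z : Pt d) j - elementCenter i c j) := by ring
      have a4 := abs_add_le ((y : Pt d) j - (z : Pt d) j) ((z : Pt d) j - elementCenter i c j)
      rw [← a3] at a4
      linarith
    · intro x' y z hx' hy _
      left
      by_contra hne
      have a1 := hmin _ (hP p) y hne
      have a2 := abs_sub_elementCenter_le hx' j
      have a3 := h.abs_coord_sub_le_of_stencil hy j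
      have a4 : (y : Pt d) j - elementCenter i c j = ((y : Pt d) j - (x' : Pt d) j) +
        ((x' : Pt d) j - elementCenter i c j) := by ring
      have a5 := abs_add_le ((y : Pt d) j - (x' : Pt d) j) ((x' : Pt d) j - elementCenter i c j)
      rw [← a4] at a5
      have := h.eight_mul_le
      linarith
  have hC := two_le_splitConst d σ μ α β
  -- The damping is the overlap constant. An active node is within `r + 4 * H` of the center and its
  -- functions reach `3 * H` further, hence the growth by `7 * H`.
  refine ⟨x + (14 ^ d : ℝ)⁻¹ • ∑ p, P p, Submodule.add_mem _ hx (Submodule.smul_mem _ _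
    (Submodule.sum_mem _ fun p _ => hsub p (hP p))), fun z hz j => ?_, ?_⟩
  · by_cases hxz : x z = 0
    · have h1 : (∑ p, P p) z ≠ 0 := by
        intro h0
        refine hz ?_
        rw [Pi.add_apply, Pi.smul_apply, hxz, h0]; simp
      rw [Finset.sum_apply] at h1
      obtain ⟨p, -, hp⟩ := Finset.exists_ne_zero_of_sum_ne_zero h1
      have a1 := lt_of_ne_zero_of_mem_nodeSpace (hP p) hp j
      have a2 : |meshNode i p j - elementCenter i c j| < r + 4 * meshSize i := by
        by_contra hn
        rw [hfar p j (not_lt.1 hn)] at hp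
        exact hp rfl
      have a3 : (z : Pt d) j - elementCenter i c j = ((z : Pt d) j - meshNode i p j) +
        (meshNode i p j - elementCenter i c j) := by ring
      rw [a3]
      exact (abs_add_le _ _).trans_lt (by linarith)
    · linarith [hxs z hxz j]
  · rw [← sub_sub]
    exact hB.schwarz_step (S := net.nodeSpace Γ i) (by linarith) (by positivity)
      (fun p => h.split_mem (fineSpaceOn_le_V he) p) (sum_split he.2.1)
      (h.sum_bilin_split_le hK (fineSpaceOn_le_V he) he.2.1) hP hPe (h.bilin_sum_le hP)

theorem localize_iterate (h : net.IsAdmissible Γ R₀ σ ρ μ i) (hK : K.IsBoundedCoercive Γ α β)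
    {c : Fin d → Fin (2 ^ i)} {v q : net.Fn} (hq : q ∈ fineSpace net Γ i)
    (hqv : ∀ y ∈ fineSpace net Γ i, K.bilin q y = K.bilinOn (element i c) v y) (m : ℕ) :
    ∃ x ∈ fineSpace net Γ i,
      (∀ z : net.nodes, x z ≠ 0 → ∀ j,
        |(z : Pt d) j - elementCenter i c j| < (1 + 7 * m) * meshSize i) ∧
      K.bilin (q - x) (q - x) ≤ contraction d σ μ α β ^ m * K.bilin q q := by
  have hH := meshSize_pos i
  induction m with
  | zero => exact ⟨0, Submodule.zero_mem _, fun z hz => absurd rfl hz, by simp⟩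
  | succ m ih =>
    obtain ⟨x, hx, hxs, hxe⟩ := ih
    obtain ⟨x', hx', hxs', hxe'⟩ := h.localize_step hK hq hqv
      (r := (1 + 7 * m) * meshSize i) (by nlinarith [Nat.cast_nonneg (α := ℝ) m]) hx hxs
    refine ⟨x', hx', fun z hz j => (hxs' z hz j).trans_eq (by push_cast; ring), hxe'.trans ?_⟩
    rw [pow_succ', mul_assoc]
    exact mul_le_mul_of_nonneg_left hxe (contraction_pos d σ μ α β).le

/-- Exponential decay of the localization error of an element corrector. -/
theorem bilin_localization_error_le (h : net.IsAdmissible Γ R₀ σ ρ μ i)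
    (hK : K.IsBoundedCoercive Γ α β) {k : ℕ} (hk : 1 ≤ k) {c : Fin d → Fin (2 ^ i)} {v q r : net.Fn}
    (hq : q ∈ fineSpace net Γ i)
    (hqv : ∀ y ∈ fineSpace net Γ i, K.bilin q y = K.bilinOn (element i c) v y)
    (hr : r ∈ net.fineSpaceOn Γ i (iterPatch i k (element i c)))
    (hrv : ∀ y ∈ net.fineSpaceOn Γ i (iterPatch i k (element i c)),
      K.bilin r y = K.bilinOn (element i c) v y) :
    K.bilin (q - r) (q - r) ≤ contraction d σ μ α β ^ ((k - 1) / 7) * K.bilin v v := by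
  have hH := meshSize_pos i
  have hB := K.isPsdForm_bilin
  -- The exponent is the largest `m` with `1 + 7 * m ≤ k`, so the iterate still fits into the
  -- `k`-layer patch.
  obtain ⟨x, hx, hxs, hxe⟩ := h.localize_iterate hK hq hqv ((k - 1) / 7)
  have hxk : x ∈ net.fineSpaceOn Γ i (iterPatch i k (element i c)) := by
    refine ⟨hx.1, hx.2.1, fun z hz => ?_⟩
    by_contra hne
    refine hz (mem_iterPatch_of_near k (net.nodes_mem z z.2) fun j => (hxs z hne j).trans ?_)
    have h1 : 1 + 7 * ((k - 1) / 7) ≤ k := by omega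
    have h2 : (1 : ℝ) + 7 * ((k - 1) / 7 : ℕ) ≤ k := by exact_mod_cast h1
    nlinarith
  have hqq : K.bilin q q ≤ K.bilin v v := by
    have h1 := (K.isPsdForm_bilinOn (element i c)).two_mul_apply_le v q
    rw [← hqv q hq] at h1
    linarith [K.bilinOn_self_le (element i c) v, K.bilinOn_self_le (element i c) q]
  refine (hB.galerkin_best hr (fun w hw => ?_) hxk).trans (hxe.trans ?_)
  · rw [hrv w hw, hqv w (fineSpaceOn_mono (Set.subset_univ _) hw)]
  · exact mul_le_mul_of_nonneg_left hqq (pow_nonneg (contraction_pos d σ μ α β).le _)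

theorem corrector_mem_V (h : net.IsAdmissible Γ R₀ σ ρ μ i) (hK : K.IsBoundedCoercive Γ α β)
    (k : ℕ) (v : net.Fn) : K.corrector Γ i k v ∈ net.V Γ :=
  Submodule.sum_mem _ fun c _ => fineSpaceOn_le_V (K.galerkin_spec
    (S := net.fineSpaceOn Γ i (iterPatch i k (element i c)))
    (fun _ hy => h.definite hK (fineSpaceOn_le_V hy)) (K.bilinOn (element i c) v)).1

theorem msSpace_le_V (h : net.IsAdmissible Γ R₀ σ ρ μ i) (hK : K.IsBoundedCoercive Γ α β) (k : ℕ) :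
    K.msSpace Γ i k ≤ net.V Γ := by
  refine Submodule.span_le.2 ?_
  rintro _ ⟨v, hv, rfl⟩
  exact Submodule.sub_mem _ (h.VH_le_V hv) (h.corrector_mem_V hK k v)

theorem ritz_spec (h : net.IsAdmissible Γ R₀ σ ρ μ i) (hK : K.IsBoundedCoercive Γ α β) (k : ℕ)
    (v : net.Fn) : K.ritz Γ i k v ∈ K.msSpace Γ i k ∧
      ∀ w ∈ K.msSpace Γ i k, K.bilin (K.ritz Γ i k v) w = K.bilin v w :=
  K.galerkin_spec (fun _ hy => h.definite hK (h.msSpace_le_V hK k hy)) (K.bilin v)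

/-- `ritz` is defined by choice; this uniqueness statement is the source of its linearity. -/
theorem ritz_eq (h : net.IsAdmissible Γ R₀ σ ρ μ i) (hK : K.IsBoundedCoercive Γ α β) {k : ℕ}
    {v r : net.Fn} (hr : r ∈ K.msSpace Γ i k)
    (hrv : ∀ w ∈ K.msSpace Γ i k, K.bilin r w = K.bilin v w) : K.ritz Γ i k v = r :=
  IsPsdForm.riesz_unique (fun _ hy => h.definite hK (h.msSpace_le_V hK k hy))
    (h.ritz_spec hK k v).1 hr (h.ritz_spec hK k v).2 hrv

theorem ritz_add (h : net.IsAdmissible Γ R₀ σ ρ μ i) (hK : K.IsBoundedCoercive Γ α β) (k : ℕ)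
    (u v : net.Fn) : K.ritz Γ i k (u + v) = K.ritz Γ i k u + K.ritz Γ i k v := by
  refine h.ritz_eq hK (Submodule.add_mem _ (h.ritz_spec hK k u).1 (h.ritz_spec hK k v).1)
    fun w hw => ?_
  rw [map_add, map_add, LinearMap.add_apply, LinearMap.add_apply, (h.ritz_spec hK k u).2 w hw,
    (h.ritz_spec hK k v).2 w hw]

theorem ritz_smul (h : net.IsAdmissible Γ R₀ σ ρ μ i) (hK : K.IsBoundedCoercive Γ α β) (k : ℕ)
    (r : ℝ) (v : net.Fn) : K.ritz Γ i k (r • v) = r • K.ritz Γ i k v := by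
  refine h.ritz_eq hK (Submodule.smul_mem _ r (h.ritz_spec hK k v).1) fun w hw => ?_
  rw [map_smul, map_smul, LinearMap.smul_apply, LinearMap.smul_apply, (h.ritz_spec hK k v).2 w hw]

theorem ritz_best (h : net.IsAdmissible Γ R₀ σ ρ μ i) (hK : K.IsBoundedCoercive Γ α β) {k : ℕ}
    (w : net.Fn) {z : net.Fn} (hz : z ∈ K.msSpace Γ i k) :
    formNorm K.bilin (w - K.ritz Γ i k w) ≤ formNorm K.bilin (w - z) :=
  Real.sqrt_le_sqrt (K.isPsdForm_bilin.galerkin_best (h.ritz_spec hK k w).1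
    (h.ritz_spec hK k w).2 hz)

end IsAdmissible

end SpatialNetwork

/-- The factor in the logarithmic condition on the number of layers. -/
def layerFactor (d : ℕ) (σ μ α β : ℝ) : ℝ := 14 * (d + 2) / -Real.log (contraction d σ μ α β)

/-- The constant in the error estimate of the Ritz projection. -/
def ritzConst (d : ℕ) (σ μ α β : ℝ) : ℝ :=
  √(fineConst d σ μ / α) +
    Real.exp (-Real.log (contraction d σ μ α β) / 2) * (√(β * interpConst d σ) * (μ ^ 2 / α))

theorem neg_log_contraction_pos (d : ℕ) (σ μ α β : ℝ) :
    0 < -Real.log (contraction d σ μ α β) :=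
  neg_pos.2 (Real.log_neg (contraction_pos d σ μ α β) (contraction_lt_one d σ μ α β))

theorem layerFactor_pos (d : ℕ) (σ μ α β : ℝ) : 0 < layerFactor d σ μ α β :=
  div_pos (by positivity) (neg_log_contraction_pos d σ μ α β)

/-- Since `k ≤ 7 * m + 7`, the square root of `γ ^ m` is at most `exp (-log γ / 2) * γ ^ (k / 14)`,
and the layer condition makes the last factor at most `H ^ (d + 2)`. Of these powers, `d` pay for
the number of elements and one for the inverse estimate. -/
theorem sqrt_contraction_pow_le {d : ℕ} {σ μ α β : ℝ} {i k : ℕ} (hk : 1 ≤ k)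
    (hlog : layerFactor d σ μ α β * Real.log (1 / meshSize i) ≤ k) :
    √(contraction d σ μ α β ^ ((k - 1) / 7)) ≤
      Real.exp (-Real.log (contraction d σ μ α β) / 2) * meshSize i ^ (d + 2) := by
  have hH := meshSize_pos i
  set γ := contraction d σ μ α β with hγ
  have hγ0 : 0 < γ := contraction_pos d σ μ α β
  have hL : 0 < -Real.log γ := neg_log_contraction_pos d σ μ α β
  set L := -Real.log γ with hLdef
  set m := (k - 1) / 7 with hm
  have h1 : γ ^ m = Real.exp (-(m * L)) := by
    rw [hLdef, mul_neg, neg_neg, ← Real.log_pow, Real.exp_log (pow_pos hγ0 m)]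
  have h2 : √(γ ^ m) = Real.exp (-(m * L) / 2) := by
    rw [h1, Real.exp_half]
  have h3 : meshSize i ^ (d + 2) = Real.exp (-((d + 2) * Real.log (1 / meshSize i))) := by
    rw [one_div, Real.log_inv, mul_neg, neg_neg]
    have : ((d : ℝ) + 2) = ((d + 2 : ℕ) : ℝ) := by push_cast; ring
    rw [this, ← Real.log_pow, Real.exp_log (pow_pos hH _)]
  rw [h2, h3, ← Real.exp_add, Real.exp_le_exp]
  have h4 : (k : ℝ) ≤ 7 * m + 7 := by
    have : k ≤ 7 * m + 7 := by omega
    exact_mod_cast this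
  have h5 : 14 * (d + 2) * Real.log (1 / meshSize i) ≤ k * L := by
    rw [layerFactor, div_mul_eq_mul_div, div_le_iff₀ hL] at hlog
    exact hlog
  nlinarith

/-! ### First-order convergence of the localized Ritz projection -/

namespace SpatialNetwork.IsAdmissible

variable {d : ℕ} {net : SpatialNetwork d} {Γ : Set (Pt d)} {R₀ σ ρ μ α β : ℝ} {i : ℕ}
  {K : net.LocalOperator}

/-- The Friedrichs inequality in terms of `K`. -/
theorem mNorm_le_kNorm (h : net.IsAdmissible Γ R₀ σ ρ μ i) (hK : K.IsBoundedCoercive Γ α β)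
    {v : net.Fn} (hv : v ∈ net.V Γ) : net.mNorm v ≤ μ / √α * K.kNorm v := by
  refine (h.poincare.global v hv).trans ?_
  rw [div_mul_eq_mul_div, mul_div_assoc]
  refine mul_le_mul_of_nonneg_left ?_ h.poincare.nonneg
  rw [LocalOperator.kNorm, ← Real.sqrt_div' _ hK.1.le]
  exact Real.sqrt_le_sqrt (lap_le hK hv)

theorem mNorm_le_of_mem_fineSpace (h : net.IsAdmissible Γ R₀ σ ρ μ i)
    (hK : K.IsBoundedCoercive Γ α β) {w : net.Fn} (hw : w ∈ fineSpace net Γ i) :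
    net.mNorm w ≤ √(fineConst d σ μ / α) * meshSize i * K.kNorm w := by
  have hF := h.fineConst_nonneg
  have hα := hK.1
  have hH := meshSize_pos i
  have h1 : net.mass w w ≤ fineConst d σ μ * meshSize i ^ 2 * net.lap w :=
    h.mass_le_of_interp_eq_zero hw.1 hw.2.1
  have h2 : net.mass w w ≤ fineConst d σ μ / α * meshSize i ^ 2 * K.bilin w w := by
    refine h1.trans ?_
    calc _ ≤ fineConst d σ μ * meshSize i ^ 2 * (K.bilin w w / α) := by
          gcongr
          exact lap_le hK hw.1
      _ = _ := by ring
  calc net.mNorm w ≤ √(fineConst d σ μ / α * meshSize i ^ 2 * K.bilin w w) := Real.sqrt_le_sqrt h2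
    _ = _ := by
      rw [Real.sqrt_mul (by positivity), Real.sqrt_mul (by positivity), Real.sqrt_sq hH.le]
      rfl

/-- Write `K(w,w)` as `(M M⁻¹K w, w)` and apply Cauchy-Schwarz and Friedrichs; one factor of the
energy norm cancels. -/
theorem kNorm_le_mNorm_invMassK (h : net.IsAdmissible Γ R₀ σ ρ μ i)
    (hK : K.IsBoundedCoercive Γ α β) {w : net.Fn} (hw : w ∈ net.V Γ) :
    K.kNorm w ≤ μ / √α * net.mNorm (K.invMassK Γ w) := by
  have := h.nontrivial
  have h1 : K.kNorm w ^ 2 ≤ net.mNorm (K.invMassK Γ w) * (μ / √α * K.kNorm w) := by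
    rw [K.kNorm_eq_formNorm, K.isPsdForm_bilin.sq_formNorm, K.bilin_apply, ← K.mass_invMassK w hw]
    refine ((net.isPsdForm_massForm Set.univ).apply_le _ _).trans ?_
    exact mul_le_mul_of_nonneg_left (h.mNorm_le_kNorm hK hw) (Real.sqrt_nonneg _)
  have h0 : 0 ≤ K.kNorm w := Real.sqrt_nonneg _
  rcases h0.eq_or_lt with h2 | h2
  · rw [← h2]
    exact mul_nonneg (div_nonneg h.poincare.nonneg (Real.sqrt_nonneg _)) (Real.sqrt_nonneg _)
  · refine le_of_mul_le_mul_right ?_ h2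
    linarith

/-- The lost power of `H` could be avoided by a sharper stability estimate, but the exponential
decay of the localization error absorbs it. -/
theorem kNorm_interp_le (h : net.IsAdmissible Γ R₀ σ ρ μ i) (hK : K.IsBoundedCoercive Γ α β)
    {w : net.Fn} (hw : w ∈ net.V Γ) :
    K.kNorm (net.interp Γ i w) ≤
      √(β * interpConst d σ) * (μ ^ 2 / α) / meshSize i * net.mNorm (K.invMassK Γ w) := by
  have hα := hK.1
  have hβ : 0 < β := hα.trans_le hK.2.1
  have hH := meshSize_pos i
  have hJ := h.interpConst_nonneg
  have hμ := h.poincare.nonneg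
  have h1 : K.bilin (net.interp Γ i w) (net.interp Γ i w) ≤
      β * interpConst d σ / meshSize i ^ 2 * net.mass w w := by
    refine (hK.2.2 _ (h.interp_mem_V w)).2.trans ?_
    have h2 : net.lap (net.interp Γ i w) ≤ interpConst d σ / meshSize i ^ 2 * net.mass w w :=
      h.lap_interp_le w
    calc _ ≤ β * (interpConst d σ / meshSize i ^ 2 * net.mass w w) := by gcongr
      _ = _ := by ring
  have h3 : K.kNorm (net.interp Γ i w) ≤ √(β * interpConst d σ) / meshSize i * net.mNorm w := by
    refine (Real.sqrt_le_sqrt h1).trans_eq ?_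
    rw [Real.sqrt_mul (by positivity), Real.sqrt_div (by positivity), Real.sqrt_sq hH.le]
    rfl
  have h4 : net.mNorm w ≤ μ / √α * (μ / √α * net.mNorm (K.invMassK Γ w)) :=
    (h.mNorm_le_kNorm hK hw).trans
      (mul_le_mul_of_nonneg_left (h.kNorm_le_mNorm_invMassK hK hw) (by positivity))
  have h5 : μ / √α * (μ / √α * net.mNorm (K.invMassK Γ w)) =
      μ ^ 2 / α * net.mNorm (K.invMassK Γ w) := by
    rw [← mul_assoc, div_mul_div_comm, Real.mul_self_sqrt hα.le, sq]
  calc _ ≤ _ := h3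
    _ ≤ √(β * interpConst d σ) / meshSize i * (μ ^ 2 / α * net.mNorm (K.invMassK Γ w)) := by
      gcongr
      exact h4.trans_eq h5
    _ = _ := by ring

/-- Localization error of the corrector. -/
theorem kNorm_corrector_error_le (h : net.IsAdmissible Γ R₀ σ ρ μ i)
    (hK : K.IsBoundedCoercive Γ α β) {k : ℕ} (hk : 1 ≤ k) (v : net.Fn) :
    ∃ q ∈ fineSpace net Γ i, (∀ y ∈ fineSpace net Γ i, K.bilin q y = K.bilin v y) ∧
      K.kNorm (q - K.corrector Γ i k v) ≤
        (2 ^ i) ^ d * √(contraction d σ μ α β ^ ((k - 1) / 7)) * K.kNorm v := by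
  have hdef : ∀ ω : Set (Pt d), ∀ y ∈ net.fineSpaceOn Γ i ω, K.bilin y y = 0 → y = 0 :=
    fun ω y hy => h.definite hK (fineSpaceOn_le_V hy)
  choose q hq hqv using fun c : Fin d → Fin (2 ^ i) => IsPsdForm.exists_riesz (B := K.bilin)
    (hdef Set.univ) (K.bilinOn (element i c) v)
  refine ⟨∑ c, q c, Submodule.sum_mem _ fun c _ => hq c, fun y hy => ?_, ?_⟩
  · rw [map_sum, LinearMap.sum_apply, ← K.sum_bilinOn_element i]
    exact Finset.sum_congr rfl fun c _ => hqv c y hy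
  · unfold LocalOperator.corrector
    rw [← Finset.sum_sub_distrib, K.kNorm_eq_formNorm]
    -- A plain triangle inequality over all `(2 ^ i) ^ d` elements, without using the overlap of the
    -- patches.
    refine (K.isPsdForm_bilin.formNorm_sum_le _ _).trans ?_
    have h1 : ∀ c, formNorm K.bilin (q c - K.galerkin
        (net.fineSpaceOn Γ i (iterPatch i k (element i c))) (K.formOn (element i c) v)) ≤
        √(contraction d σ μ α β ^ ((k - 1) / 7)) * K.kNorm v := by
      intro c
      have hs := K.galerkin_spec (S := net.fineSpaceOn Γ i (iterPatch i k (element i c)))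
        (hdef _) (K.bilinOn (element i c) v)
      refine (Real.sqrt_le_sqrt (h.bilin_localization_error_le hK hk (hq c) (hqv c)
        hs.1 hs.2)).trans_eq ?_
      rw [Real.sqrt_mul (pow_nonneg (contraction_pos d σ μ α β).le _)]
      rfl
    refine (Finset.sum_le_sum fun c _ => h1 c).trans_eq ?_
    simp [mul_assoc]

/-- Error estimate for the localized Ritz projection. -/
theorem kNorm_sub_ritz_le (h : net.IsAdmissible Γ R₀ σ ρ μ i) (hK : K.IsBoundedCoercive Γ α β)
    {k : ℕ} (hk : 1 ≤ k) (hlog : layerFactor d σ μ α β * Real.log (1 / meshSize i) ≤ k)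
    {w : net.Fn} (hw : w ∈ net.V Γ) :
    K.kNorm (w - K.ritz Γ i k w) ≤
      ritzConst d σ μ α β * meshSize i * net.mNorm (K.invMassK Γ w) := by
  have := h.nontrivial
  have hH := meshSize_pos i
  have hB := K.isPsdForm_bilin
  have hα := hK.1
  set v := net.interp Γ i w with hv
  set F := net.mNorm (K.invMassK Γ w) with hF
  have hF0 : 0 ≤ F := Real.sqrt_nonneg _
  obtain ⟨q, hq, hqv, hqe⟩ := h.kNorm_corrector_error_le hK hk v
  have hz : v - K.corrector Γ i k v ∈ K.msSpace Γ i k :=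
    Submodule.subset_span ⟨v, interp_mem_VH w, rfl⟩
  -- The error of the method with unlocalized correctors; it lies in the fine-scale space because
  -- `w` and `v` have the same interpolant.
  set e := w - v + q with he
  have heW : e ∈ fineSpace net Γ i := by
    refine Submodule.add_mem _ ⟨Submodule.sub_mem _ hw (h.interp_mem_V w), ?_, fun x hx =>
      absurd (Set.mem_univ _) hx⟩ hq
    rw [← interpLin_apply, map_sub, interpLin_apply, interpLin_apply, hv, h.interp_interp, sub_self]
  have h1 : K.kNorm e ≤ √(fineConst d σ μ / α) * meshSize i * F := by
    have h2 : K.kNorm e ^ 2 ≤ F * (√(fineConst d σ μ / α) * meshSize i * K.kNorm e) := by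
      -- On the fine-scale space `q` cancels `v`, so only `K w` remains when testing with `e`.
      have h3 : K.bilin e e = net.mass (K.invMassK Γ w) e := by
        rw [K.mass_invMassK w heW.1, ← K.bilin_apply]
        have : K.bilin e e = K.bilin w e - K.bilin v e + K.bilin q e := by
          conv_lhs => rw [he, map_add K.bilin, LinearMap.add_apply, map_sub K.bilin,
            LinearMap.sub_apply, ← he]
        rw [this, hqv e heW]; ring
      rw [K.kNorm_eq_formNorm, hB.sq_formNorm, h3]
      refine ((net.isPsdForm_massForm Set.univ).apply_le _ _).trans ?_
      exact mul_le_mul_of_nonneg_left (h.mNorm_le_of_mem_fineSpace hK heW) hF0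
    have h0 : 0 ≤ K.kNorm e := Real.sqrt_nonneg _
    rcases h0.eq_or_lt with h4 | h4
    · rw [← h4]; positivity
    · refine le_of_mul_le_mul_right ?_ h4
      linarith
  have h2 : K.kNorm (q - K.corrector Γ i k v) ≤
      Real.exp (-Real.log (contraction d σ μ α β) / 2) *
        (√(β * interpConst d σ) * (μ ^ 2 / α)) * meshSize i * F := by
    have h3 := sqrt_contraction_pow_le hk hlog
    have h4 := h.kNorm_interp_le hK hw
    have h5 : 0 ≤ K.kNorm v := Real.sqrt_nonneg _
    calc _ ≤ _ := hqe
      _ ≤ (2 ^ i) ^ d * (Real.exp (-Real.log (contraction d σ μ α β) / 2) * meshSize i ^ (d + 2)) *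
          (√(β * interpConst d σ) * (μ ^ 2 / α) / meshSize i * F) := by gcongr
      _ = (2 ^ i * meshSize i) ^ d * (Real.exp (-Real.log (contraction d σ μ α β) / 2) *
          (√(β * interpConst d σ) * (μ ^ 2 / α)) * (meshSize i ^ 2 / meshSize i) * F) := by
          rw [mul_pow]; ring
      _ = _ := by
          rw [two_pow_mul_meshSize, one_pow, one_mul, sq (meshSize i), mul_div_assoc (meshSize i),
            div_self hH.ne', mul_one]
  have e1 : w - (v - K.corrector Γ i k v) = e - (q - K.corrector Γ i k v) := by
    rw [he]; abel
  calc K.kNorm (w - K.ritz Γ i k w) ≤ formNorm K.bilin (w - (v - K.corrector Γ i k v)) :=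
        h.ritz_best hK w hz
    _ ≤ K.kNorm e + K.kNorm (q - K.corrector Γ i k v) := by
        rw [e1]; exact hB.formNorm_sub_le _ _
    _ ≤ _ := add_le_add h1 h2
    _ = _ := by rw [ritzConst]; ring

end SpatialNetwork.IsAdmissible

/-! ### Calculus for vector-valued functions and bilinear forms -/

open Set in
/-- A one-sided bound on the derivative bounds the increment. -/
theorem le_add_integral_of_deriv_le {T : ℝ} (hT : 0 < T) {φ φ' N : ℝ → ℝ}
    (hφ : ∀ t ∈ Icc 0 T, HasDerivWithinAt φ (φ' t) (Icc 0 T) t)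
    (hN : ContinuousOn N (Icc 0 T)) (hN0 : ∀ t ∈ Icc 0 T, 0 ≤ N t)
    (hle : ∀ t ∈ Icc 0 T, φ' t ≤ N t) {s t : ℝ} (hs : s ∈ Icc 0 T) (ht : t ∈ Icc 0 T)
    (hst : s ≤ t) : φ t ≤ φ s + ∫ r in (0 : ℝ)..T, N r := by
  -- The constant extension makes the primitive differentiable at the end points too.
  set N' : ℝ → ℝ := IccExtend hT.le ((Icc 0 T).domRestrict N) with hN'
  have hc : Continuous N' := (continuousOn_iff_continuous_domRestrict.1 hN).Icc_extend'
  have heq : ∀ r ∈ Icc 0 T, N' r = N r := fun r hr => by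
    rw [hN', IccExtend_of_mem _ _ hr]; rfl
  have hnn : ∀ r, 0 ≤ N' r := fun r => hN0 _ (projIcc 0 T hT.le r).2
  have hsub : Icc s t ⊆ Icc 0 T := Icc_subset_Icc hs.1 ht.2
  have h1 : φ t ≤ φ s + ∫ r in s..t, N' r := by
    refine image_le_of_deriv_right_le_deriv_boundary (f := φ) (f' := φ') (a := s) (b := t)
      (B := fun x => φ s + ∫ r in s..x, N' r) (B' := N')
      (fun x hx => (hφ x (hsub hx)).continuousWithinAt.mono hsub) (fun x hx => ?_) (by simp)
      ?_ (fun x hx => ?_) (fun x hx => ?_) (right_mem_Icc.2 hst)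
    · have hx' := hsub (Ico_subset_Icc_self hx)
      have hxT : x < T := hx.2.trans_le ht.2
      refine (hφ x hx').mono_of_mem_nhdsWithin ?_
      exact mem_nhdsWithin_of_mem_nhds (Iio_mem_nhds hxT) |> fun h2 => by
        filter_upwards [h2, self_mem_nhdsWithin] with y hy1 hy2
        exact ⟨hx'.1.trans hy2, le_of_lt hy1⟩
    · exact (continuous_const.add
        (intervalIntegral.continuous_primitive (fun a b => hc.intervalIntegrable a b) s)).continuousOn
    · exact ((hc.integral_hasStrictDerivAt s x).hasDerivAt.const_add (φ s)).hasDerivWithinAt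
    · have hx' := hsub (Ico_subset_Icc_self hx)
      rw [heq x hx']
      exact hle x hx'
  have h2 : ∫ r in s..t, N' r ≤ ∫ r in (0 : ℝ)..T, N' r :=
    intervalIntegral.integral_mono_interval hs.1 hst ht.2 (Filter.Eventually.of_forall hnn)
      (hc.intervalIntegrable _ _)
  have h3 : ∫ r in (0 : ℝ)..T, N' r = ∫ r in (0 : ℝ)..T, N r :=
    intervalIntegral.integral_congr fun r hr => heq r (by rwa [uIcc_of_le hT.le] at hr)
  linarith

open Set in
/-- Taylor's estimate for a chain of derivatives on an interval, with a crude constant. -/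
theorem abs_taylor_le {a b D : ℝ} (m : ℕ) {φ : ℕ → ℝ → ℝ}
    (hφ : ∀ j < m, ∀ t ∈ Icc a b, HasDerivWithinAt (φ j) (φ (j + 1) t) (Icc a b) t)
    (hD : ∀ t ∈ Icc a b, |φ m t| ≤ D) {x₀ x : ℝ} (hx₀ : x₀ ∈ Icc a b) (hx : x ∈ Icc a b) :
    |φ 0 x - ∑ j ∈ Finset.range m, φ j x₀ * (x - x₀) ^ j / (j.factorial : ℝ)| ≤
      D * |x - x₀| ^ m := by
  induction m generalizing φ x with
  | zero => simpa using hD x hx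
  | succ m ih =>
    have hD0 : 0 ≤ D := (abs_nonneg _).trans (hD x hx)
    -- The derivative of the remainder is the remainder of one order less for the shifted chain, and
    -- `R` vanishes at `x₀`; the mean value inequality gives the extra power.
    set R : ℝ → ℝ := fun y => φ 0 y -
      ∑ j ∈ Finset.range (m + 1), φ j x₀ * (y - x₀) ^ j / (j.factorial : ℝ) with hR
    set R' : ℝ → ℝ := fun y => φ 1 y -
      ∑ j ∈ Finset.range m, φ (j + 1) x₀ * (y - x₀) ^ j / (j.factorial : ℝ) with hR'
    have hseg : uIcc x₀ x ⊆ Icc a b := uIcc_subset_Icc hx₀ hx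
    have hder : ∀ y ∈ uIcc x₀ x, HasDerivWithinAt R (R' y) (uIcc x₀ x) y := by
      intro y hy
      refine ((hφ 0 (Nat.succ_pos m) y (hseg hy)).mono hseg).sub ?_
      have h1 : ∀ j, HasDerivAt (fun y => φ (j + 1) x₀ * (y - x₀) ^ (j + 1) / ((j + 1).factorial : ℝ))
          (φ (j + 1) x₀ * (y - x₀) ^ j / (j.factorial : ℝ)) y := by
        intro j
        have h2 := ((((hasDerivAt_id y).sub_const x₀).pow (j + 1)).const_mul
          (φ (j + 1) x₀)).div_const ((j + 1).factorial : ℝ)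
        refine h2.congr_deriv ?_
        have h3 : ((j.factorial : ℕ) : ℝ) ≠ 0 := by exact_mod_cast j.factorial_ne_zero
        have h4 : ((j : ℝ) + 1) ≠ 0 := by positivity
        rw [Nat.factorial_succ]
        push_cast
        simp only [id, mul_one]
        field_simp
      have h5 := HasDerivAt.fun_sum (u := Finset.range m) fun j _ => h1 j
      have h6 : HasDerivAt (fun y => ∑ j ∈ Finset.range (m + 1),
          φ j x₀ * (y - x₀) ^ j / (j.factorial : ℝ))
          (∑ j ∈ Finset.range m, φ (j + 1) x₀ * (y - x₀) ^ j / (j.factorial : ℝ)) y := by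
        simp only [Finset.sum_range_succ' _ m, pow_zero]
        exact h5.add_const _
      exact h6.hasDerivWithinAt
    have hbd : ∀ y ∈ uIcc x₀ x, ‖R' y‖ ≤ D * |x - x₀| ^ m := by
      intro y hy
      have h1 := ih (φ := fun j => φ (j + 1)) (fun j hj => hφ (j + 1) (by omega)) hD (hseg hy)
      refine h1.trans ?_
      have h2 : |y - x₀| ≤ |x - x₀| := abs_sub_left_of_mem_uIcc hy
      gcongr
    have h0 : R x₀ = 0 := by
      rw [hR]
      simp [Finset.sum_range_succ']
    have := Convex.norm_image_sub_le_of_norm_hasDerivWithin_le hder hbd (convex_uIcc x₀ x)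
      left_mem_uIcc right_mem_uIcc
    rw [h0, sub_zero, Real.norm_eq_abs, Real.norm_eq_abs, mul_assoc, ← pow_succ] at this
    exact this

/-! ### Difference quotients and energy estimates in seminorms -/

section Chain

open Set

variable {E : Type*} [NormedAddCommGroup E] [NormedSpace ℝ E] [FiniteDimensional ℝ E]
  {B : E →ₗ[ℝ] E →ₗ[ℝ] ℝ}

theorem hasDerivWithinAt_apply_left {u : ℝ → E} {u' : E} {s : Set ℝ} {t : ℝ}
    (h : HasDerivWithinAt u u' s t) (y : E) :
    HasDerivWithinAt (fun r => B (u r) y) (B u' y) s t := by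
  have := (B.flip y).toContinuousLinearMap.hasFDerivAt.comp_hasDerivWithinAt t h
  exact this

theorem hasDerivWithinAt_apply_apply {u v : ℝ → E} {u' v' : E} {s : Set ℝ} {t : ℝ}
    (hu : HasDerivWithinAt u u' s t) (hv : HasDerivWithinAt v v' s t) :
    HasDerivWithinAt (fun r => B (u r) (v r)) (B u' (v t) + B (u t) v') s t := by
  have h1 := (B.toContinuousBilinearMap.hasFDerivAt.comp_hasDerivWithinAt t hu).clm_apply hv
  exact h1

theorem continuous_formNorm : Continuous (formNorm B) := by
  have h : Continuous fun x => B.toContinuousBilinearMap x x := by fun_prop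
  exact Real.continuous_sqrt.comp h

namespace IsPsdForm

variable {a b D τ t : ℝ} {u : ℕ → ℝ → E}

theorem taylor_apply (hB : IsPsdForm B) (m : ℕ)
    (hu : ∀ j < m, ∀ t ∈ Icc a b, HasDerivWithinAt (u j) (u (j + 1) t) (Icc a b) t)
    (hD : ∀ t ∈ Icc a b, formNorm B (u m t) ≤ D) {x₀ x : ℝ} (hx₀ : x₀ ∈ Icc a b)
    (hx : x ∈ Icc a b) (y : E) :
    |B (u 0 x) y - ∑ j ∈ Finset.range m, B (u j x₀) y * (x - x₀) ^ j / (j.factorial : ℝ)| ≤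
      D * formNorm B y * |x - x₀| ^ m :=
  abs_taylor_le m (φ := fun j r => B (u j r) y)
    (fun j hj r hr => hasDerivWithinAt_apply_left (hu j hj r hr) y)
    (fun r hr => (hB.abs_apply_le _ _).trans
      (mul_le_mul_of_nonneg_right (hD r hr) (formNorm_nonneg y))) hx₀ hx

/-- Mean value bound for a difference. -/
theorem formNorm_diff_le (hB : IsPsdForm B) (hτ : 0 ≤ τ)
    (hu : ∀ j < 1, ∀ t ∈ Icc a b, HasDerivWithinAt (u j) (u (j + 1) t) (Icc a b) t)
    (hD : ∀ t ∈ Icc a b, formNorm B (u 1 t) ≤ D) (h0 : t ∈ Icc a b) (h1 : t + τ ∈ Icc a b) :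
    formNorm B (u 0 (t + τ) - u 0 t) ≤ τ * D := by
  have hD0 : 0 ≤ D := (formNorm_nonneg _).trans (hD t h0)
  refine hB.formNorm_le_of_abs_le hτ (fun y => ?_) hD0
  have := hB.taylor_apply 1 hu hD h0 h1 y
  simp only [Finset.sum_range_one, pow_zero, mul_one, Nat.factorial_zero, Nat.cast_one, div_one,
    add_sub_cancel_left, pow_one, abs_of_nonneg hτ] at this
  rw [map_sub, LinearMap.sub_apply]
  linarith

/-- The midpoint rule for the average of two values. -/
theorem formNorm_midpt_sub_le (hB : IsPsdForm B) (hτ : 0 ≤ τ)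
    (hu : ∀ j < 2, ∀ t ∈ Icc a b, HasDerivWithinAt (u j) (u (j + 1) t) (Icc a b) t)
    (hD : ∀ t ∈ Icc a b, formNorm B (u 2 t) ≤ D) (h0 : t ∈ Icc a b) (h1 : t + τ ∈ Icc a b) :
    formNorm B ((2 : ℝ)⁻¹ • (u 0 (t + τ) + u 0 t) - u 0 (t + τ / 2)) ≤ τ ^ 2 * D := by
  have hD0 : 0 ≤ D := (formNorm_nonneg _).trans (hD t h0)
  have hm : t + τ / 2 ∈ Icc a b := ⟨by linarith [h0.1], by linarith [h1.2]⟩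
  refine hB.formNorm_le_of_abs_le (sq_nonneg τ) (fun y => ?_) hD0
  -- Expanded about the midpoint, the first-order terms of the two end points cancel in the average.
  have e1 := hB.taylor_apply 2 hu hD hm h1 y
  have e2 := hB.taylor_apply 2 hu hD hm h0 y
  have s1 : t + τ - (t + τ / 2) = τ / 2 := by ring
  have s2 : t - (t + τ / 2) = -(τ / 2) := by ring
  rw [s1, abs_of_nonneg (show 0 ≤ τ / 2 by linarith)] at e1
  rw [s2, abs_neg, abs_of_nonneg (show 0 ≤ τ / 2 by linarith)] at e2
  simp only [Finset.sum_range_succ, Finset.sum_range_zero, zero_add, pow_zero, mul_one, pow_one,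
    Nat.factorial, Nat.cast_one, div_one] at e1 e2
  simp only [map_sub, map_add, map_smul, LinearMap.sub_apply, LinearMap.add_apply,
    LinearMap.smul_apply, smul_eq_mul]
  have hy := mul_nonneg hD0 (formNorm_nonneg (B := B) y)
  have hτ2 := sq_nonneg τ
  rw [abs_le] at *
  constructor <;> nlinarith

/-- The central difference quotient. -/
theorem formNorm_diff_sub_deriv_le (hB : IsPsdForm B) (hτ : 0 ≤ τ)
    (hu : ∀ j < 3, ∀ t ∈ Icc a b, HasDerivWithinAt (u j) (u (j + 1) t) (Icc a b) t)
    (hD : ∀ t ∈ Icc a b, formNorm B (u 3 t) ≤ D) (h0 : t ∈ Icc a b) (h1 : t + τ ∈ Icc a b) :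
    formNorm B (u 0 (t + τ) - u 0 t - τ • u 1 (t + τ / 2)) ≤ τ ^ 3 * D := by
  have hD0 : 0 ≤ D := (formNorm_nonneg _).trans (hD t h0)
  have hm : t + τ / 2 ∈ Icc a b := ⟨by linarith [h0.1], by linarith [h1.2]⟩
  refine hB.formNorm_le_of_abs_le (pow_nonneg hτ 3) (fun y => ?_) hD0
  -- Expanded about the midpoint, the even-order terms cancel in the difference; the two remainders
  -- total at most `2 * (τ / 2) ^ 3 * D`.
  have e1 := hB.taylor_apply 3 hu hD hm h1 y
  have e2 := hB.taylor_apply 3 hu hD hm h0 y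
  have s1 : t + τ - (t + τ / 2) = τ / 2 := by ring
  have s2 : t - (t + τ / 2) = -(τ / 2) := by ring
  rw [s1, abs_of_nonneg (show 0 ≤ τ / 2 by linarith)] at e1
  rw [s2, abs_neg, abs_of_nonneg (show 0 ≤ τ / 2 by linarith)] at e2
  simp only [Finset.sum_range_succ, Finset.sum_range_zero, zero_add, pow_zero, mul_one, pow_one,
    Nat.factorial, Nat.cast_one, div_one] at e1 e2
  simp only [map_sub, map_smul, LinearMap.sub_apply, LinearMap.smul_apply, smul_eq_mul]
  have hy := mul_nonneg (mul_nonneg hD0 (formNorm_nonneg (B := B) y)) (pow_nonneg hτ 3)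
  rw [abs_le] at *
  constructor <;> nlinarith

/-- The second difference. -/
theorem formNorm_second_diff_le (hB : IsPsdForm B) (hτ : 0 ≤ τ)
    (hu : ∀ j < 2, ∀ t ∈ Icc a b, HasDerivWithinAt (u j) (u (j + 1) t) (Icc a b) t)
    (hD : ∀ t ∈ Icc a b, formNorm B (u 2 t) ≤ D) (h0 : t ∈ Icc a b) (h1 : t + τ ∈ Icc a b)
    (h2 : t - τ ∈ Icc a b) :
    formNorm B (u 0 (t + τ) - (2 : ℝ) • u 0 t + u 0 (t - τ)) ≤ 2 * τ ^ 2 * D := by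
  have hD0 : 0 ≤ D := (formNorm_nonneg _).trans (hD t h0)
  refine hB.formNorm_le_of_abs_le (by positivity) (fun y => ?_) hD0
  have e1 := hB.taylor_apply 2 hu hD h0 h1 y
  have e2 := hB.taylor_apply 2 hu hD h0 h2 y
  have s1 : t + τ - t = τ := by ring
  have s2 : t - τ - t = -τ := by ring
  rw [s1, abs_of_nonneg hτ] at e1
  rw [s2, abs_neg, abs_of_nonneg hτ] at e2
  simp only [Finset.sum_range_succ, Finset.sum_range_zero, zero_add, pow_zero, mul_one, pow_one,
    Nat.factorial, Nat.cast_one, div_one] at e1 e2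
  simp only [map_sub, map_add, map_smul, LinearMap.sub_apply, LinearMap.add_apply,
    LinearMap.smul_apply, smul_eq_mul]
  rw [abs_le] at *
  constructor <;> nlinarith

/-- The second difference quotient. -/
theorem formNorm_second_diff_sub_deriv_le (hB : IsPsdForm B) (hτ : 0 ≤ τ)
    (hu : ∀ j < 4, ∀ t ∈ Icc a b, HasDerivWithinAt (u j) (u (j + 1) t) (Icc a b) t)
    (hD : ∀ t ∈ Icc a b, formNorm B (u 4 t) ≤ D) (h0 : t ∈ Icc a b) (h1 : t + τ ∈ Icc a b)
    (h2 : t - τ ∈ Icc a b) :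
    formNorm B (u 0 (t + τ) - (2 : ℝ) • u 0 t + u 0 (t - τ) - τ ^ 2 • u 2 t) ≤
      2 * τ ^ 4 * D := by
  have hD0 : 0 ≤ D := (formNorm_nonneg _).trans (hD t h0)
  refine hB.formNorm_le_of_abs_le (by positivity) (fun y => ?_) hD0
  -- The odd-order terms cancel in the symmetric difference, so only `τ ^ 2 • u 2 t` and two
  -- fourth-order remainders survive.
  have e1 := hB.taylor_apply 4 hu hD h0 h1 y
  have e2 := hB.taylor_apply 4 hu hD h0 h2 y
  have s1 : t + τ - t = τ := by ring
  have s2 : t - τ - t = -τ := by ring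
  rw [s1, abs_of_nonneg hτ] at e1
  rw [s2, abs_neg, abs_of_nonneg hτ] at e2
  simp only [Finset.sum_range_succ, Finset.sum_range_zero, zero_add, pow_zero, mul_one, pow_one,
    Nat.factorial, Nat.cast_one, div_one] at e1 e2
  simp only [map_sub, map_add, map_smul, LinearMap.sub_apply, LinearMap.add_apply,
    LinearMap.smul_apply, smul_eq_mul]
  push_cast at e1 e2
  rw [abs_le] at *
  constructor <;> nlinarith

/-- A pointwise bound by integrals of the function and its derivative. -/
theorem formNorm_le_integral (hB : IsPsdForm B) {T : ℝ} (hT : 0 < T) {g g' : ℝ → E}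
    (hg : ∀ t ∈ Icc 0 T, HasDerivWithinAt g (g' t) (Icc 0 T) t)
    (hg' : ContinuousOn g' (Icc 0 T)) {t : ℝ} (ht : t ∈ Icc 0 T) :
    formNorm B (g t) ≤ 1 / T * (∫ r in (0 : ℝ)..T, formNorm B (g r)) +
      ∫ r in (0 : ℝ)..T, formNorm B (g' r) := by
  have hgc : ContinuousOn g (Icc 0 T) := fun r hr => (hg r hr).continuousWithinAt
  have hNg : ContinuousOn (fun r => formNorm B (g r)) (Icc 0 T) :=
    continuous_formNorm.comp_continuousOn hgc
  have hNg' : ContinuousOn (fun r => formNorm B (g' r)) (Icc 0 T) :=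
    continuous_formNorm.comp_continuousOn hg'
  set D := ∫ r in (0 : ℝ)..T, formNorm B (g' r) with hD
  have hD0 : 0 ≤ D := intervalIntegral.integral_nonneg hT.le fun r _ => formNorm_nonneg _
  -- The oscillation of `g` is at most the integral `D`; averaging this lower bound over `s` gives
  -- the claim.
  have key : ∀ s ∈ Icc 0 T, formNorm B (g t) - D ≤ formNorm B (g s) := by
    intro s hs
    have h1 : formNorm B (g t - g s) ≤ D := by
      refine hB.formNorm_le_of_dual hD0 fun y => ?_
      have hN : ContinuousOn (fun r => formNorm B (g' r) * formNorm B y) (Icc 0 T) :=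
        hNg'.mul continuousOn_const
      have hN0 : ∀ r ∈ Icc 0 T, 0 ≤ formNorm B (g' r) * formNorm B y :=
        fun r _ => mul_nonneg (formNorm_nonneg _) (formNorm_nonneg _)
      have e : ∫ r in (0 : ℝ)..T, formNorm B (g' r) * formNorm B y = D * formNorm B y :=
        intervalIntegral.integral_mul_const _ _
      rw [map_sub, LinearMap.sub_apply, ← e]
      rcases le_total s t with hst | hst
      · have := le_add_integral_of_deriv_le hT (φ := fun r => B (g r) y)
          (fun r hr => hasDerivWithinAt_apply_left (hg r hr) y) hN hN0
          (fun r _ => hB.apply_le _ _) hs ht hst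
        linarith
      · have := le_add_integral_of_deriv_le hT (φ := fun r => - B (g r) y)
          (fun r hr => (hasDerivWithinAt_apply_left (hg r hr) y).neg) hN hN0
          (fun r _ => (neg_le_abs _).trans (hB.abs_apply_le _ _)) ht hs hst
        linarith
    have h2 := hB.formNorm_add_le (g t - g s) (g s)
    rw [sub_add_cancel] at h2
    linarith
  have h3 : ∫ _r in (0 : ℝ)..T, (formNorm B (g t) - D) ≤ ∫ r in (0 : ℝ)..T, formNorm B (g r) :=
    intervalIntegral.integral_mono_on hT.le (by simp)
      (hNg.intervalIntegrable_of_Icc hT.le) key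
  rw [intervalIntegral.integral_const, sub_zero, smul_eq_mul] at h3
  have h4 : formNorm B (g t) - D ≤ 1 / T * ∫ r in (0 : ℝ)..T, formNorm B (g r) := by
    rw [one_div, ← div_eq_inv_mul, le_div_iff₀ hT]
    linarith
  linarith

end IsPsdForm

/-- Energy estimate for a second-order evolution equation. -/
theorem energy_estimate {M K : E →ₗ[ℝ] E →ₗ[ℝ] ℝ} (hM : IsPsdForm M) (hK : IsPsdForm K) {T : ℝ}
    (hT : 0 < T) {y z z' F : ℝ → E}
    (hy : ∀ t ∈ Icc 0 T, HasDerivWithinAt y (z t) (Icc 0 T) t)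
    (hz : ∀ t ∈ Icc 0 T, HasDerivWithinAt z (z' t) (Icc 0 T) t)
    (heq : ∀ t ∈ Icc 0 T, M (z' t) (z t) + K (y t) (z t) = M (F t) (z t))
    (hF : ContinuousOn F (Icc 0 T)) {t : ℝ} (ht : t ∈ Icc 0 T) :
    √(M (z t) (z t) + K (y t) (y t)) ≤
      formNorm M (z 0) + formNorm K (y 0) + ∫ r in (0 : ℝ)..T, formNorm M (F r) := by
  set e : ℝ → ℝ := fun t => M (z t) (z t) + K (y t) (y t) with he
  have he0 : ∀ t, 0 ≤ e t := fun t => add_nonneg (hM.nonneg _) (hK.nonneg _)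
  have hNF : ContinuousOn (fun r => formNorm M (F r)) (Icc 0 T) :=
    continuous_formNorm.comp_continuousOn hF
  have h0T : (0 : ℝ) ∈ Icc 0 T := ⟨le_rfl, hT.le⟩
  have hde : ∀ t ∈ Icc 0 T, HasDerivWithinAt e (2 * M (F t) (z t)) (Icc 0 T) t := by
    intro t ht
    refine ((hasDerivWithinAt_apply_apply (hz t ht) (hz t ht)).add
      (hasDerivWithinAt_apply_apply (hy t ht) (hy t ht))).congr_deriv ?_
    rw [← heq t ht, hM.symm (z t) (z' t), hK.symm (z t) (y t)]
    ring
  -- The energy may vanish, where the square root is not differentiable; it is shifted by `ε ^ 2`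
  -- and `ε` tends to zero at the end.
  have key : ∀ ε : ℝ, 0 < ε →
      √(e t + ε ^ 2) ≤ √(e 0 + ε ^ 2) + ∫ r in (0 : ℝ)..T, formNorm M (F r) := by
    intro ε hε
    have hpos : ∀ t, 0 < e t + ε ^ 2 := fun t => by have := he0 t; positivity
    refine le_add_integral_of_deriv_le hT (φ := fun r => √(e r + ε ^ 2))
      (φ' := fun r => 2 * M (F r) (z r) / (2 * √(e r + ε ^ 2)))
      (fun r hr => ((hde r hr).add_const (ε ^ 2)).sqrt (hpos r).ne') hNF
      (fun r _ => formNorm_nonneg _) (fun r _ => ?_) h0T ht ht.1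
    have hs : 0 < √(e r + ε ^ 2) := Real.sqrt_pos.2 (hpos r)
    rw [mul_div_mul_left _ _ two_ne_zero, div_le_iff₀ hs]
    refine (hM.apply_le _ _).trans (mul_le_mul_of_nonneg_left ?_ (formNorm_nonneg _))
    refine Real.sqrt_le_sqrt ?_
    have := hK.nonneg (y r)
    simp only [he]
    nlinarith [sq_nonneg ε]
  have h0 : √(e 0) ≤ formNorm M (z 0) + formNorm K (y 0) := by
    refine Real.sqrt_le_iff.2 ⟨add_nonneg (formNorm_nonneg _) (formNorm_nonneg _), ?_⟩
    rw [add_sq, hM.sq_formNorm, hK.sq_formNorm]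
    have := mul_nonneg (formNorm_nonneg (B := M) (z 0)) (formNorm_nonneg (B := K) (y 0))
    simp only [he]
    linarith
  refine le_of_forall_pos_le_add fun ε hε => ?_
  have h1 := key ε hε
  have h2 : √(e t) ≤ √(e t + ε ^ 2) := Real.sqrt_le_sqrt (by linarith [sq_nonneg ε])
  have h3 : √(e 0 + ε ^ 2) ≤ √(e 0) + ε := by
    refine Real.sqrt_le_iff.2 ⟨by positivity, ?_⟩
    rw [add_sq, Real.sq_sqrt (he0 0)]
    have := mul_nonneg (Real.sqrt_nonneg (e 0)) hε.le
    linarith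
  change √(e t) ≤ _
  linarith

end Chain

/-- Energy estimate for the time-stepping scheme. -/
theorem discrete_energy_estimate {E : Type*} [AddCommGroup E] [Module ℝ E]
    {M K : E →ₗ[ℝ] E →ₗ[ℝ] ℝ} (hM : IsPsdForm M) (hK : IsPsdForm K) {S : Submodule ℝ E} {τ b : ℝ}
    (hτ : 0 < τ) {N : ℕ} {θ r : ℕ → E} (hθ : ∀ n ≤ N, θ n ∈ S)
    (heq : ∀ n, n + 2 ≤ N → ∀ v ∈ S,
      M (τ⁻¹ • (diffQuot τ θ (n + 1) - diffQuot τ θ n)) v +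
        K ((2 : ℝ)⁻¹ • (midpt θ (n + 1) + midpt θ n)) v = M (r n) v)
    (hr : ∀ n, n + 2 ≤ N → formNorm M (r n) ≤ b) {n : ℕ} (hn : n + 1 ≤ N) :
    √(M (diffQuot τ θ n) (diffQuot τ θ n) + K (midpt θ n) (midpt θ n)) ≤
      formNorm M (diffQuot τ θ 0) + formNorm K (midpt θ 0) + n * (τ * b) := by
  set e : ℕ → ℝ := fun n =>
    M (diffQuot τ θ n) (diffQuot τ θ n) + K (midpt θ n) (midpt θ n) with he
  have he0 : ∀ n, 0 ≤ e n := fun n => add_nonneg (hM.nonneg _) (hK.nonneg _)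
  change √(e n) ≤ _
  induction n with
  | zero =>
    rw [Nat.cast_zero, zero_mul, add_zero]
    refine Real.sqrt_le_iff.2 ⟨add_nonneg (formNorm_nonneg _) (formNorm_nonneg _), ?_⟩
    rw [add_sq, hM.sq_formNorm, hK.sq_formNorm]
    have := mul_nonneg (formNorm_nonneg (B := M) (diffQuot τ θ 0))
      (formNorm_nonneg (B := K) (midpt θ 0))
    simp only [he]
    linarith
  | succ n ih =>
    have ih := ih (by omega)
    have hb : 0 ≤ b := (formNorm_nonneg _).trans (hr n hn)
    -- The test function is twice a centered difference quotient. It is also `2 * τ⁻¹` times the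
    -- increment of the midpoints, so both forms become differences of consecutive energies.
    have hmem : diffQuot τ θ (n + 1) + diffQuot τ θ n ∈ S := by
      unfold diffQuot
      exact S.add_mem
        (S.smul_mem _ (S.sub_mem (hθ _ hn) (hθ _ (by omega))))
        (S.smul_mem _ (S.sub_mem (hθ _ (by omega)) (hθ _ (by omega))))
    have h1 := heq n hn _ hmem
    have e1 : diffQuot τ θ (n + 1) + diffQuot τ θ n =
        (2 * τ⁻¹) • (midpt θ (n + 1) - midpt θ n) := by
      unfold diffQuot midpt
      module
    have h2 : M (τ⁻¹ • (diffQuot τ θ (n + 1) - diffQuot τ θ n))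
        (diffQuot τ θ (n + 1) + diffQuot τ θ n) =
        τ⁻¹ * (M (diffQuot τ θ (n + 1)) (diffQuot τ θ (n + 1)) -
          M (diffQuot τ θ n) (diffQuot τ θ n)) := by
      simp only [map_smul, map_sub, map_add, LinearMap.smul_apply, LinearMap.sub_apply, smul_eq_mul,
        hM.symm (diffQuot τ θ n) (diffQuot τ θ (n + 1))]
      ring
    have h3 : K ((2 : ℝ)⁻¹ • (midpt θ (n + 1) + midpt θ n))
        (diffQuot τ θ (n + 1) + diffQuot τ θ n) =
        τ⁻¹ * (K (midpt θ (n + 1)) (midpt θ (n + 1)) - K (midpt θ n) (midpt θ n)) := by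
      rw [e1]
      simp only [map_smul, map_sub, map_add, LinearMap.smul_apply, LinearMap.add_apply, smul_eq_mul,
        hK.symm (midpt θ n) (midpt θ (n + 1))]
      ring
    rw [h2, h3, ← mul_add] at h1
    have h4 : e (n + 1) - e n = τ * M (r n) (diffQuot τ θ (n + 1) + diffQuot τ θ n) := by
      rw [← h1, ← mul_assoc, mul_inv_cancel₀ hτ.ne', one_mul]
      simp only [he]
      ring
    have hd : ∀ m, formNorm M (diffQuot τ θ m) ≤ √(e m) := fun m =>
      Real.sqrt_le_sqrt (by simp only [he]; linarith [hK.nonneg (midpt θ m)])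
    have h5 : e (n + 1) - e n ≤ τ * b * (√(e (n + 1)) + √(e n)) := by
      rw [h4, mul_assoc]
      refine mul_le_mul_of_nonneg_left ?_ hτ.le
      refine (hM.apply_le _ _).trans ?_
      refine mul_le_mul (hr n hn) ((hM.formNorm_add_le _ _).trans (add_le_add (hd _) (hd _)))
        (formNorm_nonneg _) hb
    -- A difference of squares: dividing by the sum of the roots makes the bound linear in time,
    -- without a Gronwall factor.
    have h6 : √(e (n + 1)) ≤ √(e n) + τ * b := by
      have a1 := Real.sqrt_nonneg (e (n + 1))
      have a2 := Real.sqrt_nonneg (e n)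
      have hτb := mul_nonneg hτ.le hb
      rcases (add_nonneg a1 a2).eq_or_lt with h7 | h7
      · linarith
      · have h8 : (√(e (n + 1)) - √(e n)) * (√(e (n + 1)) + √(e n)) ≤
            τ * b * (√(e (n + 1)) + √(e n)) := by
          have : (√(e (n + 1)) - √(e n)) * (√(e (n + 1)) + √(e n)) =
              √(e (n + 1)) ^ 2 - √(e n) ^ 2 := by ring
          rw [this, Real.sq_sqrt (he0 _), Real.sq_sqrt (he0 _)]
          exact h5
        linarith [le_of_mul_le_mul_right h8 h7]
    push_cast
    linarith

/-! ### Regularity in time and the error estimate -/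

open Set

namespace SpatialNetwork

variable {d : ℕ} {net : SpatialNetwork d}

/-- The time derivatives of a solution of the wave equation, expressed by the equation. -/
def LocalOperator.timeChain (K : net.LocalOperator) (Γ : Set (Pt d)) (T : ℝ) (f u : ℝ → net.Fn) :
    ℕ → ℝ → net.Fn
  | 0 => u
  | 1 => derivWithin u (Icc 0 T)
  | j + 2 => fun t => iteratedDerivWithin j f (Icc 0 T) t - K.invMassK Γ (timeChain K Γ T f u j t)

theorem mem_V_of_hasDerivWithinAt {Γ : Set (Pt d)} {T : ℝ} (hT : 0 < T) {g : ℝ → net.Fn}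
    (hg : ∀ t ∈ Icc 0 T, g t ∈ net.V Γ) {t : ℝ} (ht : t ∈ Icc 0 T) {g' : net.Fn}
    (h : HasDerivWithinAt g g' (Icc 0 T) t) : g' ∈ net.V Γ := by
  intro x hx
  have h1 : HasDerivWithinAt (fun r => g r x) (g' x) (Icc 0 T) t := hasDerivWithinAt_pi.1 h x
  have h2 : HasDerivWithinAt (fun r => g r x) 0 (Icc 0 T) t :=
    (hasDerivWithinAt_const t (Icc 0 T) (0 : ℝ)).congr (fun r hr => hg r hr x hx) (hg t ht x hx)
  exact (uniqueDiffOn_Icc hT t ht).eq_deriv _ h1 h2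

namespace LocalOperator

variable {K : net.LocalOperator} {Γ : Set (Pt d)} {T Cwf : ℝ} {f u : ℝ → net.Fn} {g h : net.Fn}

theorem IsWellPrepared.hasDerivWithinAt (hf : K.IsWellPrepared Γ T f g h 3 Cwf) (hT : 0 < T) {j : ℕ}
    (hj : j < 3) {t : ℝ} (ht : t ∈ Icc 0 T) :
    HasDerivWithinAt (iteratedDerivWithin j f (Icc 0 T))
      (iteratedDerivWithin (j + 1) f (Icc 0 T) t) (Icc 0 T) t := by
  rw [iteratedDerivWithin_succ]
  exact (hf.contDiffOn.differentiableOn_iteratedDerivWithin (by exact_mod_cast hj)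
    (uniqueDiffOn_Icc hT) t ht).hasDerivWithinAt

theorem IsWellPrepared.continuousOn (hf : K.IsWellPrepared Γ T f g h 3 Cwf) (hT : 0 < T) {j : ℕ}
    (hj : j ≤ 3) : ContinuousOn (iteratedDerivWithin j f (Icc 0 T)) (Icc 0 T) :=
  hf.contDiffOn.continuousOn_iteratedDerivWithin (by exact_mod_cast hj) (uniqueDiffOn_Icc hT)

theorem IsWellPrepared.iteratedDerivWithin_mem (hf : K.IsWellPrepared Γ T f g h 3 Cwf) (hT : 0 < T)
    {j : ℕ} (hj : j ≤ 3) : ∀ t ∈ Icc 0 T, iteratedDerivWithin j f (Icc 0 T) t ∈ net.V Γ := by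
  induction j with
  | zero => intro t ht; rw [iteratedDerivWithin_zero]; exact hf.mem t ht
  | succ j ih =>
    intro t ht
    exact mem_V_of_hasDerivWithinAt hT (ih (by omega)) ht (hf.hasDerivWithinAt hT (by omega) ht)

theorem IsSolution.hasDerivWithinAt_zero (hu : K.IsSolution Γ T f g h u) {t : ℝ}
    (ht : t ∈ Icc 0 T) : HasDerivWithinAt u (derivWithin u (Icc 0 T) t) (Icc 0 T) t :=
  (hu.contDiffOn.differentiableOn (by norm_num) t ht).hasDerivWithinAt

/-- The equation is only tested with `V`. Since `V` contains the derivatives of `u`, the residual is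
itself admissible as a test function, and definiteness of the mass turns the weak form into an
identity. -/
theorem IsSolution.hasDerivWithinAt_one [Nontrivial net.nodes] (hu : K.IsSolution Γ T f g h u)
    (hT : 0 < T) (hf : ∀ t ∈ Icc 0 T, f t ∈ net.V Γ) {t : ℝ} (ht : t ∈ Icc 0 T) :
    HasDerivWithinAt (derivWithin u (Icc 0 T)) (f t - K.invMassK Γ (u t)) (Icc 0 T) t := by
  have h1 : HasDerivWithinAt (derivWithin u (Icc 0 T)) (iteratedDerivWithin 2 u (Icc 0 T) t)
      (Icc 0 T) t := by
    rw [iteratedDerivWithin_succ, iteratedDerivWithin_one]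
    have := hu.contDiffOn.differentiableOn_iteratedDerivWithin (m := 1) (by norm_num)
      (uniqueDiffOn_Icc hT) t ht
    rw [iteratedDerivWithin_one] at this
    exact this.hasDerivWithinAt
  have hV1 : ∀ s ∈ Icc 0 T, derivWithin u (Icc 0 T) s ∈ net.V Γ := fun s hs =>
    mem_V_of_hasDerivWithinAt hT hu.mem hs (hu.hasDerivWithinAt_zero hs)
  have hV2 := mem_V_of_hasDerivWithinAt hT hV1 ht h1
  have hV3 : iteratedDerivWithin 2 u (Icc 0 T) t - (f t - K.invMassK Γ (u t)) ∈ net.V Γ :=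
    Submodule.sub_mem _ hV2 (Submodule.sub_mem _ (hf t ht) (K.invMassK_mem_V Γ _))
  have h2 : iteratedDerivWithin 2 u (Icc 0 T) t = f t - K.invMassK Γ (u t) := by
    refine sub_eq_zero.1 (net.eq_zero_of_mass_self_eq_zero ?_)
    set w := iteratedDerivWithin 2 u (Icc 0 T) t - (f t - K.invMassK Γ (u t)) with hw
    have h3 := hu.eqn t ht w hV3
    rw [← K.mass_invMassK (u t) hV3] at h3
    have h4 : net.mass w w = net.mass (iteratedDerivWithin 2 u (Icc 0 T) t) w -
        (net.mass (f t) w - net.mass (K.invMassK Γ (u t)) w) := by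
      simp only [← massForm_univ_apply]
      conv_lhs => rw [hw, map_sub (net.massForm univ), map_sub (net.massForm univ), ← hw]
      rfl
    rw [h4]; linarith
  rwa [h2] at h1

/-- Bootstrapping: `u` is only assumed twice differentiable, but the equation trades two time
derivatives for `M⁻¹K`, so three derivatives of `f` yield five of `u`. -/
theorem hasDerivWithinAt_timeChain [Nontrivial net.nodes] (hu : K.IsSolution Γ T f g h u)
    (hf : K.IsWellPrepared Γ T f g h 3 Cwf) (hT : 0 < T) (j : ℕ) (hj : j ≤ 4) :
    ∀ t ∈ Icc 0 T, HasDerivWithinAt (K.timeChain Γ T f u j) (K.timeChain Γ T f u (j + 1) t)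
      (Icc 0 T) t := by
  induction j using Nat.strong_induction_on with
  | _ j ih =>
    match j with
    | 0 => exact fun t ht => hu.hasDerivWithinAt_zero ht
    | 1 =>
      intro t ht
      have := hu.hasDerivWithinAt_one hT hf.mem ht
      simpa [timeChain] using this
    | j + 2 =>
      intro t ht
      refine (hf.hasDerivWithinAt hT (by omega) ht).sub ?_
      have h1 := ih j (by omega) (by omega) t ht
      exact (K.invMassKLin Γ).toContinuousLinearMap.hasFDerivAt.comp_hasDerivWithinAt t h1

theorem timeChain_mem [Nontrivial net.nodes] (hu : K.IsSolution Γ T f g h u)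
    (hf : K.IsWellPrepared Γ T f g h 3 Cwf) (hT : 0 < T) {j : ℕ} (hj : j ≤ 5) {t : ℝ}
    (ht : t ∈ Icc 0 T) : K.timeChain Γ T f u j t ∈ net.V Γ := by
  match j with
  | 0 => exact hu.mem t ht
  | 1 => exact mem_V_of_hasDerivWithinAt hT hu.mem ht (hu.hasDerivWithinAt_zero ht)
  | j + 2 =>
    exact Submodule.sub_mem _ (hf.iteratedDerivWithin_mem hT (by omega) t ht)
      (K.invMassK_mem_V Γ _)

theorem timeChain_zero (hu : K.IsSolution Γ T f g h u) (j : ℕ) :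
    K.timeChain Γ T f u j 0 = K.dataSeq Γ T f g h j := by
  induction j using Nat.strong_induction_on with
  | _ j ih =>
    match j with
    | 0 => exact hu.init
    | 1 => exact hu.init_deriv
    | j + 2 => simp only [timeChain, dataSeq, ih j (by omega)]

/-- All contributions to the data bound. -/
theorem IsWellPrepared.bounds (hf : K.IsWellPrepared Γ T f g h 3 Cwf) (hT : 0 < T) :
    (∀ j ≤ 3, ∫ t in (0 : ℝ)..T, net.mNorm (iteratedDerivWithin j f (Icc 0 T) t) ≤ Cwf) ∧
    (∀ j ≤ 3, K.kNorm (K.dataSeq Γ T f g h j) ≤ Cwf) ∧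
    net.mNorm (K.dataSeq Γ T f g h 4) ≤ Cwf ∧
    net.mNorm (K.dataSeq Γ T f g h 4) + K.kNorm (K.dataSeq Γ T f g h 3) +
      ∫ t in (0 : ℝ)..T, net.mNorm (iteratedDerivWithin 3 f (Icc 0 T) t) ≤ Cwf := by
  have hb := hf.bound
  have h1 : ∀ j ∈ Finset.range (3 + 1),
      0 ≤ ∫ t in (0 : ℝ)..T, net.mNorm (iteratedDerivWithin j f (Icc 0 T) t) := fun j _ =>
    intervalIntegral.integral_nonneg hT.le fun t _ => Real.sqrt_nonneg _
  have h2 : ∀ j ∈ Finset.range (3 + 1), 0 ≤ K.kNorm (K.dataSeq Γ T f g h j) :=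
    fun j _ => Real.sqrt_nonneg _
  have h3 : 0 ≤ net.mNorm (K.dataSeq Γ T f g h 4) := Real.sqrt_nonneg _
  have s1 := Finset.sum_nonneg h1
  have s2 := Finset.sum_nonneg h2
  refine ⟨fun j hj => ?_, fun j hj => ?_, ?_, ?_⟩
  · have := Finset.single_le_sum h1 (Finset.mem_range.2 (Nat.lt_succ_of_le hj))
    linarith
  · have := Finset.single_le_sum h2 (Finset.mem_range.2 (Nat.lt_succ_of_le hj))
    linarith
  · linarith
  · have a1 := Finset.single_le_sum h1 (Finset.mem_range.2 (Nat.lt_succ_self 3))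
    have a2 := Finset.single_le_sum h2 (Finset.mem_range.2 (Nat.lt_succ_self 3))
    linarith

end LocalOperator

/-- A common bound for the time derivatives of the solution. -/
def regularityConst (T κ B : ℝ) : ℝ := (1 / T + 1 + (κ + 2) ^ 2) * B

namespace IsAdmissible

variable {Γ : Set (Pt d)} {R₀ σ ρ μ α β : ℝ} {i : ℕ} {K : net.LocalOperator} {T Cwf : ℝ}
  {f u : ℝ → net.Fn} {g h : net.Fn}

/-- A priori bounds for the time derivatives of the solution. -/
theorem regularity (ha : net.IsAdmissible Γ R₀ σ ρ μ i) (hK : K.IsBoundedCoercive Γ α β) (hT : 0 < T)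
    (hu : K.IsSolution Γ T f g h u) (hf : K.IsWellPrepared Γ T f g h 3 Cwf) {t : ℝ}
    (ht : t ∈ Icc 0 T) :
    K.kNorm (K.timeChain Γ T f u 2 t) ≤ regularityConst T (μ / √α) Cwf ∧
    net.mNorm (K.timeChain Γ T f u 3 t) ≤ regularityConst T (μ / √α) Cwf ∧
    net.mNorm (K.timeChain Γ T f u 4 t) ≤ regularityConst T (μ / √α) Cwf ∧
    ∀ j ≤ 2, net.mNorm (K.invMassK Γ (K.timeChain Γ T f u j t)) ≤
      regularityConst T (μ / √α) Cwf := by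
  have := ha.nontrivial
  have hM := net.isPsdForm_massForm univ
  have hB := K.isPsdForm_bilin
  set κ := μ / √α with hκ
  have hκ0 : 0 ≤ κ := div_nonneg ha.poincare.nonneg (Real.sqrt_nonneg _)
  obtain ⟨b1, b2, b3, b4⟩ := hf.bounds hT
  have hC0 : 0 ≤ Cwf := (Real.sqrt_nonneg _).trans b3
  set u' := K.timeChain Γ T f u with hu'
  have hder := fun j hj => LocalOperator.hasDerivWithinAt_timeChain hu hf hT j hj
  have hfr : ∀ {v : net.Fn}, v ∈ net.V Γ → net.mNorm v ≤ κ * K.kNorm v :=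
    fun hv => ha.mNorm_le_kNorm hK hv
  -- The equation differentiated `j + 2` times is again a wave equation, for `u' (j + 2)` with
  -- velocity `u' (j + 3)`; its initial values are the compatible data.
  have energy : ∀ j ≤ 1, √(net.mass (u' (j + 3) t) (u' (j + 3) t) +
      K.form (u' (j + 2) t) (u' (j + 2) t)) ≤
      net.mNorm (K.dataSeq Γ T f g h (j + 3)) + K.kNorm (K.dataSeq Γ T f g h (j + 2)) +
      ∫ r in (0 : ℝ)..T, net.mNorm (iteratedDerivWithin (j + 2) f (Icc 0 T) r) := by
    intro j hj
    rw [← LocalOperator.timeChain_zero hu, ← LocalOperator.timeChain_zero hu]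
    refine energy_estimate hM hB hT (y := u' (j + 2)) (z := u' (j + 3)) (z' := u' (j + 4))
      (hder (j + 2) (by omega)) (hder (j + 3) (by omega)) (fun s hs => ?_)
      (hf.continuousOn hT (by omega)) ht
    have hz : u' (j + 3) s ∈ net.V Γ := LocalOperator.timeChain_mem hu hf hT (by omega) hs
    have e : u' (j + 4) s = iteratedDerivWithin (j + 2) f (Icc 0 T) s -
      K.invMassK Γ (u' (j + 2) s) := rfl
    rw [e, map_sub, LinearMap.sub_apply, massForm_univ_apply, massForm_univ_apply,
      K.mass_invMassK _ hz, K.bilin_apply]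
    ring
  have eM : ∀ j, net.mNorm (u' (j + 3) t) ≤ √(net.mass (u' (j + 3) t) (u' (j + 3) t) +
      K.form (u' (j + 2) t) (u' (j + 2) t)) := fun j =>
    Real.sqrt_le_sqrt (le_add_of_nonneg_right (hB.nonneg _))
  have eK : ∀ j, K.kNorm (u' (j + 2) t) ≤ √(net.mass (u' (j + 3) t) (u' (j + 3) t) +
      K.form (u' (j + 2) t) (u' (j + 2) t)) := fun j =>
    Real.sqrt_le_sqrt (le_add_of_nonneg_left (hM.nonneg _))
  have h0T : (0 : ℝ) ∈ Icc 0 T := ⟨le_rfl, hT.le⟩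
  -- The data bound controls `w_3` only in the `K`-norm, while the energy for `j = 0` needs its
  -- `M`-norm.
  have hw3 : net.mNorm (K.dataSeq Γ T f g h 3) ≤ κ * Cwf := by
    rw [← LocalOperator.timeChain_zero hu]
    refine (hfr (LocalOperator.timeChain_mem hu hf hT (by omega) h0T)).trans ?_
    rw [LocalOperator.timeChain_zero hu]
    exact mul_le_mul_of_nonneg_left (b2 3 le_rfl) hκ0
  have e0 : √(net.mass (u' 3 t) (u' 3 t) + K.form (u' 2 t) (u' 2 t)) ≤ (κ + 2) * Cwf := by
    have := energy 0 (by omega)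
    have := b2 2 (by omega)
    have := b1 2 (by omega)
    linarith
  have e1 : √(net.mass (u' 4 t) (u' 4 t) + K.form (u' 3 t) (u' 3 t)) ≤ Cwf :=
    (energy 1 le_rfl).trans b4
  have hf' : ∀ j ≤ 2, net.mNorm (iteratedDerivWithin j f (Icc 0 T) t) ≤ (1 / T + 1) * Cwf := by
    intro j hj
    have h1 := hM.formNorm_le_integral hT (g := iteratedDerivWithin j f (Icc 0 T))
      (fun r hr => hf.hasDerivWithinAt hT (by omega) hr) (hf.continuousOn hT (by omega)) ht
    have h2 := b1 j (by omega)
    have h3 := b1 (j + 1) (by omega)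
    have h4 : 1 / T * ∫ r in (0 : ℝ)..T, net.mNorm (iteratedDerivWithin j f (Icc 0 T) r) ≤
      1 / T * Cwf := mul_le_mul_of_nonneg_left h2 (by positivity)
    calc _ ≤ _ := h1
      _ ≤ 1 / T * Cwf + Cwf := add_le_add h4 h3
      _ = _ := by ring
  have k2 : K.kNorm (u' 2 t) ≤ (κ + 2) * Cwf := (eK 0).trans e0
  have m2 : net.mNorm (u' 2 t) ≤ κ * ((κ + 2) * Cwf) :=
    (hfr (LocalOperator.timeChain_mem hu hf hT (by omega) ht)).trans
      (mul_le_mul_of_nonneg_left k2 hκ0)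
  have m3 : net.mNorm (u' 3 t) ≤ (κ + 2) * Cwf := (eM 0).trans e0
  have m4 : net.mNorm (u' 4 t) ≤ Cwf := (eM 1).trans e1
  have hTi : 0 ≤ 1 / T * Cwf := by positivity
  have q1 : 0 ≤ κ * Cwf := by positivity
  have q2 : 0 ≤ κ ^ 2 * Cwf := by positivity
  have hG : regularityConst T κ Cwf =
      1 / T * Cwf + 5 * Cwf + 4 * (κ * Cwf) + κ ^ 2 * Cwf := by
    rw [regularityConst]; ring
  refine ⟨by rw [hG]; linarith, by rw [hG]; linarith, by rw [hG]; linarith, fun j hj => ?_⟩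
  -- The equation expresses the right-hand side needed by the Ritz estimate through time
  -- derivatives, which are already bounded.
  have e : K.invMassK Γ (u' j t) = iteratedDerivWithin j f (Icc 0 T) t - u' (j + 2) t := by
    rw [hu', LocalOperator.timeChain, sub_sub_cancel]
  rw [e]
  refine (hM.formNorm_sub_le _ _).trans ?_
  have h1 : formNorm (net.massForm univ) (iteratedDerivWithin j f (Icc 0 T) t) ≤
    (1 / T + 1) * Cwf := hf' j hj
  have h2 : formNorm (net.massForm univ) (u' (j + 2) t) ≤ (κ + 2) ^ 2 * Cwf := by
    rw [← mNorm_eq_formNorm]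
    interval_cases j <;> nlinarith
  rw [regularityConst]
  linarith

end IsAdmissible

end SpatialNetwork

section Stencils

variable {E : Type*} [AddCommGroup E] [Module ℝ E]

theorem diffQuot_sub_map (τ : ℝ) (U V : ℕ → E) (R : E →ₗ[ℝ] E) (n : ℕ) :
    diffQuot τ (fun n => U n - R (V n)) n = diffQuot τ U n - R (diffQuot τ V n) := by
  simp only [diffQuot, map_smul, map_sub]
  module

theorem midpt_sub_map (U V : ℕ → E) (R : E →ₗ[ℝ] E) (n : ℕ) :
    midpt (fun n => U n - R (V n)) n = midpt U n - R (midpt V n) := by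
  simp only [midpt, map_smul, map_add]
  module

end Stencils

/-! ### Consistency and convergence of the fully discrete method -/

namespace SpatialNetwork.IsAdmissible

variable {d : ℕ} {net : SpatialNetwork d} {Γ : Set (Pt d)} {R₀ σ ρ μ α β : ℝ} {i : ℕ}
  {K : net.LocalOperator} {T Cwf : ℝ} {f u : ℝ → net.Fn} {g h : net.Fn}

/-- The Ritz projection as a linear map. -/
def ritzLin (ha : net.IsAdmissible Γ R₀ σ ρ μ i) (hK : K.IsBoundedCoercive Γ α β) (k : ℕ) :
    net.Fn →ₗ[ℝ] net.Fn where
  toFun := K.ritz Γ i k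
  map_add' := ha.ritz_add hK k
  map_smul' := ha.ritz_smul hK k

theorem ritzLin_apply (ha : net.IsAdmissible Γ R₀ σ ρ μ i) (hK : K.IsBoundedCoercive Γ α β) (k : ℕ)
    (v : net.Fn) : ha.ritzLin hK k v = K.ritz Γ i k v := rfl

theorem kNorm_ritz_le (ha : net.IsAdmissible Γ R₀ σ ρ μ i) (hK : K.IsBoundedCoercive Γ α β) (k : ℕ)
    (v : net.Fn) : K.kNorm (K.ritz Γ i k v) ≤ K.kNorm v := by
  have hB := K.isPsdForm_bilin
  refine Real.sqrt_le_sqrt ?_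
  have h1 := hB.two_mul_apply_le v (K.ritz Γ i k v)
  rw [← (ha.ritz_spec hK k v).2 _ (ha.ritz_spec hK k v).1] at h1
  change K.bilin _ _ ≤ K.bilin _ _
  linarith

/-- Friedrichs transfers the energy bound to the `M`-norm. First order suffices, so no duality
argument is needed. -/
theorem mNorm_sub_ritz_le (ha : net.IsAdmissible Γ R₀ σ ρ μ i) (hK : K.IsBoundedCoercive Γ α β)
    {k : ℕ} (hk : 1 ≤ k) (hlog : layerFactor d σ μ α β * Real.log (1 / meshSize i) ≤ k)
    {w : net.Fn} (hw : w ∈ net.V Γ) :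
    net.mNorm (w - K.ritz Γ i k w) ≤
      μ / √α * (ritzConst d σ μ α β * meshSize i * net.mNorm (K.invMassK Γ w)) :=
  (ha.mNorm_le_kNorm hK (Submodule.sub_mem _ hw
    (ha.msSpace_le_V hK k (ha.ritz_spec hK k w).1))).trans
    (mul_le_mul_of_nonneg_left (ha.kNorm_sub_ritz_le hK hk hlog hw)
      (div_nonneg ha.poincare.nonneg (Real.sqrt_nonneg _)))

theorem ritzConst_nonneg (ha : net.IsAdmissible Γ R₀ σ ρ μ i) (hK : K.IsBoundedCoercive Γ α β) :
    0 ≤ ritzConst d σ μ α β := by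
  have := hK.1
  have := ha.poincare.nonneg
  unfold ritzConst
  positivity

/-- Consistency of the difference quotients of the solution. -/
theorem consistency (ha : net.IsAdmissible Γ R₀ σ ρ μ i) (hK : K.IsBoundedCoercive Γ α β)
    (hT : 0 < T) (hu : K.IsSolution Γ T f g h u) (hf : K.IsWellPrepared Γ T f g h 3 Cwf) {τ : ℝ}
    (hτ : 0 < τ) {n : ℕ} (hn : ((n : ℝ) + 1) * τ ≤ T) :
    net.mNorm (diffQuot τ (fun n => u (n * τ)) n - derivWithin u (Icc 0 T) ((n + 1 / 2) * τ)) ≤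
        regularityConst T (μ / √α) Cwf * τ ^ 2 ∧
      K.kNorm (midpt (fun n => u (n * τ)) n - u ((n + 1 / 2) * τ)) ≤
        regularityConst T (μ / √α) Cwf * τ ^ 2 ∧
      net.mNorm (K.invMassK Γ (diffQuot τ (fun n => u (n * τ)) n)) ≤
        regularityConst T (μ / √α) Cwf := by
  have := ha.nontrivial
  have hM := net.isPsdForm_massForm univ
  have hB := K.isPsdForm_bilin
  set G := regularityConst T (μ / √α) Cwf with hG
  have hreg := fun t (ht : t ∈ Icc 0 T) => ha.regularity hK hT hu hf ht
  have hder := fun j hj => LocalOperator.hasDerivWithinAt_timeChain hu hf hT j hj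
  set u' := K.timeChain Γ T f u with hu'
  set t := (n : ℝ) * τ with ht
  have e1 : ((n + 1 : ℕ) : ℝ) * τ = t + τ := by rw [ht]; push_cast; ring
  have e2 : ((n : ℝ) + 1 / 2) * τ = t + τ / 2 := by rw [ht]; ring
  have ht0 : 0 ≤ t := by positivity
  have htT : t + τ ≤ T := by rw [← e1]; push_cast; exact hn
  have h0 : t ∈ Icc 0 T := ⟨ht0, by linarith⟩
  have h1 : t + τ ∈ Icc 0 T := ⟨by linarith, htT⟩
  refine ⟨?_, ?_, ?_⟩
  · have c := hM.formNorm_diff_sub_deriv_le hτ.le (u := u') (fun j hj => hder j (by omega))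
      (fun s hs => (hreg s hs).2.1) h0 h1
    have e : diffQuot τ (fun n : ℕ => u (n * τ)) n - derivWithin u (Icc 0 T) ((n + 1 / 2) * τ) =
        τ⁻¹ • (u' 0 (t + τ) - u' 0 t - τ • u' 1 (t + τ / 2)) := by
      rw [smul_sub τ⁻¹, smul_smul, inv_mul_cancel₀ hτ.ne', one_smul, diffQuot, e1, e2]
      rfl
    rw [e, mNorm_eq_formNorm, IsPsdForm.formNorm_smul, abs_of_pos (inv_pos.2 hτ),
      inv_mul_le_iff₀ hτ]
    exact c.trans_eq (by ring)
  · have c := hB.formNorm_midpt_sub_le hτ.le (u := u') (fun j hj => hder j (by omega))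
      (fun s hs => (hreg s hs).1) h0 h1
    rw [midpt, e1, e2]
    exact c.trans_eq (by ring)
  · have c := hM.formNorm_diff_le hτ.le (u := fun j s => K.invMassKLin Γ (u' j s))
      (fun j hj s hs => (K.invMassKLin Γ).toContinuousLinearMap.hasFDerivAt.comp_hasDerivWithinAt s
        (hder j (by omega) s hs)) (fun s hs => (hreg s hs).2.2.2 1 (by omega)) h0 h1
    have e : K.invMassK Γ (diffQuot τ (fun n : ℕ => u (n * τ)) n) =
        τ⁻¹ • (K.invMassKLin Γ (u' 0 (t + τ)) - K.invMassKLin Γ (u' 0 t)) := by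
      rw [diffQuot, e1, ← K.invMassKLin_apply, map_smul, map_sub]
      rfl
    rw [e, mNorm_eq_formNorm, IsPsdForm.formNorm_smul, abs_of_pos (inv_pos.2 hτ),
      inv_mul_le_iff₀ hτ]
    exact c

/-- Consistency of the second difference quotients of the solution. -/
theorem consistency_second (ha : net.IsAdmissible Γ R₀ σ ρ μ i) (hK : K.IsBoundedCoercive Γ α β)
    (hT : 0 < T) (hu : K.IsSolution Γ T f g h u) (hf : K.IsWellPrepared Γ T f g h 3 Cwf) {τ : ℝ}
    (hτ : 0 < τ) {n : ℕ} (hn : ((n : ℝ) + 2) * τ ≤ T) {us : ℕ → net.Fn}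
    (hus : us = fun n : ℕ => u (n * τ)) {D : net.Fn}
    (hD : D = τ⁻¹ • (diffQuot τ us (n + 1) - diffQuot τ us n)) :
    net.mNorm (K.timeChain Γ T f u 2 (((n + 1 : ℕ) : ℝ) * τ) - D) ≤
        2 * regularityConst T (μ / √α) Cwf * τ ^ 2 ∧
      net.mNorm (K.invMassK Γ D) ≤ 2 * regularityConst T (μ / √α) Cwf ∧
      net.mNorm (K.invMassK Γ
        (us (n + 1) - (2 : ℝ)⁻¹ • (midpt us (n + 1) + midpt us n))) ≤
        regularityConst T (μ / √α) Cwf * τ ^ 2 := by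
  have := ha.nontrivial
  have hM := net.isPsdForm_massForm univ
  set G := regularityConst T (μ / √α) Cwf with hG
  have hreg := fun t (ht : t ∈ Icc 0 T) => ha.regularity hK hT hu hf ht
  have hder := fun j hj => LocalOperator.hasDerivWithinAt_timeChain hu hf hT j hj
  set u' := K.timeChain Γ T f u with hu'
  set t := ((n + 1 : ℕ) : ℝ) * τ with ht
  have et : t = ((n : ℝ) + 1) * τ := by rw [ht]; push_cast; ring
  have e1 : ((n + 1 + 1 : ℕ) : ℝ) * τ = t + τ := by rw [et]; push_cast; ring
  have e2 : (n : ℝ) * τ = t - τ := by rw [et]; ring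
  have hnτ : 0 ≤ (n : ℝ) * τ := by positivity
  have h2 : t - τ ∈ Icc 0 T := ⟨by linarith, by linarith⟩
  have h1 : t + τ ∈ Icc 0 T := ⟨by linarith, by linarith⟩
  have h0 : t ∈ Icc 0 T := ⟨by linarith, by linarith⟩
  have hG0 : 0 ≤ G := (Real.sqrt_nonneg _).trans (hreg t h0).1
  have u0 : us n = u' 0 (t - τ) := by rw [hus, ← e2]; rfl
  have u1 : us (n + 1) = u' 0 t := by rw [hus]; rfl
  have u2 : us (n + 1 + 1) = u' 0 (t + τ) := by rw [hus, ← e1]; rfl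
  have c1 := hM.formNorm_second_diff_sub_deriv_le hτ.le (u := u') (fun j hj => hder j (by omega))
      (fun s hs => (hreg s hs).2.2.1) h0 h1 h2
  have c2 := hM.formNorm_second_diff_le hτ.le (u := fun j s => K.invMassKLin Γ (u' j s))
      (fun j hj s hs => (K.invMassKLin Γ).toContinuousLinearMap.hasFDerivAt.comp_hasDerivWithinAt s
        (hder j (by omega) s hs)) (fun s hs => (hreg s hs).2.2.2 2 le_rfl) h0 h1 h2
  have eD : D = (τ ^ 2)⁻¹ • (u' 0 (t + τ) - (2 : ℝ) • u' 0 t + u' 0 (t - τ)) := by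
    rw [hD, diffQuot, diffQuot, u0, u1, u2, sq, mul_inv]
    module
  have hτ2 : 0 < τ ^ 2 := by positivity
  refine ⟨?_, ?_, ?_⟩
  · have e : u' 2 t - D = -((τ ^ 2)⁻¹ •
        (u' 0 (t + τ) - (2 : ℝ) • u' 0 t + u' 0 (t - τ) - τ ^ 2 • u' 2 t)) := by
      rw [smul_sub (τ ^ 2)⁻¹ (_ + _), ← eD, smul_smul, inv_mul_cancel₀ hτ2.ne', one_smul, neg_sub]
    rw [e, mNorm_eq_formNorm, IsPsdForm.formNorm_neg, IsPsdForm.formNorm_smul,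
      abs_of_pos (inv_pos.2 hτ2), inv_mul_le_iff₀ hτ2]
    exact c1.trans_eq (by ring)
  · rw [eD, ← K.invMassKLin_apply, map_smul, map_add, map_sub, map_smul, mNorm_eq_formNorm,
      IsPsdForm.formNorm_smul, abs_of_pos (inv_pos.2 hτ2), inv_mul_le_iff₀ hτ2]
    exact c2.trans_eq (by ring)
  -- The time average in the scheme has weights `1/4, 1/2, 1/4`, so it misses the middle value by a
  -- quarter of the second difference.
  · have e : us (n + 1) - (2 : ℝ)⁻¹ • (midpt us (n + 1) + midpt us n) =
        (-(1 / 4) : ℝ) • (u' 0 (t + τ) - (2 : ℝ) • u' 0 t + u' 0 (t - τ)) := by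
      rw [midpt, midpt, u0, u1, u2]
      module
    rw [e, ← K.invMassKLin_apply, map_smul, map_add, map_sub, map_smul, mNorm_eq_formNorm,
      IsPsdForm.formNorm_smul, abs_neg, abs_of_pos (by norm_num)]
    have : 0 ≤ G * τ ^ 2 := by positivity
    have c3 : formNorm (net.massForm univ) (K.invMassKLin Γ (u' 0 (t + τ)) -
      (2 : ℝ) • K.invMassKLin Γ (u' 0 t) + K.invMassKLin Γ (u' 0 (t - τ))) ≤ 2 * τ ^ 2 * G := c2
    linarith

/-- The error estimate for the fully discrete localized method. -/
theorem error_estimate (ha : net.IsAdmissible Γ R₀ σ ρ μ i) (hK : K.IsBoundedCoercive Γ α β)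
    {k N : ℕ} (hk : 1 ≤ k) (hlog : layerFactor d σ μ α β * Real.log (1 / meshSize i) ≤ k)
    (hT : 0 < T) (hN : 1 ≤ N) {τ : ℝ} (hτ : τ = T / N) (hu : K.IsSolution Γ T f g h u)
    (hf : K.IsWellPrepared Γ T f g h 3 Cwf) {U : ℕ → net.Fn}
    (hU : K.IsLocalizedScheme Γ i k N τ f U) {C₀ : ℝ}
    (hinit : net.mNorm (diffQuot τ U 0 - K.ritz Γ i k (diffQuot τ (fun n => u (n * τ)) 0)) +
      K.kNorm (midpt U 0 - K.ritz Γ i k (u (τ / 2))) ≤ C₀ * (meshSize i + τ ^ 2))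
    {G κ CR : ℝ} (hG : G = regularityConst T κ Cwf) (hκ : κ = μ / √α)
    (hCR : CR = ritzConst d σ μ α β) {n : ℕ} (hn : n + 1 ≤ N) :
    net.mNorm (diffQuot τ U n - derivWithin u (Icc 0 T) ((n + 1 / 2) * τ)) +
        K.kNorm (midpt U n - u ((n + 1 / 2) * τ)) ≤
      (2 * (C₀ + G + T * (G * (3 + 2 * κ * CR))) + G * (κ * CR + CR + 2)) *
        (meshSize i + τ ^ 2) := by
  have := ha.nontrivial
  have hH := meshSize_pos i
  have hM := net.isPsdForm_massForm univ
  have hB := K.isPsdForm_bilin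
  have hNpos : (0 : ℝ) < N := by exact_mod_cast hN
  have hτ0 : 0 < τ := by rw [hτ]; positivity
  have hNτ : N * τ = T := by rw [hτ]; field_simp
  have hκ0 : 0 ≤ κ := by rw [hκ]; exact div_nonneg ha.poincare.nonneg (Real.sqrt_nonneg _)
  have hCR0 : 0 ≤ CR := by rw [hCR]; exact ha.ritzConst_nonneg hK
  have hle : ∀ {m : ℕ}, m ≤ N → (m : ℝ) * τ ≤ T := fun {m} hm => by
    rw [← hNτ]
    exact mul_le_mul_of_nonneg_right (by exact_mod_cast hm) hτ0.le
  have hmem : ∀ {m : ℕ}, m ≤ N → (m : ℝ) * τ ∈ Icc 0 T := fun {m} hm => ⟨by positivity, hle hm⟩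
  set us : ℕ → net.Fn := fun n => u (n * τ) with hus
  have husV : ∀ m ≤ N, us m ∈ net.V Γ := fun m hm => hu.mem _ (hmem hm)
  set R := ha.ritzLin hK k with hR
  have hG0 : 0 ≤ G := by
    rw [hG, hκ]
    exact (Real.sqrt_nonneg _).trans (ha.regularity hK hT hu hf ⟨le_rfl, hT.le⟩).1
  have hfirst : ∀ {m : ℕ}, m + 1 ≤ N → _ := fun {m} hm =>
    ha.consistency hK hT hu hf hτ0 (n := m) (by exact_mod_cast hle hm)
  rw [← hκ, ← hG, ← hus] at hfirst
  have hdq : ∀ {m : ℕ}, m + 1 ≤ N → diffQuot τ us m ∈ net.V Γ := fun {m} hm =>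
    Submodule.smul_mem _ _ (Submodule.sub_mem _ (husV _ hm) (husV _ (by omega)))
  set E := meshSize i + τ ^ 2 with hE
  have hHE : meshSize i ≤ E := by rw [hE]; linarith [sq_nonneg τ]
  have hτE : τ ^ 2 ≤ E := by rw [hE]; linarith
  have hE0 : 0 ≤ E := hH.le.trans hHE
  -- the discrete error
  set θ : ℕ → net.Fn := fun n => U n - R (us n) with hθ
  have hθd : ∀ m, diffQuot τ θ m = diffQuot τ U m - R (diffQuot τ us m) :=
    diffQuot_sub_map τ U us R
  have hθm : ∀ m, midpt θ m = midpt U m - R (midpt us m) := midpt_sub_map U us R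
  have hθS : ∀ m ≤ N, θ m ∈ K.msSpace Γ i k := fun m hm =>
    Submodule.sub_mem _ (hU.mem m hm) (ha.ritz_spec hK k _).1
  -- the residual
  set D : ℕ → net.Fn := fun m => τ⁻¹ • (diffQuot τ us (m + 1) - diffQuot τ us m) with hD
  set A : ℕ → net.Fn := fun m => (2 : ℝ)⁻¹ • (midpt us (m + 1) + midpt us m) with hA
  -- The residual has three sources: the second difference quotient in place of the second
  -- derivative, the Ritz error of that quotient, and the time averaging of the stiffness term.
  set r : ℕ → net.Fn := fun m => (K.timeChain Γ T f u 2 (((m + 1 : ℕ) : ℝ) * τ) - D m) +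
    (D m - R (D m)) + K.invMassK Γ (us (m + 1) - A m) with hr
  have hres : ∀ m, m + 2 ≤ N → ∀ v ∈ K.msSpace Γ i k,
      net.massForm univ (τ⁻¹ • (diffQuot τ θ (m + 1) - diffQuot τ θ m)) v +
        K.bilin ((2 : ℝ)⁻¹ • (midpt θ (m + 1) + midpt θ m)) v = net.massForm univ (r m) v := by
    intro m hm v hv
    have hvV := ha.msSpace_le_V hK k hv
    have e1 : τ⁻¹ • (diffQuot τ θ (m + 1) - diffQuot τ θ m) =
        τ⁻¹ • (diffQuot τ U (m + 1) - diffQuot τ U m) - R (D m) := by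
      rw [hθd, hθd, hD]
      simp only [map_smul, map_sub]
      module
    have e2 : (2 : ℝ)⁻¹ • (midpt θ (m + 1) + midpt θ m) =
        (2 : ℝ)⁻¹ • (midpt U (m + 1) + midpt U m) - R (A m) := by
      rw [hθm, hθm, hA]
      simp only [map_smul, map_add]
      module
    have h1 := hU.eqn m hm v hv
    rw [← massForm_univ_apply, ← massForm_univ_apply, ← K.bilin_apply] at h1
    have h2 : K.bilin (R (A m)) v = K.bilin (A m) v := (ha.ritz_spec hK k (A m)).2 v hv
    have h3 : net.massForm univ (K.invMassK Γ (us (m + 1) - A m)) v =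
        K.bilin (us (m + 1)) v - K.bilin (A m) v := by
      rw [massForm_univ_apply, K.mass_invMassK _ hvV, ← K.bilin_apply, map_sub,
        LinearMap.sub_apply]
    have h4 : K.timeChain Γ T f u 2 (((m + 1 : ℕ) : ℝ) * τ) =
        f (((m + 1 : ℕ) : ℝ) * τ) - K.invMassK Γ (us (m + 1)) := by
      simp [LocalOperator.timeChain, hus]
    have h5 : net.massForm univ (K.invMassK Γ (us (m + 1))) v = K.bilin (us (m + 1)) v := by
      rw [massForm_univ_apply, K.mass_invMassK _ hvV, ← K.bilin_apply]
    rw [e1, e2]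
    simp only [hr, h4]
    simp only [map_add, map_sub, LinearMap.add_apply, LinearMap.sub_apply] at h1 h3 ⊢
    linarith
  have hrb : ∀ m, m + 2 ≤ N → formNorm (net.massForm univ) (r m) ≤
      G * (3 + 2 * κ * CR) * E := by
    intro m hm
    obtain ⟨a1, a2, a3⟩ := ha.consistency_second hK hT hu hf hτ0 (n := m)
      (by exact_mod_cast hle hm) hus (D := D m) rfl
    rw [← hκ, ← hG] at a1 a2 a3
    have hDV : D m ∈ net.V Γ :=
      Submodule.smul_mem _ _ (Submodule.sub_mem _ (hdq hm) (hdq (by omega)))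
    have a4 := ha.mNorm_sub_ritz_le hK hk hlog hDV
    rw [← hκ, ← hCR] at a4
    have a5 : net.mNorm (D m - R (D m)) ≤ κ * (CR * meshSize i * (2 * G)) :=
      a4.trans (by gcongr)
    calc _ ≤ net.mNorm (K.timeChain Γ T f u 2 (((m + 1 : ℕ) : ℝ) * τ) - D m) +
          net.mNorm (D m - R (D m)) + net.mNorm (K.invMassK Γ (us (m + 1) - A m)) :=
          (hM.formNorm_add_le _ _).trans
            (add_le_add (hM.formNorm_add_le _ _) le_rfl)
      _ ≤ 2 * G * τ ^ 2 + κ * (CR * meshSize i * (2 * G)) + G * τ ^ 2 := by gcongr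
      _ ≤ 2 * G * E + κ * (CR * E * (2 * G)) + G * E := by gcongr
      _ = _ := by ring
  have hRK : ∀ v, K.kNorm (R v) ≤ K.kNorm v := ha.kNorm_ritz_le hK k
  -- the initial error
  have h00 : formNorm (net.massForm univ) (diffQuot τ θ 0) + formNorm K.bilin (midpt θ 0) ≤
      (C₀ + G) * E := by
    have a1 := (hfirst (m := 0) (by omega)).2.1
    have e0 : (((0 : ℕ) : ℝ) + 1 / 2) * τ = τ / 2 := by push_cast; ring
    rw [e0] at a1
    -- The initial hypothesis compares with the projection at time `τ / 2`, whereas `θ` involves the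
    -- projected average; `K`-stability of the projection makes the difference second order in `τ`.
    have e1 : midpt θ 0 = (midpt U 0 - K.ritz Γ i k (u (τ / 2))) -
        R (midpt us 0 - u (τ / 2)) := by
      rw [hθm, map_sub, ha.ritzLin_apply hK k (u (τ / 2))]; abel
    have a2 : K.kNorm (midpt θ 0) ≤ K.kNorm (midpt U 0 - K.ritz Γ i k (u (τ / 2))) +
        G * τ ^ 2 := by
      rw [e1]
      exact (hB.formNorm_sub_le _ _).trans (add_le_add le_rfl ((hRK _).trans a1))
    have a3 : net.mNorm (diffQuot τ θ 0) =
        net.mNorm (diffQuot τ U 0 - K.ritz Γ i k (diffQuot τ us 0)) := by rw [hθd]; rfl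
    rw [← mNorm_eq_formNorm, ← K.kNorm_eq_formNorm, a3]
    have a4 : G * τ ^ 2 ≤ G * E := by gcongr
    linarith
  have henergy := discrete_energy_estimate hM hB hτ0 hθS hres hrb hn
  have hnT : (n : ℝ) * τ ≤ T := hle (by omega)
  have hbound : √(net.massForm univ (diffQuot τ θ n) (diffQuot τ θ n) +
      K.bilin (midpt θ n) (midpt θ n)) ≤ (C₀ + G + T * (G * (3 + 2 * κ * CR))) * E := by
    have h1 : (n : ℝ) * (τ * (G * (3 + 2 * κ * CR) * E)) ≤ T * (G * (3 + 2 * κ * CR) * E) := by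
      rw [← mul_assoc]
      gcongr
    calc _ ≤ _ := henergy
      _ ≤ (C₀ + G) * E + T * (G * (3 + 2 * κ * CR) * E) := add_le_add h00 h1
      _ = _ := by ring
  have hθM : net.mNorm (diffQuot τ θ n) ≤ (C₀ + G + T * (G * (3 + 2 * κ * CR))) * E :=
    (Real.sqrt_le_sqrt (le_add_of_nonneg_right (hB.nonneg _))).trans hbound
  have hθK : K.kNorm (midpt θ n) ≤ (C₀ + G + T * (G * (3 + 2 * κ * CR))) * E :=
    (Real.sqrt_le_sqrt (le_add_of_nonneg_left (hM.nonneg _))).trans hbound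
  obtain ⟨a1, a2, a3⟩ := hfirst hn
  have hfin1 : net.mNorm (diffQuot τ U n - derivWithin u (Icc 0 T) ((n + 1 / 2) * τ)) ≤
      (C₀ + G + T * (G * (3 + 2 * κ * CR))) * E + G * (κ * CR) * E + G * E := by
    have e1 : diffQuot τ U n - derivWithin u (Icc 0 T) ((n + 1 / 2) * τ) =
        (diffQuot τ θ n - (diffQuot τ us n - R (diffQuot τ us n))) +
          (diffQuot τ us n - derivWithin u (Icc 0 T) ((n + 1 / 2) * τ)) := by
      rw [hθd]; abel
    have b1 := ha.mNorm_sub_ritz_le hK hk hlog (hdq hn)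
    rw [← hκ, ← hCR] at b1
    have b2 : net.mNorm (diffQuot τ us n - R (diffQuot τ us n)) ≤ κ * (CR * meshSize i * G) :=
      b1.trans (by gcongr)
    rw [e1]
    calc _ ≤ net.mNorm (diffQuot τ θ n) + net.mNorm (diffQuot τ us n - R (diffQuot τ us n)) +
          net.mNorm (diffQuot τ us n - derivWithin u (Icc 0 T) ((n + 1 / 2) * τ)) :=
          (hM.formNorm_add_le _ _).trans (add_le_add (hM.formNorm_sub_le _ _) le_rfl)
      _ ≤ (C₀ + G + T * (G * (3 + 2 * κ * CR))) * E + κ * (CR * meshSize i * G) +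
          G * τ ^ 2 := by gcongr
      _ ≤ (C₀ + G + T * (G * (3 + 2 * κ * CR))) * E + κ * (CR * E * G) + G * E := by gcongr
      _ = _ := by ring
  have hfin2 : K.kNorm (midpt U n - u ((n + 1 / 2) * τ)) ≤
      (C₀ + G + T * (G * (3 + 2 * κ * CR))) * E + G * E + G * CR * E := by
    have hmid : ((n : ℝ) + 1 / 2) * τ ∈ Icc 0 T := by
      refine ⟨by positivity, ?_⟩
      have := hle hn
      push_cast at this
      nlinarith
    -- The averaging error is kept behind the projection, where its `K`-stability applies; the Ritz
    -- error is taken at the midpoint itself.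
    have e1 : midpt U n - u ((n + 1 / 2) * τ) =
        (midpt θ n + R (midpt us n - u ((n + 1 / 2) * τ))) -
          (u ((n + 1 / 2) * τ) - R (u ((n + 1 / 2) * τ))) := by
      rw [hθm, map_sub]; abel
    have b1 := ha.kNorm_sub_ritz_le hK hk hlog (hu.mem _ hmid)
    rw [← hCR] at b1
    have b0 := (ha.regularity hK hT hu hf hmid).2.2.2 0 (by omega)
    rw [← hκ, ← hG] at b0
    have b2 : K.kNorm (u ((n + 1 / 2) * τ) - R (u ((n + 1 / 2) * τ))) ≤ CR * meshSize i * G :=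
      b1.trans (by gcongr; exact b0)
    rw [e1]
    calc _ ≤ K.kNorm (midpt θ n) + K.kNorm (R (midpt us n - u ((n + 1 / 2) * τ))) +
          K.kNorm (u ((n + 1 / 2) * τ) - R (u ((n + 1 / 2) * τ))) :=
          (hB.formNorm_sub_le _ _).trans (add_le_add (hB.formNorm_add_le _ _) le_rfl)
      _ ≤ (C₀ + G + T * (G * (3 + 2 * κ * CR))) * E + G * τ ^ 2 + CR * meshSize i * G := by
          gcongr
          exact (hRK _).trans a2
      _ ≤ (C₀ + G + T * (G * (3 + 2 * κ * CR))) * E + G * E + CR * E * G := by gcongr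
      _ = _ := by ring
  calc _ ≤ _ := add_le_add hfin1 hfin2
    _ = _ := by ring

end SpatialNetwork.IsAdmissible

end

theorem corollary1 (d : ℕ) (σ μ α β : ℝ) :
    ∃ c₀ : ℝ, 0 < c₀ ∧ ∀ T C₀ Cwf : ℝ, 0 < T → ∃ C : ℝ,
      ∀ (net : SpatialNetwork d) (Γ : Set (Pt d)) (R₀ ρ : ℝ) (K : net.LocalOperator)
        (i k N : ℕ) (f : ℝ → net.Fn) (g h : net.Fn) (u : ℝ → net.Fn)
        (U : ℕ → net.Fn) (τ : ℝ),
        Γ.Nonempty →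
        IsUnionOfBoundaryFaces i Γ →
        net.HasProperties Γ R₀ σ ρ →
        net.poincareConst Γ R₀ ≤ μ →
        K.IsBoundedCoercive Γ α β →
        8 * d * R₀ ≤ meshSize i →
        1 ≤ k →
        c₀ * Real.log (1 / meshSize i) ≤ k →
        1 ≤ N →
        τ = T / N →
        K.IsSolution Γ T f g h u →
        K.IsWellPrepared Γ T f g h 3 Cwf →
        K.IsLocalizedScheme Γ i k N τ f U →
        net.mNorm (diffQuot τ U 0 - K.ritz Γ i k (diffQuot τ (fun n => u (n * τ)) 0)) +
            K.kNorm (midpt U 0 - K.ritz Γ i k (u (τ / 2))) ≤ C₀ * (meshSize i + τ ^ 2) →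
        ∀ n : ℕ, n + 1 ≤ N →
          net.mNorm (diffQuot τ U n - derivWithin u (Set.Icc 0 T) ((n + 1 / 2) * τ)) +
              K.kNorm (midpt U n - u ((n + 1 / 2) * τ)) ≤ C * (meshSize i + τ ^ 2) := by
  -- Every constant is formed with `μ + 1`, which is an admissible Poincaré bound whether or not the
  -- infimum is attained.
  refine ⟨layerFactor d σ (μ + 1) α β, layerFactor_pos d σ (μ + 1) α β, fun T C₀ Cwf hT =>
    let κ := (μ + 1) / √α
    let G := SpatialNetwork.regularityConst T κ Cwf
    let CR := ritzConst d σ (μ + 1) α β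
    ⟨2 * (C₀ + G + T * (G * (3 + 2 * κ * CR))) + G * (κ * CR + CR + 2), ?_⟩⟩
  intro net Γ R₀ ρ K i k N f g h u U τ hne hΓ hp hμ hK hmesh hk hlog hN hτ hu hf hU hinit n hn
  have ha : net.IsAdmissible Γ R₀ σ ρ (μ + 1) i :=
    ⟨hne, hΓ, hp, SpatialNetwork.isPoincareBound_add_one hne hΓ hp hμ, hmesh⟩
  exact ha.error_estimate hK hk hlog hT hN hτ hu hf hU hinit rfl rfl rfl hn
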